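/- Let $n\ge 1$. Let $\mathcal B_{2n}$ be the braid group with standard generators $\sigma_1,\dots,\sigma_{2n-1}$, and let $A(B_n)$ be the Artin group of type $B_n$, generated by $s_1,\dots,s_n$ with the relations $s_1s_2s_1s_2=s_2s_1s_2s_1$, $s_is_{i+1}s_i=s_{i+1}s_is_{i+1}$ for $2\le i\le n-1$, and $s_is_j=s_js_i$ for $|i-j|>1$. Let $\Psi:A(B_n)\to\mathcal B_{2n}$ be the homomorphism with $\Psi(s_1)=\sigma_n$ and $\Psi(s_i)=\sigma_{n+(i-1)}\sigma_{n-(i-1)}$ for $i>1$. Identify $\mathcal B_{2n}$ with the mapping class group of the disc with punctures, from left to right on the real line, $p_n,\dots,p_1,q_1,\dots,q_n$ (where $p_i=-i$, $q_i=i$), $\sigma_k$ being the clockwise half twist exchanging the $k$-th and $(k+1)$-st puncture and products being compositions of maps; let $r(z)=-z$. *Classical simple elements.* For $\mathcal B_{2n}$ these are the positive permutation braids (braids given by a positive word in which any two strands cross at most once); for $A(B_n)$ these are the $x$ such that $\Psi(x)$ is the positive permutation braid of a permutation of the punctures commuting with $r$. The classical Garside elements are the half twist $\Delta_{2n}=(\sigma_1\cdots\sigma_{2n-1})(\sigma_1\cdots\sigma_{2n-2})\cdots\sigma_1$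 in $\mathcal B_{2n}$ and $\Delta=(s_1\cdots s_n)^n$ in $A(B_n)$. *Dual simple elements.* Move the $p_i$ vertically upwards and the $q_i$ vertically downwards onto a circle, so that the clockwise order is $p_n,\dots,p_1,q_n,\dots,q_1$ and $r$ still exchanges $p_i$ and $q_i$. For a collection $Q$ of pairwise disjoint convex polygons (possibly segments) with vertices at the punctures, let $y_Q\in\mathcal B_{2n}$ be the product of the clockwise rotations of these polygons, moving each vertex to the next one; for a segment this is the clockwise half twist along it. The dual simple elements of $\mathcal B_{2n}$ are the $y_Q$; those of $A(B_n)$ are the $y$ with $\Psi(y)=y_Q$ for some $Q$ with $r(Q)=Q$. The dual Garside elements are $\delta_{2n}=y_Q$, for $Q$ the polygon on all the punctures, in $\mathcal B_{2n}$, and $\delta=s_n\cdots s_2s_1$ in $A(B_n)$. *Normal forms.* Given one of these sets $S$ of simple elements with Garside element $D$, let $P$ be the monoid generated by $S$. A normal form of $g$ is an expression $g=x_r\cdots x_1D^p$ with $p\in\mathbb Z$, $r\ge 0$, $x_i\in S\setminus\{1,D\}$, in which all consecutive pairs $x_{i+1}x_i$ are right weighted (every simple suffix of $x_{i+1}x_i$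 is a suffix of $x_i$); the left-greedy version requires them to be left weighted instead (every simple prefix of $x_{i+1}x_i$ is a prefix of $x_{i+1}$). Here $a$ is a prefix (suffix) of $b$ if $a^{-1}b\in P$ (resp. $ba^{-1}\in P$). Then $\Psi$ is injective, $\Psi(\Delta)=\Delta_{2n}$, $\Psi(\delta)=\delta_{2n}$, the classical and the dual simple elements generate $A(B_n)$ and $\mathcal B_{2n}$ respectively, and for every $\beta\in A(B_n)$ the classical and the dual normal forms of $\beta$ and of $\Psi(\beta)$ exist and are unique. If the classical and the dual normal form of $\beta$ are $$x_r\cdots x_1\Delta^p\quad\text{and}\quad y_s\cdots y_1\delta^q,$$ then the classical and the dual normal form of $\Psi(\beta)$ are $$\Psi(x_r)\cdots\Psi(x_1)\Psi(\Delta)^p\quad\text{and}\quad \Psi(y_s)\cdots\Psi(y_1)\Psi(\delta)^q;$$ this holds for the right-greedy and for the left-greedy normal forms. In particular, $\Psi$ is an isometric embedding of $A(B_n)$ into $\mathcal B_{2n}$ for the word metrics given by the classical simple elements of both groups, and for those given by the dual simple elements. -/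

import Mathlib

namespace ArtinB

/-! ### The groups and the homomorphism -/

/-- Braid relations on `m` strands. The index `i : Fin (m - 1)` stands for `σ_{i+1}`. -/
def braidRels (m : ℕ) : Set (FreeGroup (Fin (m - 1))) :=
  {r | ∃ i j : Fin (m - 1),
    (i.val + 1 = j.val ∧
      r = (FreeGroup.of i * FreeGroup.of j * FreeGroup.of i) *
        (FreeGroup.of j * FreeGroup.of i * FreeGroup.of j)⁻¹) ∨
    (i.val + 1 < j.val ∧
      r = (FreeGroup.of i * FreeGroup.of j) * (FreeGroup.of j * FreeGroup.of i)⁻¹)}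

/-- The braid group on `m` strands. -/
abbrev BraidGroup (m : ℕ) : Type := PresentedGroup (braidRels m)

/-- The standard generators of the braid group. -/
def σ {m : ℕ} (i : Fin (m - 1)) : BraidGroup m := PresentedGroup.of i

/-- Relations of the Artin group of type `B_n`. The index `i : Fin n` stands for `s_{i+1}`. -/
def typeBRels (n : ℕ) : Set (FreeGroup (Fin n)) :=
  {r | ∃ i j : Fin n,
    (i.val = 0 ∧ j.val = 1 ∧
      r = (FreeGroup.of i * FreeGroup.of j * FreeGroup.of i * FreeGroup.of j) *
        (FreeGroup.of j * FreeGroup.of i * FreeGroup.of j * FreeGroup.of i)⁻¹) ∨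
    (i.val + 1 < j.val ∧
      r = (FreeGroup.of i * FreeGroup.of j) * (FreeGroup.of j * FreeGroup.of i)⁻¹) ∨
    (1 ≤ i.val ∧ i.val + 1 = j.val ∧
      r = (FreeGroup.of i * FreeGroup.of j * FreeGroup.of i) *
        (FreeGroup.of j * FreeGroup.of i * FreeGroup.of j)⁻¹)}

/-- The Artin group of type `B_n`. -/
abbrev ArtinGroupB (n : ℕ) : Type := PresentedGroup (typeBRels n)

/-- The standard generators of the Artin group of type `B_n`. -/
def s {n : ℕ} (i : Fin n) : ArtinGroupB n := PresentedGroup.of i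

theorem sigma_braid {m : ℕ} (i j : Fin (m - 1)) (h : i.val + 1 = j.val) :
    σ i * σ j * σ i = σ j * σ i * σ j := by
  have := PresentedGroup.one_of_mem (rels := braidRels m) ⟨i, j, Or.inl ⟨h, rfl⟩⟩
  simp only [map_mul, map_inv] at this
  exact mul_inv_eq_one.mp this

theorem sigma_comm {m : ℕ} (i j : Fin (m - 1)) (h : i.val + 1 < j.val) :
    σ i * σ j = σ j * σ i := by
  have := PresentedGroup.one_of_mem (rels := braidRels m) ⟨i, j, Or.inr ⟨h, rfl⟩⟩
  simp only [map_mul, map_inv] at this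
  exact mul_inv_eq_one.mp this

/-- `s_1 ↦ σ_n` and `s_i ↦ σ_{n+(i-1)} σ_{n-(i-1)}` for `i > 1` (one-based indices). -/
def psiGen (n : ℕ) (i : Fin n) : BraidGroup (2 * n) :=
  if i.val = 0 then σ ⟨n - 1, by have := i.isLt; omega⟩
  else σ ⟨n - 1 + i.val, by have := i.isLt; omega⟩ * σ ⟨n - 1 - i.val, by have := i.isLt; omega⟩

theorem four_braid {G : Type} [Group G] (a b c : G) (hab : a * b = b * a)
    (hac : a * c * a = c * a * c) (hbc : b * c * b = c * b * c) :
    c * (a * b) * c * (a * b) = a * b * c * (a * b) * c := by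
  calc c * (a * b) * c * (a * b) = c * a * (b * c * b) * a := by
        rw [hab]; simp only [mul_assoc]; rw [← mul_assoc b a, ← hab, mul_assoc]
    _ = (c * a * c) * (b * c * a) := by rw [hbc]; simp only [mul_assoc]
    _ = a * c * (a * b) * (c * a) := by rw [← hac]; simp only [mul_assoc]
    _ = a * c * b * (a * c * a) := by rw [hab]; simp only [mul_assoc]
    _ = a * (c * b * c) * a * c := by rw [hac]; simp only [mul_assoc]
    _ = a * b * c * (b * a) * c := by rw [← hbc]; simp only [mul_assoc]
    _ = a * b * c * (a * b) * c := by rw [hab]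

theorem double_braid {G : Type} [Group G] (x y x' y' : G) (hx : x * x' * x = x' * x * x')
    (hy : y' * y * y' = y * y' * y) (h1 : Commute y x) (h2 : Commute y x') (h3 : Commute y' x)
    (h4 : Commute y' x') :
    (x * y) * (x' * y') * (x * y) = (x' * y') * (x * y) * (x' * y') := by
  calc (x * y) * (x' * y') * (x * y) = (x * x' * x) * (y * y' * y) := by
        simp only [mul_assoc]
        rw [h2.left_comm, h3.left_comm, h1.left_comm]
    _ = (x' * x * x') * (y' * y * y') := by rw [hx, hy]
    _ = (x' * y') * (x * y) * (x' * y') := by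
        simp only [mul_assoc]
        rw [h3.left_comm, h2.left_comm, h4.left_comm]

theorem psiGen_rels (n : ℕ) (r : FreeGroup (Fin n)) (hr : r ∈ typeBRels n) :
    FreeGroup.lift (psiGen n) r = 1 := by
  have hc : ∀ i j : Fin (2 * n - 1), i.val + 1 < j.val → Commute (σ i) (σ j) :=
    fun i j h => sigma_comm i j h
  obtain ⟨i, j, h⟩ := hr
  have hi := i.isLt
  have hj := j.isLt
  rcases h with ⟨h0, h1, rfl⟩ | ⟨h, rfl⟩ | ⟨h0, h, rfl⟩
  · simp only [map_mul, map_inv, FreeGroup.lift_apply_of, mul_inv_eq_one]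
    have hj0 : j.val ≠ 0 := by omega
    simp only [psiGen, h0, hj0, if_true, if_false]
    refine four_braid _ _ _ ?_ ?_ ?_
    · exact ((hc _ _ (by simp only; omega)).symm).eq
    · exact (sigma_braid _ _ (by simp only; omega)).symm
    · exact sigma_braid _ _ (by simp only; omega)
  · simp only [map_mul, map_inv, FreeGroup.lift_apply_of, mul_inv_eq_one]
    have hj0 : j.val ≠ 0 := by omega
    by_cases hi0 : i.val = 0
    · simp only [psiGen, hi0, hj0, if_true, if_false]
      refine (Commute.mul_right ?_ ?_).eq
      · exact hc _ _ (by simp only; omega)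
      · exact (hc _ _ (by simp only; omega)).symm
    · simp only [psiGen, hi0, hj0, if_false]
      refine (Commute.mul_left (Commute.mul_right ?_ ?_) (Commute.mul_right ?_ ?_)).eq
      · exact hc _ _ (by simp only; omega)
      · exact (hc _ _ (by simp only; omega)).symm
      · exact hc _ _ (by simp only; omega)
      · exact (hc _ _ (by simp only; omega)).symm
  · simp only [map_mul, map_inv, FreeGroup.lift_apply_of, mul_inv_eq_one]
    have hj0 : j.val ≠ 0 := by omega
    have hi0 : i.val ≠ 0 := by omega
    simp only [psiGen, hi0, hj0, if_false]
    refine double_braid _ _ _ _ ?_ ?_ ?_ ?_ ?_ ?_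
    · exact sigma_braid _ _ (by simp only; omega)
    · exact sigma_braid _ _ (by simp only; omega)
    · exact hc _ _ (by simp only; omega)
    · exact hc _ _ (by simp only; omega)
    · exact hc _ _ (by simp only; omega)
    · exact hc _ _ (by simp only; omega)

/-- The homomorphism `Ψ : A(B_n) → B_{2n}`. -/
def Psi (n : ℕ) : ArtinGroupB n →* BraidGroup (2 * n) :=
  PresentedGroup.toGroup (f := psiGen n) (psiGen_rels n)

/-! ### Classical simple elements

The punctures on the real line, from left to right, are numbered `0, …, m - 1`; `σ i` is the
clockwise half twist that exchanges the punctures `i` and `i + 1`. -/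

/-- The transposition of two neighbouring positions. -/
def adjSwap {m : ℕ} (i : Fin (m - 1)) : Equiv.Perm (Fin m) :=
  Equiv.swap ⟨i.val, by omega⟩ ⟨i.val + 1, by omega⟩

/-- The number of inversions of a permutation. -/
def inversions {m : ℕ} (w : Equiv.Perm (Fin m)) : ℕ :=
  (Finset.univ.filter fun p : Fin m × Fin m => p.1 < p.2 ∧ w p.2 < w p.1).card

/-- `b` is the positive permutation braid of `w`: it is represented by a positive word with
permutation `w` in which every two strands cross at most once. This is the dance of the punctures
that first turns their line clockwise by a right angle, then moves them horizontally to the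
abscissae prescribed by `w`, then moves them vertically back to the real line: a pair of punctures
makes a clockwise half turn around each other if `w` inverts it, and none otherwise. -/
def IsDance {m : ℕ} (w : Equiv.Perm (Fin m)) (b : BraidGroup m) : Prop :=
  ∃ L : List (Fin (m - 1)),
    (L.map σ).prod = b ∧ (L.map adjSwap).prod = w ∧ L.length = inversions w

/-- The classical simple elements of the braid group. -/
def classicalSimpleA (m : ℕ) : Set (BraidGroup m) :=
  {b | ∃ w : Equiv.Perm (Fin m), IsDance w b}

/-- The classical simple elements of `A(B_n)`: those that act on the `2n`-punctured disc by a dance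
symmetric under the half turn `z ↦ -z`, which exchanges the positions `i` and `2n - 1 - i`. -/
def classicalSimpleB (n : ℕ) : Set (ArtinGroupB n) :=
  {x | ∃ w : Equiv.Perm (Fin (2 * n)), (∀ i, w i.rev = (w i).rev) ∧ IsDance w (Psi n x)}

/-- `σ_1 σ_2 ⋯ σ_k` for `k ≤ m - 1`. -/
def sigmaRun (m k : ℕ) (hk : k ≤ m - 1) : BraidGroup m :=
  (List.ofFn fun i : Fin k => σ (m := m) (Fin.castLE hk i)).prod

/-- The half turn `Δ = (σ_1 ⋯ σ_{m-1}) (σ_1 ⋯ σ_{m-2}) ⋯ (σ_1 σ_2) σ_1` of the braid group. -/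
def DeltaA (m : ℕ) : BraidGroup m :=
  (List.ofFn fun j : Fin (m - 1) => sigmaRun m (m - 1 - j.val) (by omega)).prod

/-- The classical Garside element `Δ = (s_1 s_2 ⋯ s_n)^n` of `A(B_n)`. -/
def DeltaB (n : ℕ) : ArtinGroupB n := (List.ofFn fun i : Fin n => s i).prod ^ n

/-! ### Dual simple elements

The punctures are moved vertically onto a circle, the left ones `p_n, …, p_1` (positions
`0, …, n - 1` on the line) upwards and the right ones `q_1, …, q_n` (positions `n, …, 2n - 1`)
downwards, so that the circle is symmetric under the half turn. Clockwise, the punctures on the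
circle are then `p_n, …, p_1, q_n, …, q_1`; they are numbered `0, …, 2n - 1` in this order. -/

/-- The position on the line of the `c`-th puncture on the circle. -/
def linePos (n c : ℕ) : ℕ := if c < n then c else 3 * n - 1 - c

/-- The generator `σ` by natural number index (only used for `i < 2n - 1`). -/
def sigmaNat (n i : ℕ) : BraidGroup (2 * n) :=
  if h : i < 2 * n - 1 then σ ⟨i, h⟩ else 1

/-- The clockwise half twist along the arc from the line position `i` to `i + 1 + k` that becomes a
chord of the circle, i.e. that passes below the left and above the right punctures in between.
The half twist `σ_j` (resp. its inverse) carries an arc ending at `j` to one that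
passes above (resp. below) the puncture `j` and ends at `j + 1`. -/
def band (n i : ℕ) : ℕ → BraidGroup (2 * n)
  | 0 => sigmaNat n i
  | k + 1 =>
    if i + 1 + k < n then (sigmaNat n (i + 1 + k))⁻¹ * band n i k * sigmaNat n (i + 1 + k)
    else sigmaNat n (i + 1 + k) * band n i k * (sigmaNat n (i + 1 + k))⁻¹

/-- The clockwise half twist along the chord joining two distinct punctures `c`, `d` of the
circle. -/
def chordTwist (n : ℕ) (c d : Fin (2 * n)) : BraidGroup (2 * n) :=
  band n (min (linePos n c) (linePos n d))
    (max (linePos n c) (linePos n d) - min (linePos n c) (linePos n d) - 1)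

/-- The clockwise rotation of the convex polygon with vertex set `P`, each vertex moving to the
next one. If `v_1, …, v_k` are the vertices in clockwise order, this is the product of the half
twists along `v_1 v_2`, …, `v_{k-1} v_k` (products are compositions of maps). -/
def polygonRotation (n : ℕ) (P : Finset (Fin (2 * n))) : BraidGroup (2 * n) :=
  (List.zipWith (chordTwist n) P.sort P.sort.tail).prod

/-- The convex hulls of two sets of points on the circle are disjoint. -/
def NonCrossing {k : ℕ} (P Q : Finset (Fin k)) : Prop :=
  Disjoint P Q ∧ ∀ a ∈ P, ∀ c ∈ P, ∀ b ∈ Q, ∀ d ∈ Q,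
    ¬ (a < b ∧ b < c ∧ c < d) ∧ ¬ (b < a ∧ a < d ∧ d < c)

/-- A collection of disjoint convex polygons (segments included) with vertices at the punctures. -/
def IsPolygonCollection {n : ℕ} (Q : List (Finset (Fin (2 * n)))) : Prop :=
  (∀ P ∈ Q, 2 ≤ P.card) ∧ Q.Pairwise NonCrossing

/-- The half turn on the circle of punctures. -/
def halfTurn {n : ℕ} (c : Fin (2 * n)) : Fin (2 * n) :=
  ⟨(c.val + n) % (2 * n), Nat.mod_lt _ (by have := c.isLt; omega)⟩

/-- The collection is invariant under the half turn. -/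
def IsSymmetric {n : ℕ} (Q : List (Finset (Fin (2 * n)))) : Prop :=
  ∀ P ∈ Q, P.image halfTurn ∈ Q

/-- The braid `y_Q` of a collection of polygons (the factors commute). -/
def collectionRotation (n : ℕ) (Q : List (Finset (Fin (2 * n)))) : BraidGroup (2 * n) :=
  (Q.map (polygonRotation n)).prod

/-- The dual simple elements of the braid group on `2n` strands. -/
def dualSimpleA (n : ℕ) : Set (BraidGroup (2 * n)) :=
  {b | ∃ Q, IsPolygonCollection Q ∧ b = collectionRotation n Q}

/-- The dual simple elements of `A(B_n)`. -/
def dualSimpleB (n : ℕ) : Set (ArtinGroupB n) :=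
  {y | ∃ Q, IsPolygonCollection Q ∧ IsSymmetric Q ∧ Psi n y = collectionRotation n Q}

/-- The dual Garside element of the braid group: rotation of the polygon of all punctures. -/
def deltaA (n : ℕ) : BraidGroup (2 * n) := polygonRotation n Finset.univ

/-- The dual Garside element `δ = s_n ⋯ s_2 s_1` of `A(B_n)`. -/
def deltaB (n : ℕ) : ArtinGroupB n := (List.ofFn fun i : Fin n => s i.rev).prod

/-! ### Garside normal forms and word metrics

Here `S` is the set of simple elements of a Garside structure and `D` its Garside element. -/

/-- `a` is a prefix of `b` (for the monoid generated by the simple elements). -/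
def IsPrefix {G : Type*} [Group G] (S : Set G) (a b : G) : Prop :=
  a⁻¹ * b ∈ Submonoid.closure S

/-- `a` is a suffix of `b`. -/
def IsSuffix {G : Type*} [Group G] (S : Set G) (a b : G) : Prop :=
  b * a⁻¹ ∈ Submonoid.closure S

/-- `x · y` is left weighted: `x` is the greatest simple prefix of `x * y`. -/
def LeftWeighted {G : Type*} [Group G] (S : Set G) (x y : G) : Prop :=
  ∀ t ∈ S, IsPrefix S t (x * y) → IsPrefix S t x

/-- `x · y` is right weighted: `y` is the greatest simple suffix of `x * y`. -/
def RightWeighted {G : Type*} [Group G] (S : Set G) (x y : G) : Prop :=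
  ∀ t ∈ S, IsSuffix S t (x * y) → IsSuffix S t y

/-- `x_r ⋯ x_1 D ^ p`, with `xs = [x_r, …, x_1]`, is the left-greedy normal form of `g`. -/
structure IsLeftNormalForm {G : Type*} [Group G] (S : Set G) (D g : G)
    (xs : List G) (p : ℤ) : Prop where
  eq_prod : g = xs.prod * D ^ p
  proper_simple : ∀ x ∈ xs, x ∈ S ∧ x ≠ 1 ∧ x ≠ D
  weighted : xs.IsChain (LeftWeighted S)

/-- `x_r ⋯ x_1 D ^ p`, with `xs = [x_r, …, x_1]`, is the right-greedy normal form of `g`. -/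
structure IsRightNormalForm {G : Type*} [Group G] (S : Set G) (D g : G)
    (xs : List G) (p : ℤ) : Prop where
  eq_prod : g = xs.prod * D ^ p
  proper_simple : ∀ x ∈ xs, x ∈ S ∧ x ≠ 1 ∧ x ≠ D
  weighted : xs.IsChain (RightWeighted S)

/-- Word length with respect to a generating set `S`. -/
noncomputable def wordLength {G : Type*} [Group G] (S : Set G) (g : G) : ℕ :=
  sInf {k | ∃ l : List G, l.length = k ∧ (∀ x ∈ l, x ∈ S ∨ x⁻¹ ∈ S) ∧ l.prod = g}

/-- The (left-invariant) word metric with respect to a generating set `S`. -/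
noncomputable def wordDist {G : Type*} [Group G] (S : Set G) (g h : G) : ℕ :=
  wordLength S (g⁻¹ * h)

end ArtinB

/-! Everything follows from one fact: `Ψ` is injective and its image is the centralizer of a power
`D ^ k` of the Garside element of the braid group, with `D = Δ` and `k = 1` in the classical case,
`D = δ` and `k = n` in the dual case (`IsCentralizerEmbedding`). Conjugation by `D ^ k` preserves
the simple elements and the prefix order, so it fixes the greatest simple prefix of every positive
element that it fixes (`commute_of_isHead`). Hence greatest simple prefixes of positive elements of
the image stay in the image. The preimage of the simple elements is therefore itself a Garside
structure (`preimage`), weighted pairs go to weighted pairs (`leftWeighted_map`), and so normal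
forms go to normal forms. A word in simple elements and inverses that represents an element of the
image can be rewritten inside the image without changing its length (`wordLength_map`), which gives
the isometry. Right-greedy forms are treated in the opposite group.

Three things remain. First, the braid group must be shown to be Garside for both families. In each
case the simple elements come from an interval `[1, top]` of a group with a subadditive length:
permutations counted by inversions below the order-reversing one, and permutations with the absolute
length below the long cycle, which are the noncrossing ones. If greatest common prefixes exist, a
simple element acts greedily on sequences of simple elements; this gives normal forms and
cancellation in the monoid of the germ, and the action on fractions embeds the monoid in the group
(`incl_injective`). Common prefixes and well-definedness of the lifted braid are checked on pairs of
atoms only, in the manner of Matsumoto's theorem (`IsAtomic`). The atoms are adjacent transpositions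
in the classical case and chords of the circle, with the Birman-Ko-Lee relations, in the dual case.

Second, the centralizer must be identified. The permutations commuting with the half turn form a
germ whose group is `A(B_n)`; comparing normal forms shows that `Ψ` is injective (`Psi_injective`).
An element commuting with `Δ` is, up to a power of `Δ`, a product of permutation braids commuting
with `Δ`, and these belong to symmetric permutations. The dual case needs no second analysis: `δ ^
n` and `Δ` conjugate the generators `σ i` in the same way, so they have the same centralizer
(`commute_deltaA_pow_iff`).

Third, the simple elements of `A(B_n)` must be exactly the elements with simple image: the required
symmetry is automatic for elements of the centralizer (`classicalSimpleB_eq`, `dualSimpleB_eq`). -/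

namespace ArtinB

/-! ### Interval germs

A group with a subadditive length function and a distinguished element `top` gives rise to a
germ, the interval `[1, top]` for the prefix order. -/

/-- A group with a length function and a distinguished element. -/
structure IntervalGerm (W : Type) [Group W] where
  len : W → ℕ
  top : W
  len_one : len 1 = 0
  len_mul_le : ∀ u v, len (u * v) ≤ len u + len v
  eq_one_of_len : ∀ u, len u = 0 → u = 1
  len_conj : ∀ u, len (top⁻¹ * u * top) = len u

namespace IntervalGerm

variable {W : Type} [Group W] (I : IntervalGerm W)

/-- The prefix relation. -/
def Pre (u v : W) : Prop := I.len u + I.len (u⁻¹ * v) = I.len v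

/-- The elements of the interval `[1, top]`. -/
def Simple (u : W) : Prop := I.Pre u I.top

/-- Any two elements of the interval have a greatest common prefix. -/
def HasMeets : Prop := ∀ u v, I.Simple u → I.Simple v →
  ∃ w, I.Pre w u ∧ I.Pre w v ∧ ∀ z, I.Pre z u → I.Pre z v → I.Pre z w

variable {I}

theorem len_le_add (u v : W) : I.len v ≤ I.len u + I.len (u⁻¹ * v) := by
  simpa using I.len_mul_le u (u⁻¹ * v)

theorem pre_refl (u : W) : I.Pre u u := by simp [Pre, I.len_one]

theorem one_pre (u : W) : I.Pre 1 u := by simp [Pre, I.len_one]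

theorem pre_mul_iff (u v : W) : I.Pre u (u * v) ↔ I.len u + I.len v = I.len (u * v) := by
  simp [Pre]

theorem pre_trans {u v w : W} (h1 : I.Pre u v) (h2 : I.Pre v w) : I.Pre u w := by
  have h3 := I.len_mul_le (u⁻¹ * v) (v⁻¹ * w)
  have h4 := I.len_le_add u w
  rw [mul_assoc, mul_inv_cancel_left] at h3
  unfold Pre at *
  omega

theorem pre_antisymm {u v : W} (h1 : I.Pre u v) (h2 : I.Pre v u) : u = v := by
  have : I.len (u⁻¹ * v) = 0 := by unfold Pre at *; omega
  exact inv_mul_eq_one.mp (I.eq_one_of_len _ this)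

theorem pre_quot {u v w : W} (h1 : I.Pre u v) (h2 : I.Pre v w) :
    I.Pre (u⁻¹ * v) (u⁻¹ * w) := by
  have h3 := pre_trans h1 h2
  have h4 : (u⁻¹ * v)⁻¹ * (u⁻¹ * w) = v⁻¹ * w := by group
  unfold Pre at *
  rw [h4]
  omega

/-- Subadditivity bounds `len (a * w)` by `len (a * v) + len (v⁻¹ * w)`, and this by `len a + len
w`. The outer terms agree, so both inequalities are equalities. -/
theorem pre_mul_of_pre {a v w : W} (h1 : I.Pre a (a * w)) (h2 : I.Pre v w) :
    I.Pre a (a * v) ∧ I.Pre (a * v) (a * w) := by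
  have h3 := I.len_mul_le a v
  have h4 := I.len_le_add (a * v) (a * w)
  have h5 : (a * v)⁻¹ * (a * w) = v⁻¹ * w := by group
  rw [pre_mul_iff] at *
  unfold Pre at *
  rw [h5] at h4 ⊢
  constructor <;> omega

theorem simple_one : I.Simple 1 := one_pre _

theorem simple_top : I.Simple I.top := pre_refl _

/-- The complement of the complement is the conjugate of `u` by `top`, which has the length of `u`.
-/
theorem simple_compl {u : W} (h : I.Simple u) : I.Simple (u⁻¹ * I.top) := by
  have h1 : (u⁻¹ * I.top)⁻¹ * I.top = I.top⁻¹ * u * I.top := by group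
  have h2 := I.len_conj u
  unfold Simple Pre at *
  rw [h1]
  omega

theorem simple_of_pre {u v : W} (h1 : I.Pre u v) (h2 : I.Simple v) : I.Simple u :=
  pre_trans h1 h2

theorem simple_quot {u v : W} (h1 : I.Pre u v) (h2 : I.Simple v) : I.Simple (u⁻¹ * v) :=
  pre_trans (pre_quot h1 h2) (simple_compl (pre_trans h1 h2))

theorem simple_of_mul {u v : W} (h1 : I.Pre u (u * v)) (h2 : I.Simple (u * v)) : I.Simple v := by
  simpa using simple_quot h1 h2

/-- The part of `x` that `a` can absorb is thus a common prefix of `x` and the complement of `a`, so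
meets provide a largest one. -/
theorem pre_compl_iff {a : W} (ha : I.Simple a) (v : W) :
    I.Pre v (a⁻¹ * I.top) ↔ I.Pre a (a * v) ∧ I.Simple (a * v) := by
  constructor
  · intro h
    have := pre_mul_of_pre (a := a) (w := a⁻¹ * I.top) (by simpa [Simple] using ha) h
    simpa [Simple] using this
  · rintro ⟨h1, h2⟩
    simpa using pre_quot h1 h2

theorem len_conj' (u : W) : I.len (I.top * u * I.top⁻¹) = I.len u := by
  rw [← I.len_conj (I.top * u * I.top⁻¹)]
  congr 1
  group

theorem pre_conj {u v : W} (h : I.Pre u v) :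
    I.Pre (I.top⁻¹ * u * I.top) (I.top⁻¹ * v * I.top) := by
  have h1 : (I.top⁻¹ * u * I.top)⁻¹ * (I.top⁻¹ * v * I.top) = I.top⁻¹ * (u⁻¹ * v) * I.top := by
    group
  unfold Pre at *
  rw [h1, I.len_conj, I.len_conj, I.len_conj, h]

theorem pre_conj' {u v : W} (h : I.Pre u v) :
    I.Pre (I.top * u * I.top⁻¹) (I.top * v * I.top⁻¹) := by
  have h1 : (I.top * u * I.top⁻¹)⁻¹ * (I.top * v * I.top⁻¹) = I.top * (u⁻¹ * v) * I.top⁻¹ := by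
    group
  unfold Pre at *
  rw [h1, I.len_conj', I.len_conj', I.len_conj', h]

theorem simple_conj {u : W} (h : I.Simple u) : I.Simple (I.top⁻¹ * u * I.top) := by
  simpa [Simple] using pre_conj h

theorem simple_conj' {u : W} (h : I.Simple u) : I.Simple (I.top * u * I.top⁻¹) := by
  simpa [Simple] using pre_conj' h

/-- A map that is multiplicative on the germ. -/
def IsMorphism (I : IntervalGerm W) {N : Type} [Mul N] (f : W → N) : Prop :=
  ∀ u v, I.Pre u (u * v) → I.Simple (u * v) → f (u * v) = f u * f v

/-! ### The monoid of a germ -/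

variable (I) in
/-- The simple elements as a type. -/
abbrev Simples : Type := {u : W // I.Simple u}

instance : One I.Simples := ⟨⟨1, simple_one⟩⟩

@[simp] theorem coe_one : ((1 : I.Simples) : W) = 1 := rfl

variable (I) in
/-- The defining relations of the monoid of a germ. -/
def monoidRels (x y : FreeMonoid I.Simples) : Prop :=
  (x = FreeMonoid.of 1 ∧ y = 1) ∨
  ∃ a b d : I.Simples, d.1 = a.1 * b.1 ∧ I.Pre a.1 d.1 ∧
    x = FreeMonoid.of a * FreeMonoid.of b ∧ y = FreeMonoid.of d

variable (I) in
/-- The monoid of a germ. -/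
abbrev GMonoid : Type := PresentedMonoid I.monoidRels

/-- A simple element as an element of the monoid. -/
def gen (a : I.Simples) : I.GMonoid := PresentedMonoid.of I.monoidRels a

theorem gen_one : gen (1 : I.Simples) = 1 :=
  PresentedMonoid.mk_eq_mk_of_rel (Or.inl ⟨rfl, rfl⟩)

theorem gen_mul {a b d : I.Simples} (h : d.1 = a.1 * b.1) (h' : I.Pre a.1 d.1) :
    gen a * gen b = gen d :=
  PresentedMonoid.mk_eq_mk_of_rel (Or.inr ⟨a, b, d, h, h', rfl, rfl⟩)

theorem gmonoid_induction {p : I.GMonoid → Prop} (m : I.GMonoid) (one : p 1)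
    (mul : ∀ a m, p m → p (gen a * m)) : p m := by
  have h : m ∈ Submonoid.closure (Set.range (PresentedMonoid.of I.monoidRels)) := by
    rw [PresentedMonoid.closure_range_of]; trivial
  induction h using Submonoid.closure_induction_left with
  | one => exact one
  | mul_left x hx y _ ih =>
    obtain ⟨a, rfl⟩ := hx
    exact mul a y ih

/-- The homomorphism from the monoid of a germ given by a map multiplicative on the germ. -/
def liftM {N : Type} [Monoid N] (f : I.Simples → N) (h1 : f 1 = 1)
    (h : ∀ a b d : I.Simples, d.1 = a.1 * b.1 → I.Pre a.1 d.1 → f d = f a * f b) :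
    I.GMonoid →* N :=
  PresentedMonoid.lift f (by
    rintro x y (⟨rfl, rfl⟩ | ⟨a, b, d, hd, hp, rfl, rfl⟩)
    · simp [h1]
    · simp [h a b d hd hp])

theorem liftM_gen {N : Type} [Monoid N] (f : I.Simples → N) (h1 h) (a : I.Simples) :
    liftM f h1 h (gen a) = f a := rfl

/-! ### The action on sequences of simple elements -/

section Streams

variable (hm : I.HasMeets)

/-- The greatest prefix `p` of `x` such that `a * p` is simple. -/
noncomputable def absorbed (a x : I.Simples) : W :=
  (hm x.1 (a.1⁻¹ * I.top) x.2 (simple_compl a.2)).choose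

theorem absorbed_pre (a x : I.Simples) : I.Pre (absorbed hm a x) x.1 :=
  (hm x.1 (a.1⁻¹ * I.top) x.2 (simple_compl a.2)).choose_spec.1

theorem absorbed_mul (a x : I.Simples) :
    I.Pre a.1 (a.1 * absorbed hm a x) ∧ I.Simple (a.1 * absorbed hm a x) :=
  (pre_compl_iff a.2 _).1 (hm x.1 (a.1⁻¹ * I.top) x.2 (simple_compl a.2)).choose_spec.2.1

theorem pre_absorbed (a x : I.Simples) (z : W) (hz : I.Pre z x.1) (h1 : I.Pre a.1 (a.1 * z))
    (h2 : I.Simple (a.1 * z)) : I.Pre z (absorbed hm a x) :=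
  (hm x.1 (a.1⁻¹ * I.top) x.2 (simple_compl a.2)).choose_spec.2.2 z hz
    ((pre_compl_iff a.2 _).2 ⟨h1, h2⟩)

theorem absorbed_unique (a x : I.Simples) (p : W) (hp : I.Pre p x.1) (h1 : I.Pre a.1 (a.1 * p))
    (h2 : I.Simple (a.1 * p))
    (h : ∀ z, I.Pre z x.1 → I.Pre a.1 (a.1 * z) → I.Simple (a.1 * z) → I.Pre z p) :
    absorbed hm a x = p :=
  pre_antisymm (h _ (absorbed_pre hm a x) (absorbed_mul hm a x).1 (absorbed_mul hm a x).2)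
    (pre_absorbed hm a x p hp h1 h2)

/-- The first entry of the greedy decomposition of `a * x`. -/
noncomputable def lead (a x : I.Simples) : I.Simples :=
  ⟨a.1 * absorbed hm a x, (absorbed_mul hm a x).2⟩

/-- The second entry of the greedy decomposition of `a * x`. -/
noncomputable def rest (a x : I.Simples) : I.Simples :=
  ⟨(absorbed hm a x)⁻¹ * x.1, simple_quot (absorbed_pre hm a x) x.2⟩

theorem gen_lead_mul_gen_rest (a x : I.Simples) :
    gen (lead hm a x) * gen (rest hm a x) = gen a * gen x := by
  have h1 := gen_mul (I := I) (a := a)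
    (b := ⟨absorbed hm a x, simple_of_pre (absorbed_pre hm a x) x.2⟩)
    (d := lead hm a x) rfl (absorbed_mul hm a x).1
  have h2 := gen_mul (I := I)
    (a := ⟨absorbed hm a x, simple_of_pre (absorbed_pre hm a x) x.2⟩)
    (b := rest hm a x) (d := x) (by simp [rest]) (absorbed_pre hm a x)
  rw [← h1, mul_assoc, h2]

theorem absorbed_one_left (x : I.Simples) : absorbed hm 1 x = x.1 :=
  absorbed_unique hm _ _ _ (pre_refl _) (by simpa using one_pre _) (by simpa using x.2)
    fun _ h _ _ => h

theorem absorbed_one_right (a : I.Simples) : absorbed hm a 1 = 1 :=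
  absorbed_unique hm _ _ _ (pre_refl _) (by simpa using pre_refl _) (by simpa using a.2)
    fun _ h _ _ => h

theorem lead_one_left (x : I.Simples) : lead hm 1 x = x :=
  Subtype.ext (by simp [lead, absorbed_one_left])

theorem rest_one_left (x : I.Simples) : rest hm 1 x = 1 :=
  Subtype.ext (by simp [rest, absorbed_one_left])

theorem lead_one_right (a : I.Simples) : lead hm a 1 = a :=
  Subtype.ext (by simp [lead, absorbed_one_right])

theorem rest_one_right (a : I.Simples) : rest hm a 1 = 1 :=
  Subtype.ext (by simp [rest, absorbed_one_right])

/-- The factor that is left over after `a` has passed the first `k` entries of `x`. -/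
noncomputable def carry (a : I.Simples) (x : ℕ → I.Simples) : ℕ → I.Simples
  | 0 => a
  | k + 1 => rest hm (carry a x k) (x k)

/-- The action of a simple element on a sequence of simple elements. -/
noncomputable def act (a : I.Simples) (x : ℕ → I.Simples) (k : ℕ) : I.Simples :=
  lead hm (carry hm a x k) (x k)

/-- Passing `d = a * b` through `x` amounts to passing `b` and then `a`. If `d` absorbs `u` from
`x`, then `a` absorbs exactly `b * u` from `lead b x`. This is what makes the greedy rule an action
of the monoid. -/
theorem lead_rest_mul {a b d x : I.Simples} (hd : d.1 = a.1 * b.1) (h : I.Pre a.1 d.1) :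
    lead hm d x = lead hm a (lead hm b x) ∧
    (rest hm d x).1 = (rest hm a (lead hm b x)).1 * (rest hm b x).1 ∧
    I.Pre (rest hm a (lead hm b x)).1 (rest hm d x).1 := by
  set u := absorbed hm d x with hu
  have hux : I.Pre u x.1 := absorbed_pre hm d x
  obtain ⟨h1, h2⟩ := absorbed_mul hm d x
  rw [← hu] at h1 h2
  have h3 : I.Pre a.1 (a.1 * (b.1 * u)) := by rw [← mul_assoc, ← hd]; exact pre_trans h h1
  have h4 : I.Simple (a.1 * (b.1 * u)) := by rw [← mul_assoc, ← hd]; exact h2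
  have h5 : I.Pre b.1 (b.1 * u) := by
    have := pre_quot h h1
    rwa [hd, mul_assoc, inv_mul_cancel_left, inv_mul_cancel_left] at this
  have h6 : I.Simple (b.1 * u) := simple_of_mul h3 h4
  have huv : I.Pre u (absorbed hm b x) := pre_absorbed hm b x u hux h5 h6
  have hkey : absorbed hm a (lead hm b x) = b.1 * u := by
    refine absorbed_unique hm _ _ _ ?_ h3 h4 ?_
    · exact (pre_mul_of_pre (absorbed_mul hm b x).1 huv).2
    · intro z hz hz1 hz2
      have hbz : I.Pre (absorbed hm a (lead hm b x)) (lead hm b x).1 := absorbed_pre hm _ _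
      obtain ⟨hp1, hp2⟩ := absorbed_mul hm a (lead hm b x)
      have hzp := pre_absorbed hm a (lead hm b x) z hz hz1 hz2
      -- Since `a * b` is simple, `b` alone can be absorbed, so the largest absorbed prefix begins
      -- with `b`; what follows `b` is a prefix of `x` that `d` could absorb.
      have hbp : I.Pre b.1 (absorbed hm a (lead hm b x)) := by
        refine pre_absorbed hm a (lead hm b x) b.1 (absorbed_mul hm b x).1 ?_ ?_
        · rw [← hd]; exact h
        · rw [← hd]; exact d.2
      refine pre_trans hzp ?_
      set p := absorbed hm a (lead hm b x) with hpdef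
      obtain ⟨q, hq⟩ : ∃ q, p = b.1 * q := ⟨b.1⁻¹ * p, by simp⟩
      rw [hq] at hbp hbz hp1 hp2 ⊢
      have hqx : I.Pre q x.1 := by
        have h7 := pre_quot hbp hbz
        simp only [inv_mul_cancel_left, lead] at h7
        exact pre_trans h7 (absorbed_pre hm b x)
      have h8 : I.Pre d.1 (d.1 * q) := by
        rw [hd, mul_assoc]
        exact (pre_mul_of_pre hp1 hbp).2
      have h9 : I.Simple (d.1 * q) := by rw [hd, mul_assoc]; exact hp2
      exact (pre_mul_of_pre h5 (pre_absorbed hm d x q hqx h8 h9)).2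
  have hr : (rest hm d x).1 = (rest hm a (lead hm b x)).1 * (rest hm b x).1 := by
    simp only [rest, hkey, ← hu]
    simp only [lead]
    group
  refine ⟨Subtype.ext ?_, hr, ?_⟩
  · change d.1 * u = a.1 * absorbed hm a (lead hm b x)
    rw [hkey, hd, mul_assoc]
  · simp only [rest, hkey, ← hu]
    simp only [lead]
    have h10 := pre_quot huv (absorbed_pre hm b x)
    simpa [mul_assoc] using h10

theorem carry_mul {a b d : I.Simples} (hd : d.1 = a.1 * b.1) (h : I.Pre a.1 d.1)
    (x : ℕ → I.Simples) (k : ℕ) :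
    (carry hm d x k).1 = (carry hm a (act hm b x) k).1 * (carry hm b x k).1 ∧
    I.Pre (carry hm a (act hm b x) k).1 (carry hm d x k).1 := by
  induction k with
  | zero => exact ⟨hd, h⟩
  | succ k ih => exact (lead_rest_mul hm ih.1 ih.2).2

theorem act_mul {a b d : I.Simples} (hd : d.1 = a.1 * b.1) (h : I.Pre a.1 d.1)
    (x : ℕ → I.Simples) : act hm d x = act hm a (act hm b x) := by
  funext k
  have := carry_mul hm hd h x k
  exact (lead_rest_mul hm this.1 this.2).1

theorem act_one (x : ℕ → I.Simples) : act hm 1 x = x := by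
  have h : ∀ k, carry hm 1 x k = 1 := by
    intro k
    induction k with
    | zero => rfl
    | succ k ih => simp [carry, ih, rest_one_left]
  funext k
  simp [act, h, lead_one_left]

/-- The action of the monoid of a germ on sequences. -/
noncomputable def actM : I.GMonoid →* Function.End (ℕ → I.Simples) :=
  liftM (N := Function.End (ℕ → I.Simples)) (fun a => act hm a) (funext fun x => act_one hm x)
    fun _ _ _ hd h => funext fun x => act_mul hm hd h x

/-- The sequence `x` is finite and its product is `m`. -/
def Eval (x : ℕ → I.Simples) (m : I.GMonoid) : Prop :=
  ∃ k, (∀ j, k ≤ j → x j = 1) ∧ ((List.range k).map fun j => gen (x j)).prod = m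

theorem eval_unique {x : ℕ → I.Simples} {m m' : I.GMonoid} (h : Eval x m) (h' : Eval x m') :
    m = m' := by
  have key : ∀ k, (∀ j, k ≤ j → x j = 1) → ∀ i,
      ((List.range (k + i)).map fun j => gen (x j)).prod =
        ((List.range k).map fun j => gen (x j)).prod := by
    intro k hk i
    induction i with
    | zero => rfl
    | succ i ih =>
      rw [← add_assoc, List.range_succ, List.map_append, List.prod_append, ih]
      simp [hk (k + i) (by omega), gen_one]
  obtain ⟨k, hk, rfl⟩ := h
  obtain ⟨l, hl, rfl⟩ := h'
  rw [← key k hk l, ← key l hl k, add_comm]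

theorem eval_act {x : ℕ → I.Simples} {m : I.GMonoid} (a : I.Simples) (h : Eval x m) :
    Eval (act hm a x) (gen a * m) := by
  obtain ⟨k, hk, rfl⟩ := h
  have key : ∀ i, gen a * ((List.range i).map fun j => gen (x j)).prod =
      ((List.range i).map fun j => gen (act hm a x j)).prod * gen (carry hm a x i) := by
    intro i
    induction i with
    | zero => simp [carry]
    | succ i ih =>
      simp only [List.range_succ, List.map_append, List.prod_append, List.map_cons, List.map_nil,
        List.prod_cons, List.prod_nil, mul_one]
      rw [← mul_assoc, ih, mul_assoc, ← gen_lead_mul_gen_rest hm, mul_assoc]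
      rfl
  -- The entry `k` of `x` is trivial and takes up the whole carry, so the carry vanishes only from
  -- `k + 1` on and the new sequence may be one longer.
  have hc : ∀ j, k < j → carry hm a x j = 1 := by
    intro j hj
    obtain ⟨j, rfl⟩ : ∃ i, j = i + 1 := ⟨j - 1, by omega⟩
    simp [carry, hk j (by omega), rest_one_right]
  refine ⟨k + 1, fun j hj => ?_, ?_⟩
  · simp [act, hc j (by omega), hk j (by omega), lead_one_left]
  · rw [key k, List.range_succ, List.map_append, List.prod_append]
    simp [act, hk k le_rfl, lead_one_right]

/-- The greedy normal form of an element of the monoid. -/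
noncomputable def nf (m : I.GMonoid) : ℕ → I.Simples := actM hm m fun _ => 1

theorem nf_one : nf hm 1 = fun _ => 1 := by
  unfold nf
  rw [map_one]
  rfl

theorem nf_gen_mul (a : I.Simples) (m : I.GMonoid) :
    nf hm (gen a * m) = act hm a (nf hm m) := by
  unfold nf
  rw [map_mul]
  rfl

theorem eval_nf (m : I.GMonoid) : Eval (nf hm m) m := by
  induction m using gmonoid_induction with
  | one => exact ⟨0, fun _ _ => by rw [nf_one], by simp⟩
  | mul a m ih => rw [nf_gen_mul]; exact eval_act hm a ih

theorem Eval.tail {x : ℕ → I.Simples} {m : I.GMonoid} (h : Eval x m) :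
    ∃ m', Eval (fun k => x (k + 1)) m' ∧ m = gen (x 0) * m' := by
  obtain ⟨k, hk, rfl⟩ := h
  refine ⟨_, ⟨k, fun j hj => hk _ (by omega), rfl⟩, ?_⟩
  have h0 : ((List.range k).map fun j => gen (x j)).prod =
      ((List.range (k + 1)).map fun j => gen (x j)).prod := by
    rw [List.range_succ, List.map_append, List.prod_append]
    simp [hk k le_rfl, gen_one]
  rw [h0, List.range_succ_eq_map]
  simp [Function.comp_def]

/-- The greatest simple prefix. -/
noncomputable def head (m : I.GMonoid) : I.Simples := nf hm m 0

theorem exists_eq_head_mul (m : I.GMonoid) : ∃ m', m = gen (head hm m) * m' := by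
  obtain ⟨m', _, h⟩ := (eval_nf hm m).tail
  exact ⟨m', h⟩

/-- The first entry of the greedy decomposition of `t * m` is `t` times what it absorbs. With
`head_gen`, this reads divisibility in the monoid back in `W`. -/
theorem pre_head (t : I.Simples) (m : I.GMonoid) : I.Pre t.1 (head hm (gen t * m)).1 := by
  unfold head
  rw [nf_gen_mul]
  exact (absorbed_mul hm t (nf hm m 0)).1

theorem head_gen (u : I.Simples) : head hm (gen u) = u := by
  have h := nf_gen_mul hm u 1
  rw [mul_one] at h
  unfold head
  rw [h]
  simp [act, carry, nf_one, lead_one_right]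

include hm in
theorem gen_injective : Function.Injective (gen (I := I)) := fun a b h => by
  rw [← head_gen hm a, h, head_gen]

theorem act_tail (a : I.Simples) (x : ℕ → I.Simples) (k : ℕ) :
    act hm a x (k + 1) = act hm (rest hm a (x 0)) (fun j => x (j + 1)) k := by
  have h : ∀ k, carry hm a x (k + 1) = carry hm (rest hm a (x 0)) (fun j => x (j + 1)) k := by
    intro k
    induction k with
    | zero => rfl
    | succ k ih => rw [carry, ih]; rfl
  simp [act, h]

-- The factor `m` can be recovered from the normal form of `a * m`: its first entry is `a * p` with
-- `p` the absorbed part, its remaining entries multiply to some `m''`, and `m = p * m''`.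
include hm in
theorem gen_mul_left_cancel (a : I.Simples) {m m' : I.GMonoid} (h : gen a * m = gen a * m') :
    m = m' := by
  have key : ∀ m : I.GMonoid, ∃ p : I.Simples, p.1 = a.1⁻¹ * (nf hm (gen a * m) 0).1 ∧
      ∃ m'', Eval (fun k => nf hm (gen a * m) (k + 1)) m'' ∧ m = gen p * m'' := by
    intro m
    obtain ⟨mt, h1, h2⟩ := (eval_nf hm m).tail
    set x := nf hm m with hx
    refine ⟨⟨absorbed hm a (x 0), simple_of_pre (absorbed_pre hm a _) (x 0).2⟩, ?_,
      gen (rest hm a (x 0)) * mt, ?_, ?_⟩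
    · simp [nf_gen_mul, act, carry, lead, ← hx]
    · rw [nf_gen_mul]
      have := eval_act hm (rest hm a (x 0)) h1
      convert this using 1
      funext k
      exact act_tail hm a x k
    · rw [← mul_assoc, gen_mul (d := x 0) (by simp [rest]) (absorbed_pre hm a _), h2]
  obtain ⟨p, hp, m1, h1, h2⟩ := key m
  obtain ⟨p', hp', m1', h1', h2'⟩ := key m'
  rw [← h] at hp' h1'
  rw [h2, h2', eval_unique h1 h1', Subtype.ext (hp.trans hp'.symm)]

include hm in
theorem mul_left_cancel' (a : I.GMonoid) {m m' : I.GMonoid} (h : a * m = a * m') : m = m' := by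
  induction a using gmonoid_induction with
  | one => simpa using h
  | mul a b ih => exact ih (gen_mul_left_cancel hm a (by simpa [mul_assoc] using h))

include hm in
/-- Factors of simple elements are simple. -/
theorem exists_gen_of_mul_eq_gen (m m' : I.GMonoid) (u : I.Simples) (h : m * m' = gen u) :
    ∃ v w : I.Simples, m = gen v ∧ m' = gen w ∧ u.1 = v.1 * w.1 ∧ I.Pre v.1 u.1 := by
  induction m using gmonoid_induction generalizing u with
  | one => exact ⟨1, u, gen_one.symm, by simpa using h, by simp, one_pre _⟩
  | mul a m ih =>
    rw [mul_assoc] at h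
    have h1 : I.Pre a.1 u.1 := by
      have := pre_head hm a (m * m')
      rwa [h, head_gen] at this
    have h2 : gen a * gen ⟨a.1⁻¹ * u.1, simple_quot h1 u.2⟩ = gen u := gen_mul (by simp) h1
    obtain ⟨v, w, rfl, rfl, h3, h4⟩ := ih _ (gen_mul_left_cancel hm a (h.trans h2.symm))
    simp only at h3 h4
    have h5 := pre_mul_of_pre (a := a.1) (w := a.1⁻¹ * u.1) (by simpa using h1) h4
    rw [mul_inv_cancel_left] at h5
    refine ⟨⟨a.1 * v.1, simple_of_pre h5.2 u.2⟩, w, gen_mul rfl h5.1, rfl, ?_, h5.2⟩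
    rw [mul_assoc, ← h3, mul_inv_cancel_left]

end Streams

/-! ### The Garside element of the monoid -/

variable (I) in
/-- The Garside element. -/
def garside : I.GMonoid := gen ⟨I.top, simple_top⟩

/-- The complement of a simple element. -/
def compl (u : I.Simples) : I.Simples := ⟨u.1⁻¹ * I.top, simple_compl u.2⟩

theorem gen_mul_compl (u : I.Simples) : gen u * gen (compl u) = I.garside :=
  gen_mul (by simp [compl]) u.2

variable (I) in
/-- Conjugation by the Garside element. -/
def tau : I.GMonoid →* I.GMonoid :=
  liftM (fun u => gen ⟨I.top⁻¹ * u.1 * I.top, simple_conj u.2⟩)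
    (by rw [← gen_one]; congr 1; exact Subtype.ext (by simp))
    fun a b d hd h => (gen_mul (by simp [hd]; group) (pre_conj h)).symm

variable (I) in
/-- Conjugation by the inverse of the Garside element. -/
def tauInv : I.GMonoid →* I.GMonoid :=
  liftM (fun u => gen ⟨I.top * u.1 * I.top⁻¹, simple_conj' u.2⟩)
    (by rw [← gen_one]; congr 1; exact Subtype.ext (by simp))
    fun a b d hd h => (gen_mul (by simp [hd]) (pre_conj' h)).symm

theorem tauInv_tau (m : I.GMonoid) : I.tauInv (I.tau m) = m := by
  induction m using gmonoid_induction with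
  | one => simp
  | mul a m ih =>
    rw [map_mul, map_mul, ih]
    congr 1
    simp only [tau, tauInv, liftM_gen]
    congr 1
    exact Subtype.ext (by simp [mul_assoc])

/-- Complementing twice is `tau`: if `a'` and `a''` are the first and second complements of `a`,
then `a * Δ = a * a' * a'' = Δ * a''`. -/
theorem mul_garside (m : I.GMonoid) : m * I.garside = I.garside * I.tau m := by
  induction m using gmonoid_induction with
  | one => simp
  | mul a m ih =>
    have h : gen a * I.garside = I.garside * I.tau (gen a) := by
      have h1 := gen_mul_compl (compl a)
      have h2 : gen (compl (compl a)) = I.tau (gen a) := by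
        simp only [tau, liftM_gen]
        congr 1
        exact Subtype.ext (by simp [compl, mul_assoc])
      rw [← h2, ← gen_mul_compl a, mul_assoc, h1, gen_mul_compl]
    rw [mul_assoc, ih, ← mul_assoc, h, map_mul, mul_assoc]

theorem mul_garside_cancel (hm : I.HasMeets) {m m' : I.GMonoid}
    (h : m * I.garside = m' * I.garside) : m = m' := by
  rw [mul_garside, mul_garside] at h
  rw [← tauInv_tau m, mul_left_cancel' hm _ h, tauInv_tau]

theorem mul_garside_pow_cancel (hm : I.HasMeets) (k : ℕ) {m m' : I.GMonoid}
    (h : m * I.garside ^ k = m' * I.garside ^ k) : m = m' := by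
  induction k with
  | zero => simpa using h
  | succ k ih => exact ih (mul_garside_cancel hm (by simpa [pow_succ, mul_assoc] using h))

/-- Formal fractions `m * D ^ (-k)`. -/
def fractionSetoid (hm : I.HasMeets) : Setoid (I.GMonoid × ℕ) where
  r x y := x.1 * I.garside ^ y.2 = y.1 * I.garside ^ x.2
  iseqv :=
    { refl := fun _ => rfl
      symm := fun h => h.symm
      trans := by
        rintro ⟨a, i⟩ ⟨b, j⟩ ⟨d, k⟩ h1 h2
        simp only at *
        refine mul_garside_pow_cancel hm j ?_
        rw [mul_assoc, ← pow_add, add_comm, pow_add, ← mul_assoc, h1, mul_assoc, ← pow_add,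
          add_comm, pow_add, ← mul_assoc, h2, mul_assoc, ← pow_add, add_comm, pow_add,
          ← mul_assoc] }

/-- The set of fractions. -/
abbrev Fraction (hm : I.HasMeets) : Type := Quotient (fractionSetoid hm)

/-- Left multiplication on fractions. -/
def fractionMul (hm : I.HasMeets) (a : I.Simples) : Fraction hm → Fraction hm :=
  Quotient.map (fun x => (gen a * x.1, x.2)) fun x y h => by
    change gen a * x.1 * _ = gen a * y.1 * _
    rw [mul_assoc, mul_assoc]
    exact congrArg _ h

theorem fractionMul_bijective (hm : I.HasMeets) (a : I.Simples) :
    Function.Bijective (fractionMul hm a) := by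
  constructor
  · rintro ⟨x⟩ ⟨y⟩ h
    have h' : gen a * x.1 * _ = gen a * y.1 * _ := Quotient.exact h
    rw [mul_assoc, mul_assoc] at h'
    exact Quotient.sound (gen_mul_left_cancel hm a h')
  · rintro ⟨m, k⟩
    -- The inverse of `a` is its complement times `Δ⁻¹`, and moving `Δ⁻¹` past `m` applies `tau`.
    refine ⟨Quotient.mk _ (gen (compl a) * I.tau m, k + 1), Quotient.sound ?_⟩
    change gen a * (gen (compl a) * I.tau m) * I.garside ^ k = m * I.garside ^ (k + 1)
    rw [← mul_assoc (gen a), gen_mul_compl, ← mul_garside, mul_assoc, ← pow_succ']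

open Classical in
/-- The simple elements as permutations of the set of fractions. -/
noncomputable def fractionPerm (hm : I.HasMeets) (u : W) : Equiv.Perm (Fraction hm) :=
  if h : I.Simple u then Equiv.ofBijective _ (fractionMul_bijective hm ⟨u, h⟩) else 1

theorem fractionPerm_apply (hm : I.HasMeets) (u : I.Simples) (x : Fraction hm) :
    fractionPerm hm u.1 x = fractionMul hm u x := by
  simp [fractionPerm, u.2]

theorem isMorphism_fractionPerm (hm : I.HasMeets) : I.IsMorphism (fractionPerm hm) := by
  intro u v h1 h2
  have hu := simple_of_pre h1 h2
  have hv := simple_of_mul h1 h2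
  ext x
  rw [Equiv.Perm.mul_apply, fractionPerm_apply hm ⟨u, hu⟩, fractionPerm_apply hm ⟨v, hv⟩,
    fractionPerm_apply hm ⟨_, h2⟩]
  obtain ⟨x⟩ := x
  refine congrArg (Quotient.mk _) (Prod.ext ?_ rfl)
  change gen _ * x.1 = gen _ * (gen _ * x.1)
  rw [← mul_assoc, gen_mul (d := ⟨u * v, h2⟩) rfl h1]

end IntervalGerm
/-! ### Garside structures on groups -/

/-- `S` is the set of simple elements of a Garside structure with Garside element `D`; the
greatest simple prefixes are the part of the lattice structure that is recorded. -/
structure IsGarside {G : Type} [Group G] (S : Set G) (D : G) : Prop where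
  one_mem : 1 ∈ S
  top_ne_one : D ≠ 1
  compl_mem : ∀ x ∈ S, x⁻¹ * D ∈ S
  compl_mem' : ∀ x ∈ S, D * x⁻¹ ∈ S
  factor_mem : ∀ x ∈ Submonoid.closure S, ∀ y ∈ Submonoid.closure S, x * y ∈ S → x ∈ S ∧ y ∈ S
  closure_eq_top : Subgroup.closure S = ⊤
  exists_head : ∀ g ∈ Submonoid.closure S, ∃ h ∈ S, IsPrefix S h g ∧
    ∀ t ∈ S, IsPrefix S t g → IsPrefix S t h
  exists_len : ∃ len : G →* Multiplicative ℤ, ∀ x ∈ S, x ≠ 1 → 0 < (len x).toAdd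

namespace IntervalGerm

variable {W : Type} [Group W] {I : IntervalGerm W} {G : Type} [Group G]

/-- The map `b` identifies `G` with the group presented by the germ `I`. -/
structure Realization (I : IntervalGerm W) (b : W → G) : Prop where
  mul : I.IsMorphism b
  lift : ∀ {N : Type} [Group N] (f : W → N), I.IsMorphism f →
    ∃ θ : G →* N, ∀ u, I.Simple u → θ (b u) = f u
  gen : Subgroup.closure (b '' {u | I.Simple u}) = ⊤

/-! ### The group presented by a germ -/

namespace Realization

variable {b : W → G} (hb : I.Realization b)
include hb

theorem map_one : b 1 = 1 := by
  have := hb.mul 1 1 (by simpa using one_pre 1) (by simpa using simple_one)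
  simpa using this

/-- The homomorphism from the monoid of the germ to the group. -/
def incl : I.GMonoid →* G :=
  liftM (fun u => b u.1) hb.map_one fun a c d hd h => by
    rw [hd]
    exact hb.mul _ _ (hd ▸ h) (hd ▸ d.2)

theorem incl_gen (u : I.Simples) : hb.incl (IntervalGerm.gen u) = b u.1 := rfl

/-- By the universal property, the permutations `fractionPerm` extend to an action of `G` on the
fractions. The image of `m` carries the fraction `1` to `m`, so it determines `m`. -/
theorem incl_injective (hm : I.HasMeets) : Function.Injective hb.incl := by
  obtain ⟨θ, hθ⟩ := hb.lift _ (isMorphism_fractionPerm hm)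
  have key : ∀ m : I.GMonoid,
      θ (hb.incl m) (Quotient.mk _ (1, 0)) = Quotient.mk (fractionSetoid hm) (m, 0) := by
    intro m
    induction m using gmonoid_induction with
    | one => simp
    | mul a m ih =>
      rw [_root_.map_mul, _root_.map_mul, Equiv.Perm.mul_apply, ih, incl_gen, hθ _ a.2,
        fractionPerm_apply]
      rfl
  intro m m' h
  have h1 := (key m).symm.trans ((congrArg (fun g => θ g (Quotient.mk _ (1, 0))) h).trans (key m'))
  have h2 : m * _ = m' * _ := Quotient.exact h1
  simpa using h2

theorem mem_closure_iff (g : G) :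
    g ∈ Submonoid.closure (b '' {u | I.Simple u}) ↔ ∃ m, hb.incl m = g := by
  constructor
  · intro h
    induction h using Submonoid.closure_induction with
    | mem x hx =>
      obtain ⟨u, hu, rfl⟩ := hx
      exact ⟨IntervalGerm.gen ⟨u, hu⟩, rfl⟩
    | one => exact ⟨1, _root_.map_one _⟩
    | mul x y _ _ hx hy =>
      obtain ⟨m, rfl⟩ := hx
      obtain ⟨m', rfl⟩ := hy
      exact ⟨m * m', _root_.map_mul _ _ _⟩
  · rintro ⟨m, rfl⟩
    induction m using gmonoid_induction with
    | one => rw [_root_.map_one]; exact one_mem _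
    | mul a m ih =>
      rw [_root_.map_mul]
      exact mul_mem (Submonoid.subset_closure ⟨a.1, a.2, rfl⟩) ih

theorem isPrefix_iff (hm : I.HasMeets) {u v : W} (hu : I.Simple u) (hv : I.Simple v) :
    IsPrefix (b '' {u | I.Simple u}) (b u) (b v) ↔ I.Pre u v := by
  unfold IsPrefix
  rw [hb.mem_closure_iff]
  constructor
  · rintro ⟨m, h⟩
    have h1 : IntervalGerm.gen ⟨u, hu⟩ * m = IntervalGerm.gen ⟨v, hv⟩ := by
      apply hb.incl_injective hm
      rw [_root_.map_mul, h, incl_gen, incl_gen, mul_inv_cancel_left]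
    have := pre_head hm ⟨u, hu⟩ m
    rwa [h1, head_gen] at this
  · intro h
    refine ⟨IntervalGerm.gen ⟨u⁻¹ * v, simple_quot h hv⟩, ?_⟩
    rw [incl_gen, eq_inv_mul_iff_mul_eq, ← hb.mul] <;> simp <;> assumption

theorem injOn (hm : I.HasMeets) {u v : W} (hu : I.Simple u) (hv : I.Simple v) (h : b u = b v) :
    u = v := by
  have : IntervalGerm.gen (⟨u, hu⟩ : I.Simples) = IntervalGerm.gen ⟨v, hv⟩ :=
    hb.incl_injective hm h
  exact congrArg Subtype.val (gen_injective hm this)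

theorem mul_compl {u : W} (hu : I.Simple u) : b u * b (u⁻¹ * I.top) = b I.top := by
  rw [← hb.mul] <;> simp
  exacts [hu, simple_top]

theorem isGarside (hm : I.HasMeets) (h1 : I.top ≠ 1) :
    IsGarside (b '' {u | I.Simple u}) (b I.top) where
  one_mem := ⟨1, simple_one, hb.map_one⟩
  top_ne_one h := h1 (hb.injOn hm simple_top simple_one (h.trans hb.map_one.symm))
  compl_mem := by
    rintro _ ⟨u, hu, rfl⟩
    refine ⟨u⁻¹ * I.top, simple_compl hu, ?_⟩
    rw [eq_inv_mul_iff_mul_eq, ← hb.mul] <;> simp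
    exacts [hu, simple_top]
  compl_mem' := by
    rintro _ ⟨u, hu, rfl⟩
    refine ⟨I.top * u⁻¹, ?_, ?_⟩
    · have := simple_conj' (simple_compl hu)
      simpa [mul_assoc] using this
    · rw [eq_mul_inv_iff_mul_eq, ← hb.mul]
      · simp
      · rw [pre_mul_iff]
        have h1 : I.top * u⁻¹ = I.top * (u⁻¹ * I.top) * I.top⁻¹ := by group
        have h2 : I.len u + I.len (u⁻¹ * I.top) = I.len I.top := hu
        rw [h1, len_conj']
        simp only [mul_assoc, inv_mul_cancel, mul_one, mul_inv_cancel]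
        omega
      · simpa using simple_top
  factor_mem := by
    intro x hx y hy hxy
    obtain ⟨m, rfl⟩ := (hb.mem_closure_iff x).1 hx
    obtain ⟨m', rfl⟩ := (hb.mem_closure_iff y).1 hy
    obtain ⟨u, hu, h⟩ := hxy
    have h1 : m * m' = IntervalGerm.gen ⟨u, hu⟩ := by
      apply hb.incl_injective hm
      rw [_root_.map_mul, ← h, incl_gen]
    obtain ⟨v, w, rfl, rfl, -⟩ := exists_gen_of_mul_eq_gen hm _ _ _ h1
    exact ⟨⟨v.1, v.2, rfl⟩, ⟨w.1, w.2, rfl⟩⟩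
  closure_eq_top := hb.gen
  exists_head := by
    intro g hg
    obtain ⟨m, rfl⟩ := (hb.mem_closure_iff g).1 hg
    refine ⟨b (head hm m).1, ⟨_, (head hm m).2, rfl⟩, ?_, ?_⟩
    · obtain ⟨m', h⟩ := exists_eq_head_mul hm m
      unfold IsPrefix
      rw [hb.mem_closure_iff]
      refine ⟨m', ?_⟩
      rw [eq_inv_mul_iff_mul_eq, ← hb.incl_gen, ← _root_.map_mul, ← h]
    · rintro _ ⟨u, hu, rfl⟩ h
      rw [hb.isPrefix_iff hm hu (head hm m).2]
      unfold IsPrefix at h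
      rw [hb.mem_closure_iff] at h
      obtain ⟨m', h⟩ := h
      have h1 : m = IntervalGerm.gen ⟨u, hu⟩ * m' := by
        apply hb.incl_injective hm
        rw [_root_.map_mul, h, incl_gen, mul_inv_cancel_left]
      rw [h1]
      exact pre_head hm ⟨u, hu⟩ m'
  exists_len := by
    -- On the germ the length is additive by the meaning of `Pre`, so it extends to a homomorphism
    -- to the integers.
    obtain ⟨θ, hθ⟩ := hb.lift (fun u => Multiplicative.ofAdd (I.len u : ℤ)) (by
      intro u v h _
      rw [← ofAdd_add, ← Nat.cast_add, (pre_mul_iff u v).1 h])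
    refine ⟨θ, ?_⟩
    rintro _ ⟨u, hu, rfl⟩ h
    rw [hθ u hu, toAdd_ofAdd, Nat.cast_pos, Nat.pos_iff_ne_zero]
    intro h0
    exact h (by rw [I.eq_one_of_len u h0, hb.map_one])

end Realization

/-! ### Opposite germs -/

open MulOpposite

/-- The opposite of a germ. -/
def op (I : IntervalGerm W) : IntervalGerm Wᵐᵒᵖ where
  len u := I.len u.unop
  top := MulOpposite.op I.top
  len_one := I.len_one
  len_mul_le u v := by
    rw [unop_mul, add_comm]
    exact I.len_mul_le _ _
  eq_one_of_len u h := by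
    rw [← op_unop u, I.eq_one_of_len _ h, op_one]
  len_conj u := by
    rw [unop_mul, unop_mul, unop_inv, unop_op, ← mul_assoc, len_conj']

theorem op_pre_mul_iff (u v : Wᵐᵒᵖ) :
    I.op.Pre u (u * v) ↔ I.Pre v.unop (v.unop * u.unop) := by
  rw [pre_mul_iff, pre_mul_iff, add_comm]
  rfl

/-- Prefixes and suffixes of `top` coincide, because the left and right complements are conjugate by
`top` and so have equal length. -/
theorem op_simple_iff (u : Wᵐᵒᵖ) : I.op.Simple u ↔ I.Simple u.unop := by
  have h1 : I.top * u.unop⁻¹ = I.top * (u.unop⁻¹ * I.top) * I.top⁻¹ := by group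
  change I.len u.unop + I.len (I.top * u.unop⁻¹) = I.len I.top ↔ _
  rw [h1, len_conj']
  rfl

theorem Realization.op {b : W → G} (hb : I.Realization b) :
    I.op.Realization fun u => MulOpposite.op (b u.unop) where
  mul u v h1 h2 := by
    beta_reduce
    rw [unop_mul, hb.mul _ _ ((op_pre_mul_iff u v).1 h1) ((op_simple_iff _).1 h2), op_mul]
  lift {N} _ f hf := by
    obtain ⟨θ, hθ⟩ := hb.lift (N := Nᵐᵒᵖ) (fun u => MulOpposite.op (f (MulOpposite.op u))) (by
      intro u v h1 h2
      beta_reduce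
      rw [op_mul, hf _ _ _ _, op_mul]
      · rwa [op_pre_mul_iff]
      · rwa [op_simple_iff])
    refine ⟨⟨⟨fun x => (θ x.unop).unop, by simp⟩, by simp⟩, fun u hu => ?_⟩
    change (θ (b u.unop)).unop = _
    rw [hθ _ ((op_simple_iff u).1 hu)]
    rfl
  gen := by
    have h : (fun u : Wᵐᵒᵖ => MulOpposite.op (b u.unop)) '' {u | I.op.Simple u} =
        unop ⁻¹' (b '' {u | I.Simple u}) := by
      ext x
      constructor
      · rintro ⟨u, hu, rfl⟩
        exact ⟨u.unop, (op_simple_iff u).1 hu, rfl⟩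
      · rintro ⟨u, hu, h⟩
        exact ⟨MulOpposite.op u, (op_simple_iff _).2 hu, by simp [h]⟩
    rw [h, ← Subgroup.op_closure, hb.gen, Subgroup.op_top]

theorem Realization.isGarside_op {b : W → G} (hb : I.Realization b) (hm : I.op.HasMeets)
    (h1 : I.top ≠ 1) : IsGarside (unop ⁻¹' (b '' {u | I.Simple u})) (MulOpposite.op (b I.top)) := by
  have h := hb.op.isGarside hm fun h => h1 (op_injective h)
  refine (congrArg (fun S => IsGarside S (MulOpposite.op (b I.top))) ?_).mp h
  symm
  ext x
  constructor
  · rintro ⟨u, hu, h⟩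
    exact ⟨MulOpposite.op u, (op_simple_iff _).2 hu, by simp [h]⟩
  · rintro ⟨u, hu, rfl⟩
    exact ⟨u.unop, (op_simple_iff u).1 hu, rfl⟩

end IntervalGerm
/-! ### Normal forms in a Garside group -/

section Prefix

variable {G : Type} [Group G] {S : Set G}

theorem isPrefix_refl (a : G) : IsPrefix S a a := by simp [IsPrefix]

theorem isPrefix_trans {a b c : G} (h1 : IsPrefix S a b) (h2 : IsPrefix S b c) :
    IsPrefix S a c := by
  have := mul_mem h1 h2
  simpa [IsPrefix, mul_assoc] using this

theorem isPrefix_mul {a b : G} (hb : b ∈ Submonoid.closure S) : IsPrefix S a (a * b) := by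
  simpa [IsPrefix] using hb

theorem isPrefix_mul_left {a b : G} (c : G) : IsPrefix S (c * a) (c * b) ↔ IsPrefix S a b := by
  simp [IsPrefix, mul_assoc]

end Prefix

namespace IsGarside

variable {G : Type} [Group G] {S : Set G} {D : G} (h : IsGarside S D)

/-- `x` is the greatest simple prefix of `g`. -/
def IsHead (S : Set G) (x g : G) : Prop :=
  x ∈ S ∧ IsPrefix S x g ∧ ∀ t ∈ S, IsPrefix S t g → IsPrefix S t x

include h

theorem top_mem : D ∈ S := by simpa using h.compl_mem 1 h.one_mem

theorem isPrefix_top {x : G} (hx : x ∈ S) : IsPrefix S x D :=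
  Submonoid.subset_closure (h.compl_mem x hx)

theorem conj_mem {x : G} (hx : x ∈ S) : D * x * D⁻¹ ∈ S := by
  simpa [mul_assoc] using h.compl_mem' _ (h.compl_mem' x hx)

theorem conj_inv_mem {x : G} (hx : x ∈ S) : D⁻¹ * x * D ∈ S := by
  simpa [mul_assoc] using h.compl_mem _ (h.compl_mem x hx)

theorem conj_zpow_mem (k : ℤ) {x : G} (hx : x ∈ S) : D ^ k * x * (D ^ k)⁻¹ ∈ S := by
  induction k with
  | zero => simpa using hx
  | succ k ih =>
    have := h.conj_mem ih
    rw [add_comm, zpow_add, zpow_one]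
    simpa [mul_assoc] using this
  | pred k ih =>
    have := h.conj_inv_mem ih
    rw [sub_eq_add_neg, add_comm, zpow_add, zpow_neg_one]
    simpa [mul_assoc] using this

theorem conj_zpow_mem_closure (k : ℤ) {x : G} (hx : x ∈ Submonoid.closure S) :
    D ^ k * x * (D ^ k)⁻¹ ∈ Submonoid.closure S := by
  induction hx using Submonoid.closure_induction with
  | mem x hx => exact Submonoid.subset_closure (h.conj_zpow_mem k hx)
  | one => simp
  | mul x y _ _ hx hy =>
    have := mul_mem hx hy
    simpa [mul_assoc] using this

theorem conj_zpow_mem_closure_iff (k : ℤ) {x : G} :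
    D ^ k * x * (D ^ k)⁻¹ ∈ Submonoid.closure S ↔ x ∈ Submonoid.closure S := by
  refine ⟨fun hx => ?_, h.conj_zpow_mem_closure k⟩
  have := h.conj_zpow_mem_closure (-k) hx
  simpa [mul_assoc] using this

theorem isPrefix_conj_iff (k : ℤ) (x y : G) :
    IsPrefix S (D ^ k * x * (D ^ k)⁻¹) (D ^ k * y * (D ^ k)⁻¹) ↔ IsPrefix S x y := by
  unfold IsPrefix
  rw [← h.conj_zpow_mem_closure_iff k (x := x⁻¹ * y)]
  simp [mul_assoc]

theorem leftWeighted_conj (k : ℤ) {x y : G} (hw : LeftWeighted S x y) :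
    LeftWeighted S (D ^ k * x * (D ^ k)⁻¹) (D ^ k * y * (D ^ k)⁻¹) := by
  intro t ht h1
  have e : t = D ^ k * (D ^ (-k) * t * (D ^ (-k))⁻¹) * (D ^ k)⁻¹ := by simp [mul_assoc]
  have e2 : D ^ k * x * (D ^ k)⁻¹ * (D ^ k * y * (D ^ k)⁻¹) = D ^ k * (x * y) * (D ^ k)⁻¹ := by
    simp [mul_assoc]
  rw [e, e2, h.isPrefix_conj_iff] at h1
  rw [e, h.isPrefix_conj_iff]
  exact hw _ (h.conj_zpow_mem (-k) ht) h1

theorem exists_len' : ∃ len : G →* Multiplicative ℤ, (∀ x ∈ Submonoid.closure S,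
    0 ≤ (len x).toAdd) ∧ ∀ x ∈ Submonoid.closure S, x ≠ 1 → 0 < (len x).toAdd := by
  obtain ⟨len, hlen⟩ := h.exists_len
  have h0 : ∀ x ∈ Submonoid.closure S, 0 ≤ (len x).toAdd := by
    intro x hx
    induction hx using Submonoid.closure_induction with
    | mem x hx =>
      by_cases h1 : x = 1
      · simp [h1]
      · exact (hlen x hx h1).le
    | one => simp
    | mul x y _ _ hx hy => rw [map_mul, toAdd_mul]; omega
  refine ⟨len, h0, fun x hx => ?_⟩
  induction hx using Submonoid.closure_induction_left with
  | one => simp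
  | mul_left x hx y hy ih =>
    intro hxy
    have := h0 y hy
    rw [map_mul, toAdd_mul]
    by_cases h1 : x = 1
    · subst h1
      simpa using ih (by simpa using hxy)
    · have := hlen x hx h1
      omega

theorem isPrefix_antisymm {x y : G} (h1 : IsPrefix S x y) (h2 : IsPrefix S y x) : x = y := by
  obtain ⟨len, h3, h4⟩ := h.exists_len'
  by_contra hne
  have h5 := h4 _ h1 (by rwa [Ne, inv_mul_eq_one])
  have h6 := h3 _ h2
  rw [map_mul, map_inv, toAdd_mul, toAdd_inv] at h5 h6
  omega

theorem isHead_unique {x y g : G} (hx : IsHead S x g) (hy : IsHead S y g) : x = y :=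
  h.isPrefix_antisymm (hy.2.2 x hx.1 hx.2.1) (hx.2.2 y hy.1 hy.2.1)

theorem exists_isHead {g : G} (hg : g ∈ Submonoid.closure S) : ∃ x, IsHead S x g := by
  obtain ⟨x, h1, h2, h3⟩ := h.exists_head g hg
  exact ⟨x, h1, h2, h3⟩

omit h in
theorem isHead_self {x : G} (hx : x ∈ S) : IsHead S x x := ⟨hx, isPrefix_refl x, fun _ _ h => h⟩

omit h in
theorem mem_closure_of_list {l : List G} (hl : ∀ x ∈ l, x ∈ S) :
    l.prod ∈ Submonoid.closure S :=
  Submonoid.list_prod_mem _ fun x hx => Submonoid.subset_closure (hl x hx)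

theorem quot_mem {x y : G} (hx : x ∈ S) (hy : y ∈ S) (hxy : IsPrefix S x y) : x⁻¹ * y ∈ S :=
  (h.factor_mem x (Submonoid.subset_closure hx) _ hxy (by simpa using hy)).2

/-- The greatest simple prefix of a product of two factors of which the first one is simple. -/
theorem head_mul {x g z : G} (hx : x ∈ S) (hg : g ∈ Submonoid.closure S)
    (hz : IsHead S z (x * g)) : IsPrefix S x z ∧ x⁻¹ * z ∈ S ∧ IsPrefix S (x⁻¹ * z) g := by
  have h1 := hz.2.2 x hx (isPrefix_mul hg)
  refine ⟨h1, h.quot_mem hx hz.1 h1, ?_⟩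
  rw [← isPrefix_mul_left x]
  simpa using hz.2.1

/-- A product of `k + 1` simple elements is its greatest simple prefix times a product of `k`
simple elements. -/
theorem exists_tail (l : List G) (hl : ∀ x ∈ l, x ∈ S) (hne : l ≠ []) {z : G}
    (hz : IsHead S z l.prod) :
    ∃ l' : List G, l'.length + 1 = l.length ∧ (∀ x ∈ l', x ∈ S) ∧ l.prod = z * l'.prod := by
  induction l generalizing z with
  | nil => exact absurd rfl hne
  | cons a l ih =>
    have ha := hl a (by simp)
    have hl' : ∀ x ∈ l, x ∈ S := fun x hx => hl x (by simp [hx])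
    by_cases hn : l = []
    · subst hn
      refine ⟨[], rfl, by simp, ?_⟩
      have : z = a := h.isHead_unique hz (by simpa using isHead_self ha)
      simp [this]
    · obtain ⟨y, hy⟩ := h.exists_isHead (mem_closure_of_list hl')
      obtain ⟨l1, h1, h2, h3⟩ := ih hl' hn hy
      rw [List.prod_cons] at hz
      obtain ⟨h4, h5, h6⟩ := h.head_mul ha (mem_closure_of_list hl') hz
      have h7 := hy.2.2 _ h5 h6
      refine ⟨((a⁻¹ * z)⁻¹ * y) :: l1, by simp [← h1], ?_, ?_⟩
      · intro x hx
        rcases List.mem_cons.1 hx with rfl | hx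
        · exact h.quot_mem h5 hy.1 h7
        · exact h2 x hx
      · rw [List.prod_cons, List.prod_cons, h3]
        group

/-- Local weightedness suffices: if `z` is the head of the product, then `x⁻¹ * z` is a simple
prefix of the tail, hence by induction of its first factor `y`. Thus `z` is a prefix of `x * y`, and
so of `x`. -/
theorem isHead_of_chain (x : G) (l : List G) (hl : ∀ y ∈ x :: l, y ∈ S)
    (hc : (x :: l).IsChain (LeftWeighted S)) : IsHead S x (x :: l).prod := by
  induction l generalizing x with
  | nil => simpa using isHead_self (hl x (by simp))
  | cons y l ih =>
    rw [List.isChain_cons_cons] at hc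
    have hx := hl x (by simp)
    have hl' : ∀ z ∈ y :: l, z ∈ S := fun z hz => hl z (by simp at hz ⊢; tauto)
    have hy := ih y hl' hc.2
    have hp := mem_closure_of_list hl'
    rw [List.prod_cons]
    refine ⟨hx, isPrefix_mul hp, fun t ht htp => ?_⟩
    obtain ⟨z, hz⟩ := h.exists_isHead (mul_mem (Submonoid.subset_closure hx) hp)
    obtain ⟨h1, h2, h3⟩ := h.head_mul hx hp hz
    have h4 := hy.2.2 _ h2 h3
    rw [← isPrefix_mul_left x, mul_inv_cancel_left] at h4
    exact isPrefix_trans (hz.2.2 t ht htp) (hc.1 z hz.1 h4)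

theorem chain_unique (l l' : List G) (hl : ∀ x ∈ l, x ∈ S ∧ x ≠ 1) (hl' : ∀ x ∈ l', x ∈ S ∧ x ≠ 1)
    (hc : l.IsChain (LeftWeighted S)) (hc' : l'.IsChain (LeftWeighted S))
    (hp : l.prod = l'.prod) : l = l' := by
  have key : ∀ (y : G) (l : List G), (∀ x ∈ y :: l, x ∈ S ∧ x ≠ 1) → (y :: l).prod ≠ 1 := by
    intro y l hl hp
    have h1 : IsPrefix S y 1 := by
      rw [← hp, List.prod_cons]
      exact isPrefix_mul (mem_closure_of_list fun x hx => (hl x (by simp [hx])).1)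
    have h2 : IsPrefix S 1 y := by
      have := isPrefix_mul (a := 1) (Submonoid.subset_closure (hl y (by simp)).1)
      simpa using this
    exact (hl y (by simp)).2 (h.isPrefix_antisymm h1 h2)
  induction l generalizing l' with
  | nil =>
    cases l' with
    | nil => rfl
    | cons y l' => exact absurd hp.symm (key y l' hl')
  | cons x l ih =>
    cases l' with
    | nil => exact absurd hp (key x l hl)
    | cons y l' =>
      have h1 := h.isHead_of_chain x l (fun z hz => (hl z hz).1) hc
      have h2 := h.isHead_of_chain y l' (fun z hz => (hl' z hz).1) hc'
      rw [hp] at h1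
      have h3 := h.isHead_unique h1 h2
      subst h3
      rw [ih l' (fun z hz => hl z (by simp [hz])) (fun z hz => hl' z (by simp [hz])) hc.of_cons
        hc'.of_cons (by simpa using hp)]

theorem exists_chain {g : G} (hg : g ∈ Submonoid.closure S) :
    ∃ l : List G, (∀ x ∈ l, x ∈ S ∧ x ≠ 1) ∧ l.IsChain (LeftWeighted S) ∧ l.prod = g := by
  obtain ⟨len, h0, hpos⟩ := h.exists_len'
  induction hN : (len g).toAdd.toNat using Nat.strong_induction_on generalizing g with
  | _ N ih =>
    by_cases hg1 : g = 1
    · exact ⟨[], by simp, by simp, by simp [hg1]⟩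
    · obtain ⟨x, hx⟩ := h.exists_isHead hg
      have hx1 : x ≠ 1 := by
        rintro rfl
        -- A nontrivial positive element has a nontrivial simple prefix, so its head is not `1` and
        -- removing it lowers the length.
        have : ∀ g ∈ Submonoid.closure S, g ≠ 1 → ∃ t ∈ S, t ≠ 1 ∧ IsPrefix S t g := by
          intro g hg
          induction hg using Submonoid.closure_induction_left with
          | one => simp
          | mul_left x hx y hy ih =>
            intro hne
            by_cases h1 : x = 1
            · subst h1
              simpa using ih (by simpa using hne)
            · exact ⟨x, hx, h1, isPrefix_mul hy⟩
        obtain ⟨t, ht, ht1, htg⟩ := this g hg hg1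
        refine ht1 (h.isPrefix_antisymm (hx.2.2 t ht htg) ?_)
        simpa [IsPrefix] using Submonoid.subset_closure ht
      have h1 := hpos x (Submonoid.subset_closure hx.1) hx1
      have h2 : x⁻¹ * g ∈ Submonoid.closure S := hx.2.1
      have h3 := h0 _ h2
      obtain ⟨l, hl1, hl2, hl3⟩ := ih _ (by
        rw [map_mul, map_inv, toAdd_mul, toAdd_inv] at h3 ⊢
        omega) h2 rfl
      refine ⟨x :: l, ?_, ?_, by simp [hl3]⟩
      · intro y hy
        rcases List.mem_cons.1 hy with rfl | hy
        · exact ⟨hx.1, hx1⟩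
        · exact hl1 y hy
      · cases l with
        | nil => simp
        | cons y l =>
          refine List.isChain_cons_cons.2 ⟨fun t ht htp => hx.2.2 t ht ?_, hl2⟩
          refine isPrefix_trans htp ?_
          have : g = x * y * l.prod := by
            rw [mul_assoc, ← List.prod_cons, hl3, mul_inv_cancel_left]
          rw [this]
          exact isPrefix_mul (mem_closure_of_list fun z hz => (hl1 z (by simp [hz])).1)

/-! #### Extracting the powers of the Garside element -/

/-- The Garside element can only occur at the start: `D` is a prefix of `x * D = D * (D⁻¹ * x * D)`,
so weightedness of the pair `x`, `D` forces `x = D`. -/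
theorem ne_top_of_chain (x : G) (l : List G) (hl : ∀ y ∈ x :: l, y ∈ S)
    (hc : (x :: l).IsChain (LeftWeighted S)) (hx : x ≠ D) : ∀ y ∈ x :: l, y ≠ D := by
  induction l generalizing x with
  | nil => simpa using hx
  | cons y l ih =>
    rw [List.isChain_cons_cons] at hc
    have hxS := hl x (by simp)
    have hy : y ≠ D := by
      rintro rfl
      have h1 : IsPrefix S y (x * y) := by
        unfold IsPrefix
        rw [← mul_assoc]
        exact Submonoid.subset_closure (h.conj_inv_mem hxS)
      exact hx (h.isPrefix_antisymm (h.isPrefix_top hxS) (hc.1 y h.top_mem h1))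
    intro z hz
    rcases List.mem_cons.1 hz with rfl | hz
    · exact hx
    · exact ih y (fun z hz => hl z (by simp at hz ⊢; tauto)) hc.2 hy z hz

theorem exists_replicate_append (l : List G) (hl : ∀ y ∈ l, y ∈ S)
    (hc : l.IsChain (LeftWeighted S)) :
    ∃ (k : ℕ) (l' : List G), l = List.replicate k D ++ l' ∧ ∀ y ∈ l', y ≠ D := by
  induction l with
  | nil => exact ⟨0, [], by simp⟩
  | cons x l ih =>
    by_cases hx : x = D
    · obtain ⟨k, l', h1, h2⟩ := ih (fun y hy => hl y (by simp [hy])) hc.of_cons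
      exact ⟨k + 1, l', by simp [hx, h1, List.replicate_succ], h2⟩
    · exact ⟨0, x :: l, by simp, h.ne_top_of_chain x l hl hc hx⟩

theorem replicate_append_chain (k : ℕ) (l : List G)
    (hc : l.IsChain (LeftWeighted S)) :
    (List.replicate k D ++ l).IsChain (LeftWeighted S) := by
  induction k with
  | zero => simpa using hc
  | succ k ih =>
    rw [List.replicate_succ, List.cons_append, List.isChain_cons]
    exact ⟨fun y _ t ht _ => h.isPrefix_top ht, ih⟩

theorem exists_pow_mul_mem (g : G) : ∃ k : ℕ, D ^ k * g ∈ Submonoid.closure S := by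
  have hg : g ∈ Subgroup.closure S := by rw [h.closure_eq_top]; trivial
  induction hg using Subgroup.closure_induction'' with
  | mem x hx => exact ⟨0, by simpa using Submonoid.subset_closure hx⟩
  | inv_mem x hx => exact ⟨1, by simpa using Submonoid.subset_closure (h.compl_mem' x hx)⟩
  | one => exact ⟨0, by simp⟩
  | mul x y _ _ hx hy =>
    obtain ⟨k, hk⟩ := hx
    obtain ⟨l, hl⟩ := hy
    refine ⟨l + k, ?_⟩
    have h1 := mul_mem (h.conj_zpow_mem_closure l hk) hl
    have h2 : D ^ (l + k) * (x * y) =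
        D ^ (l : ℤ) * (D ^ k * x) * (D ^ (l : ℤ))⁻¹ * (D ^ l * y) := by
      rw [zpow_natCast, pow_add]
      group
    rwa [h2]

/-- A power of `D` makes `g` positive, and the copies of `D` at the front of its chain are moved
into the exponent. For uniqueness, cancel the smaller power; leftover copies of `D` would form a
chain with the other list and contradict `chain_unique`, as `D` is not allowed as a factor. -/
theorem existsUnique_zpow_mul (g : G) : ∃! w : List G × ℤ, g = D ^ w.2 * w.1.prod ∧
    (∀ x ∈ w.1, x ∈ S ∧ x ≠ 1 ∧ x ≠ D) ∧ w.1.IsChain (LeftWeighted S) := by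
  have uniq : ∀ (l l' : List G) (p q : ℤ), p ≤ q → D ^ p * l.prod = D ^ q * l'.prod →
      (∀ x ∈ l, x ∈ S ∧ x ≠ 1 ∧ x ≠ D) → (∀ x ∈ l', x ∈ S ∧ x ≠ 1 ∧ x ≠ D) →
      l.IsChain (LeftWeighted S) → l'.IsChain (LeftWeighted S) → (l', q) = (l, p) := by
    intro l l' p q hpq e hl hl' hc hc'
    obtain ⟨k, rfl⟩ : ∃ k : ℕ, q = p + k := ⟨(q - p).toNat, by omega⟩
    rw [zpow_add, mul_assoc, mul_right_inj, zpow_natCast] at e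
    rcases Nat.eq_zero_or_pos k with rfl | hk
    · have := h.chain_unique l l' (fun x hx => ⟨(hl x hx).1, (hl x hx).2.1⟩)
        (fun x hx => ⟨(hl' x hx).1, (hl' x hx).2.1⟩) hc hc' (by simpa using e)
      simp [this]
    · exfalso
      have := h.chain_unique l (List.replicate k D ++ l')
        (fun x hx => ⟨(hl x hx).1, (hl x hx).2.1⟩)
        (fun x hx => by
          rcases List.mem_append.1 hx with hx | hx
          · rw [List.eq_of_mem_replicate hx]; exact ⟨h.top_mem, h.top_ne_one⟩
          · exact ⟨(hl' x hx).1, (hl' x hx).2.1⟩) hc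
        (h.replicate_append_chain k l' hc') (by simp [e])
      exact (hl D (by rw [this]; simp; omega)).2.2 rfl
  obtain ⟨k, hk⟩ := h.exists_pow_mul_mem g
  obtain ⟨l, hl, hc, hp⟩ := h.exists_chain hk
  obtain ⟨j, l', rfl, hl'⟩ := h.exists_replicate_append l (fun x hx => (hl x hx).1) hc
  have hw : g = D ^ ((j : ℤ) - k) * l'.prod := by
    rw [List.prod_append, List.prod_replicate] at hp
    rw [sub_eq_neg_add, zpow_add, mul_assoc, zpow_natCast, hp, zpow_neg, zpow_natCast,
      inv_mul_cancel_left]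
  have hl'' : ∀ x ∈ l', x ∈ S ∧ x ≠ 1 ∧ x ≠ D := fun x hx =>
    ⟨(hl x (by simp [hx])).1, (hl x (by simp [hx])).2, hl' x hx⟩
  have hc' : l'.IsChain (LeftWeighted S) := hc.right_of_append
  refine ⟨(l', (j : ℤ) - k), ⟨hw, hl'', hc'⟩, ?_⟩
  rintro ⟨l2, p⟩ ⟨h1, h2, h3⟩
  simp only at h1 h2 h3
  rcases le_total p ((j : ℤ) - k) with hle | hle
  · exact (uniq l2 l' _ _ hle (h1.symm.trans hw) h2 hl'' h3 hc').symm
  · exact uniq l' l2 _ _ hle (hw.symm.trans h1) hl'' h2 hc' h3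

omit h in
theorem map_conj_prod (k : ℤ) (l : List G) :
    (l.map fun x => D ^ k * x * (D ^ k)⁻¹).prod = D ^ k * l.prod * (D ^ k)⁻¹ := by
  exact (map_list_prod (MulAut.conj (D ^ k)) l).symm

theorem map_conj_proper (k : ℤ) {l : List G} (hl : ∀ x ∈ l, x ∈ S ∧ x ≠ 1 ∧ x ≠ D) :
    ∀ x ∈ l.map (fun x => D ^ k * x * (D ^ k)⁻¹), x ∈ S ∧ x ≠ 1 ∧ x ≠ D := by
  intro x hx
  obtain ⟨y, hy, rfl⟩ := List.mem_map.1 hx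
  obtain ⟨h1, h2, h3⟩ := hl y hy
  refine ⟨h.conj_zpow_mem k h1, fun e => h2 ?_, fun e => h3 ?_⟩
  · simpa using e
  · rw [mul_inv_eq_iff_eq_mul, ← zpow_one_add, add_comm, zpow_add, zpow_one] at e
    exact mul_left_cancel e

theorem map_conj_chain (k : ℤ) {l : List G} (hl : l.IsChain (LeftWeighted S)) :
    (l.map fun x => D ^ k * x * (D ^ k)⁻¹).IsChain (LeftWeighted S) := by
  rw [List.isChain_map]
  exact hl.imp fun _ _ hw => h.leftWeighted_conj k hw

/-- Moving `D ^ p` from the left to the right of the factors conjugates each of them by `D ^ p`,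
which preserves simplicity and weightedness. -/
theorem existsUnique_isLeftNormalForm (g : G) :
    ∃! w : List G × ℤ, IsLeftNormalForm S D g w.1 w.2 := by
  obtain ⟨⟨l, p⟩, ⟨h1, h2, h3⟩, hu⟩ := h.existsUnique_zpow_mul g
  simp only at h1 h2 h3
  refine ⟨(l.map fun x => D ^ p * x * (D ^ p)⁻¹, p), ⟨?_, h.map_conj_proper p h2,
    h.map_conj_chain p h3⟩, ?_⟩
  · rw [map_conj_prod, h1, inv_mul_cancel_right]
  · rintro ⟨l', q⟩ ⟨h4, h5, h6⟩
    simp only at h4 h5 h6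
    have := hu (l'.map (fun x => D ^ (-q) * x * (D ^ (-q))⁻¹), q)
      ⟨?_, h.map_conj_proper (-q) h5, h.map_conj_chain (-q) h6⟩
    · obtain ⟨e1, rfl⟩ := Prod.mk.inj this
      rw [← e1]
      simp [mul_assoc, Function.comp_def]
    · simp only
      rw [map_conj_prod, h4]
      simp [mul_assoc]

end IsGarside

/-! ### Right normal forms -/

section Opposite

open MulOpposite

variable {G : Type} [Group G] {S : Set G} {D : G}

theorem isPrefix_op_iff (a b : G) : IsPrefix (unop ⁻¹' S) (op a) (op b) ↔ IsSuffix S a b := by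
  unfold IsPrefix IsSuffix
  rw [← Submonoid.op_closure, ← op_inv, ← op_mul]
  rfl

theorem leftWeighted_op_iff (a b : G) :
    LeftWeighted (unop ⁻¹' S) (op a) (op b) ↔ RightWeighted S b a := by
  constructor
  · intro h t ht h1
    rw [← isPrefix_op_iff] at h1 ⊢
    exact h (op t) ht h1
  · intro h t ht h1
    rw [← op_unop t, ← op_mul, isPrefix_op_iff] at h1
    rw [← op_unop t, isPrefix_op_iff]
    exact h _ ht h1

/-- In the opposite group the power of `D` stands on the left, so the right-hand side is the shape
treated in `existsUnique_zpow_mul` and no conjugation of the factors is needed. -/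
theorem isRightNormalForm_iff (g : G) (l : List G) (p : ℤ) :
    IsRightNormalForm S D g l p ↔ op g = op D ^ p * (l.map op).reverse.prod ∧
      (∀ x ∈ (l.map op).reverse, x ∈ unop ⁻¹' S ∧ x ≠ 1 ∧ x ≠ op D) ∧
      (l.map op).reverse.IsChain (LeftWeighted (unop ⁻¹' S)) := by
  have h1 : op g = op D ^ p * (l.map op).reverse.prod ↔ g = l.prod * D ^ p := by
    rw [← op_list_prod, ← op_zpow, ← op_mul, op_inj]
  have h2 : (∀ x ∈ (l.map op).reverse, x ∈ unop ⁻¹' S ∧ x ≠ 1 ∧ x ≠ op D) ↔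
      ∀ x ∈ l, x ∈ S ∧ x ≠ 1 ∧ x ≠ D := by
    simp
  have h3 : (l.map op).reverse.IsChain (LeftWeighted (unop ⁻¹' S)) ↔
      l.IsChain (RightWeighted S) := by
    rw [List.isChain_reverse, List.isChain_map]
    simp only [leftWeighted_op_iff]
  rw [h1, h2, h3]
  exact ⟨fun h => ⟨h.1, h.2, h.3⟩, fun h => ⟨h.1, h.2.1, h.2.2⟩⟩

theorem IsGarside.existsUnique_isRightNormalForm (h : IsGarside (unop ⁻¹' S) (op D)) (g : G) :
    ∃! w : List G × ℤ, IsRightNormalForm S D g w.1 w.2 := by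
  obtain ⟨⟨l, p⟩, hw, hu⟩ := h.existsUnique_zpow_mul (op g)
  have hl : ((l.reverse.map unop).map op).reverse = l := by simp [Function.comp_def]
  refine ⟨(l.reverse.map unop, p), ?_, ?_⟩
  · simp only
    rw [isRightNormalForm_iff, hl]
    exact hw
  · rintro ⟨l', q⟩ hw'
    simp only at hw'
    rw [isRightNormalForm_iff] at hw'
    obtain ⟨e1, rfl⟩ := Prod.mk.inj (hu ((l'.map op).reverse, q) hw')
    rw [← e1]
    simp [Function.comp_def]

end Opposite
/-! ### Centralizers of powers of the Garside element -/

/-- `Ψ` identifies `H` with the centralizer of a power of `D`. -/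
structure IsCentralizerEmbedding {G H : Type} [Group G] [Group H] (Ψ : H →* G) (D : G) (D' : H)
    (k : ℕ) : Prop where
  injective : Function.Injective Ψ
  exists_iff : ∀ g, (∃ β, Ψ β = g) ↔ Commute (D ^ k) g
  map_top : Ψ D' = D

namespace IsGarside

variable {G H : Type} [Group G] [Group H] {S : Set G} {D : G} (h : IsGarside S D)

include h

/-- Conjugation by `D ^ k` preserves `S` and the prefix order, so it maps heads of `g` to heads of
`g`; the head is unique. -/
theorem commute_of_isHead (k : ℕ) {x g : G} (hg : Commute (D ^ k) g) (hx : IsHead S x g) :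
    Commute (D ^ k) x := by
  have e : D ^ (k : ℤ) * g * (D ^ (k : ℤ))⁻¹ = g := by
    rw [zpow_natCast, hg.eq, mul_inv_cancel_right]
  have h1 : IsHead S (D ^ (k : ℤ) * x * (D ^ (k : ℤ))⁻¹) g := by
    refine ⟨h.conj_zpow_mem k hx.1, ?_, fun t ht htg => ?_⟩
    · rw [← e, h.isPrefix_conj_iff]
      exact hx.2.1
    · have e2 : t = D ^ (k : ℤ) * (D ^ (-k : ℤ) * t * (D ^ (-k : ℤ))⁻¹) * (D ^ (k : ℤ))⁻¹ := by
        simp [mul_assoc]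
      rw [← e, e2, h.isPrefix_conj_iff] at htg
      rw [e2, h.isPrefix_conj_iff]
      exact hx.2.2 _ (h.conj_zpow_mem _ ht) htg
  have h2 := h.isHead_unique h1 hx
  rwa [zpow_natCast, mul_inv_eq_iff_eq_mul] at h2

/-- Split off the head, which commutes with `D ^ k`; by `exists_tail` one simple factor fewer is
left. Keeping the number of factors is essential for the word metric. -/
theorem exists_commuting_list (k : ℕ) (l : List G) (hl : ∀ x ∈ l, x ∈ S)
    (hc : Commute (D ^ k) l.prod) :
    ∃ l' : List G, l'.length = l.length ∧ (∀ x ∈ l', x ∈ S ∧ Commute (D ^ k) x) ∧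
      l'.prod = l.prod := by
  induction hn : l.length generalizing l with
  | zero => exact ⟨[], rfl, by simp, by simp [List.length_eq_zero_iff.1 hn]⟩
  | succ n ih =>
    obtain ⟨z, hz⟩ := h.exists_isHead (mem_closure_of_list hl)
    obtain ⟨l1, h1, h2, h3⟩ := h.exists_tail l hl (by rintro rfl; simp at hn) hz
    have hzc := h.commute_of_isHead k hc hz
    have h4 : Commute (D ^ k) l1.prod := by
      have : l1.prod = z⁻¹ * l.prod := by rw [h3, inv_mul_cancel_left]
      rw [this]
      exact hzc.inv_right.mul_right hc
    obtain ⟨l2, h5, h6, h7⟩ := ih l1 h2 h4 (by omega)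
    refine ⟨z :: l2, by simp [h5], ?_, by rw [List.prod_cons, h7, h3]⟩
    intro x hx
    rcases List.mem_cons.1 hx with rfl | hx
    · exact ⟨hz.1, hzc⟩
    · exact h6 x hx

/-- A word of length `k` in the simple elements and their inverses becomes a product of `k`
simple elements after multiplication by a power of the Garside element. -/
theorem exists_pow_mul_word (l : List G) (hl : ∀ x ∈ l, x ∈ S ∨ x⁻¹ ∈ S) :
    ∃ (b : ℕ) (l' : List G), b ≤ l.length ∧ l'.length = l.length ∧ (∀ x ∈ l', x ∈ S) ∧
      l'.prod = D ^ b * l.prod := by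
  induction l with
  | nil => exact ⟨0, [], by simp⟩
  | cons x l ih =>
    obtain ⟨b, l1, h1, h2, h3, h4⟩ := ih fun y hy => hl y (by simp [hy])
    rcases hl x (by simp) with hx | hx
    · refine ⟨b, (D ^ (b : ℤ) * x * (D ^ (b : ℤ))⁻¹) :: l1, by simp; omega, by simp [h2], ?_, ?_⟩
      · intro y hy
        rcases List.mem_cons.1 hy with rfl | hy
        · exact h.conj_zpow_mem b hx
        · exact h3 y hy
      · rw [List.prod_cons, List.prod_cons, h4, zpow_natCast]
        group
    · refine ⟨b + 1, (D ^ (b : ℤ) * (D * x) * (D ^ (b : ℤ))⁻¹) :: l1, by simp; omega,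
        by simp [h2], ?_, ?_⟩
      · intro y hy
        rcases List.mem_cons.1 hy with rfl | hy
        · refine h.conj_zpow_mem b ?_
          simpa using h.compl_mem' _ hx
        · exact h3 y hy
      · rw [List.prod_cons, List.prod_cons, h4, zpow_natCast, pow_succ]
        group

/-- This undoes `exists_pow_mul_word`: one factor `D⁻¹` is spent on each of the first `b` letters.
The letter `D⁻¹ * x` is the inverse of the simple element `x⁻¹ * D`, and the other powers of `D`
only conjugate it. -/
theorem exists_word_of_pow (l : List G) (hl : ∀ x ∈ l, x ∈ S) (b : ℕ) (hb : b ≤ l.length) :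
    ∃ l' : List G, l'.length = l.length ∧ (∀ x ∈ l', x ∈ S ∨ x⁻¹ ∈ S) ∧
      l.prod = D ^ b * l'.prod := by
  induction l generalizing b with
  | nil => exact ⟨[], by simp_all⟩
  | cons x l ih =>
    have hx := hl x (by simp)
    have hl' : ∀ y ∈ l, y ∈ S := fun y hy => hl y (by simp [hy])
    cases b with
    | zero => exact ⟨x :: l, rfl, fun y hy => Or.inl (hl y hy), by simp⟩
    | succ b =>
      obtain ⟨l1, h1, h2, h3⟩ := ih hl' b (by simpa using hb)
      refine ⟨((D ^ (b + 1))⁻¹ * x * D ^ b) :: l1, by simp [h1], ?_, ?_⟩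
      · intro y hy
        rcases List.mem_cons.1 hy with rfl | hy
        · right
          have := h.conj_zpow_mem (-b) (h.compl_mem _ hx)
          convert this using 1
          rw [zpow_neg, zpow_natCast, pow_succ]
          group
        · exact h2 y hy
      · rw [List.prod_cons, List.prod_cons, h3]
        group

/-! ### Transfer of Garside structure, normal forms and metric to a centralizer -/

section Embedding

variable {Ψ : H →* G} {D' : H} {k : ℕ} (e : IsCentralizerEmbedding Ψ D D' k)

include e

theorem exists_lift_list (l : List G) (hl : ∀ x ∈ l, x ∈ S) (β : H) (hβ : l.prod = Ψ β) :
    ∃ l' : List H, l'.length = l.length ∧ (∀ x ∈ l', Ψ x ∈ S) ∧ l'.prod = β := by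
  obtain ⟨l1, h1, h2, h3⟩ := h.exists_commuting_list k l hl
    (by rw [hβ]; exact (e.exists_iff _).1 ⟨β, rfl⟩)
  have key : ∀ l : List G, (∀ x ∈ l, x ∈ S ∧ Commute (D ^ k) x) →
      ∃ l' : List H, l'.map Ψ = l := by
    intro l
    induction l with
    | nil => exact fun _ => ⟨[], rfl⟩
    | cons x l ih =>
      intro hl
      obtain ⟨l', hl'⟩ := ih fun y hy => hl y (by simp [hy])
      obtain ⟨y, hy⟩ := (e.exists_iff x).2 (hl x (by simp)).2
      exact ⟨y :: l', by simp [hy, hl']⟩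
  obtain ⟨l2, rfl⟩ := key l1 h2
  refine ⟨l2, by simpa using h1, fun x hx => (h2 _ (List.mem_map_of_mem hx)).1, ?_⟩
  apply e.injective
  rw [map_list_prod, h3, hβ]

/-- A positive factorization of `Ψ β` can be rechosen with all factors in the image of `Ψ`. -/
theorem mem_closure_preimage_iff (β : H) :
    β ∈ Submonoid.closure (Ψ ⁻¹' S) ↔ Ψ β ∈ Submonoid.closure S := by
  constructor
  · intro hβ
    induction hβ using Submonoid.closure_induction with
    | mem x hx => exact Submonoid.subset_closure hx
    | one => simp
    | mul x y _ _ hx hy => rw [map_mul]; exact mul_mem hx hy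
  · intro hβ
    obtain ⟨l, hl, hp⟩ := Submonoid.exists_list_of_mem_closure hβ
    obtain ⟨l', -, h2, rfl⟩ := h.exists_lift_list e l hl β hp
    exact mem_closure_of_list h2

theorem isPrefix_preimage_iff (a b : H) :
    IsPrefix (Ψ ⁻¹' S) a b ↔ IsPrefix S (Ψ a) (Ψ b) := by
  unfold IsPrefix
  rw [h.mem_closure_preimage_iff e, map_mul, map_inv]

theorem exists_lift_head {β : H} (hβ : Ψ β ∈ Submonoid.closure S) :
    ∃ x, IsHead S (Ψ x) (Ψ β) := by
  obtain ⟨x, hx⟩ := h.exists_isHead hβ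
  obtain ⟨y, rfl⟩ := (e.exists_iff x).2 (h.commute_of_isHead k ((e.exists_iff _).1 ⟨β, rfl⟩) hx)
  exact ⟨y, hx⟩

theorem preimage : IsGarside (Ψ ⁻¹' S) D' where
  one_mem := by simpa using h.one_mem
  top_ne_one := by
    rintro rfl
    exact h.top_ne_one (by rw [← e.map_top, map_one])
  compl_mem x hx := by
    have := h.compl_mem _ hx
    rwa [← e.map_top, ← map_inv, ← map_mul] at this
  compl_mem' x hx := by
    have := h.compl_mem' _ hx
    rwa [← e.map_top, ← map_inv, ← map_mul] at this
  factor_mem x hx y hy hxy := by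
    rw [h.mem_closure_preimage_iff e] at hx hy
    exact h.factor_mem _ hx _ hy (by rw [← map_mul]; exact hxy)
  closure_eq_top := by
    rw [eq_top_iff]
    intro β _
    obtain ⟨j, hj⟩ := h.exists_pow_mul_mem (Ψ β)
    rw [← e.map_top, ← map_pow, ← map_mul, ← h.mem_closure_preimage_iff e] at hj
    have h1 : D' ∈ Subgroup.closure (Ψ ⁻¹' S) :=
      Subgroup.subset_closure (by rw [Set.mem_preimage, e.map_top]; exact h.top_mem)
    have h2 : D' ^ j * β ∈ Subgroup.closure (Ψ ⁻¹' S) := by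
      refine (Submonoid.closure_le (S := (Subgroup.closure (Ψ ⁻¹' S)).toSubmonoid)).2 ?_ hj
      exact Subgroup.subset_closure
    exact (Subgroup.mul_mem_cancel_left _ (pow_mem h1 j)).1 h2
  exists_head β hβ := by
    rw [h.mem_closure_preimage_iff e] at hβ
    obtain ⟨x, hx⟩ := h.exists_lift_head e hβ
    refine ⟨x, hx.1, (h.isPrefix_preimage_iff e _ _).2 hx.2.1, fun t ht htβ => ?_⟩
    rw [h.isPrefix_preimage_iff e] at htβ ⊢
    exact hx.2.2 _ ht htβ
  exists_len := by
    obtain ⟨len, hlen⟩ := h.exists_len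
    refine ⟨len.comp Ψ, fun x hx hx1 => hlen _ hx fun h1 => hx1 (e.injective ?_)⟩
    rw [h1, map_one]

/-- The condition in `G` involves simple elements outside the image. They are all prefixes of the
head of `Ψ (a * b)`, which lies in the image, where the hypothesis applies. -/
theorem leftWeighted_map {a b : H} (ha : Ψ a ∈ S) (hb : Ψ b ∈ S)
    (hw : LeftWeighted (Ψ ⁻¹' S) a b) : LeftWeighted S (Ψ a) (Ψ b) := by
  intro t ht htp
  rw [← map_mul] at htp
  obtain ⟨x, hx⟩ := h.exists_lift_head e (β := a * b) (by
    rw [map_mul]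
    exact mul_mem (Submonoid.subset_closure ha) (Submonoid.subset_closure hb))
  refine isPrefix_trans (hx.2.2 t ht htp) ?_
  rw [← h.isPrefix_preimage_iff e]
  exact hw x hx.1 ((h.isPrefix_preimage_iff e _ _).2 hx.2.1)

theorem chain_map {l : List H} (hl : ∀ x ∈ l, Ψ x ∈ S)
    (hc : l.IsChain (LeftWeighted (Ψ ⁻¹' S))) : (l.map Ψ).IsChain (LeftWeighted S) := by
  induction l with
  | nil => simp
  | cons x l ih =>
    cases l with
    | nil => simp
    | cons y l =>
      rw [List.isChain_cons_cons] at hc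
      rw [List.map_cons, List.map_cons, List.isChain_cons_cons]
      exact ⟨h.leftWeighted_map e (hl x (by simp)) (hl y (by simp)) hc.1,
        ih (fun z hz => hl z (by simp at hz ⊢; tauto)) hc.2⟩

omit h in
theorem proper_map {l : List H} (hl : ∀ x ∈ l, x ∈ Ψ ⁻¹' S ∧ x ≠ 1 ∧ x ≠ D') :
    ∀ x ∈ l.map Ψ, x ∈ S ∧ x ≠ 1 ∧ x ≠ D := by
  intro x hx
  obtain ⟨y, hy, rfl⟩ := List.mem_map.1 hx
  obtain ⟨h1, h2, h3⟩ := hl y hy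
  refine ⟨h1, fun h4 => h2 (e.injective ?_), fun h4 => h3 (e.injective ?_)⟩
  · rw [h4, map_one]
  · rw [h4, e.map_top]

theorem isLeftNormalForm_map {β : H} {xs : List H} {p : ℤ}
    (hw : IsLeftNormalForm (Ψ ⁻¹' S) D' β xs p) :
    IsLeftNormalForm S D (Ψ β) (xs.map Ψ) p where
  eq_prod := by rw [hw.eq_prod, map_mul, map_zpow, e.map_top, map_list_prod]
  proper_simple := proper_map e hw.proper_simple
  weighted := h.chain_map e (fun x hx => (hw.proper_simple x hx).1) hw.weighted

/-- A word for `Ψ β` becomes positive after multiplication by some `D ^ b`, with the same number of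
letters. The product stays in the image, so it refactors there with as many letters, and `D ^ b` is
then removed inside `H`. -/
theorem wordLength_map (β : H) : wordLength S (Ψ β) = wordLength (Ψ ⁻¹' S) β := by
  unfold wordLength
  congr 1
  ext j
  constructor
  · rintro ⟨l, rfl, hl, hp⟩
    obtain ⟨b, l1, h1, h2, h3, h4⟩ := h.exists_pow_mul_word l hl
    rw [hp, ← e.map_top, ← map_pow, ← map_mul] at h4
    obtain ⟨l2, h5, h6, h7⟩ := h.exists_lift_list e l1 h3 _ h4
    obtain ⟨l3, h8, h9, h10⟩ := (h.preimage e).exists_word_of_pow l2 h6 b (by omega)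
    refine ⟨l3, by omega, h9, ?_⟩
    rw [h7] at h10
    exact (mul_left_cancel h10).symm
  · rintro ⟨l, rfl, hl, rfl⟩
    refine ⟨l.map Ψ, by simp, ?_, (map_list_prod _ _).symm⟩
    intro x hx
    obtain ⟨y, hy, rfl⟩ := List.mem_map.1 hx
    rw [← map_inv]
    exact hl y hy

theorem wordDist_map (β γ : H) : wordDist S (Ψ β) (Ψ γ) = wordDist (Ψ ⁻¹' S) β γ := by
  unfold wordDist
  rw [← map_inv, ← map_mul, h.wordLength_map e]

end Embedding

end IsGarside

/-! ### The transfer for right-greedy normal forms -/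

section Opposite

open MulOpposite

variable {G H : Type} [Group G] [Group H] {S : Set G} {D : G} {Ψ : H →* G} {D' : H} {k : ℕ}

theorem IsCentralizerEmbedding.op (e : IsCentralizerEmbedding Ψ D D' k) :
    IsCentralizerEmbedding (MonoidHom.op Ψ) (op D) (op D') k where
  injective x y hxy := unop_injective (e.injective (op_injective hxy))
  exists_iff g := by
    rw [← op_pow, ← op_unop g, commute_op, ← e.exists_iff]
    constructor
    · rintro ⟨β, hβ⟩
      exact ⟨β.unop, op_injective hβ⟩
    · rintro ⟨β, hβ⟩
      exact ⟨MulOpposite.op β, congrArg MulOpposite.op hβ⟩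
  map_top := congrArg MulOpposite.op e.map_top

theorem isRightNormalForm_map (h : IsGarside (unop ⁻¹' S) (op D))
    (e : IsCentralizerEmbedding Ψ D D' k) {β : H} {xs : List H} {p : ℤ}
    (hw : IsRightNormalForm (Ψ ⁻¹' S) D' β xs p) :
    IsRightNormalForm S D (Ψ β) (xs.map Ψ) p := by
  have hw' := (isRightNormalForm_iff _ _ _).1 hw
  have hmap : ((xs.map Ψ).map MulOpposite.op).reverse =
      ((xs.map MulOpposite.op).reverse).map (MonoidHom.op Ψ) := by
    rw [List.map_reverse, List.map_map, List.map_map]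
    rfl
  rw [isRightNormalForm_iff, hmap]
  refine ⟨?_, IsGarside.proper_map e.op hw'.2.1,
    h.chain_map e.op (fun x hx => (hw'.2.1 x hx).1) hw'.2.2⟩
  have := congrArg (MonoidHom.op Ψ) hw'.1
  rw [map_mul, map_zpow, map_list_prod, e.op.map_top] at this
  exact this

theorem IsGarside.preimage_op (h : IsGarside (unop ⁻¹' S) (op D))
    (e : IsCentralizerEmbedding Ψ D D' k) : IsGarside (unop ⁻¹' (Ψ ⁻¹' S)) (op D') :=
  h.preimage e.op

end Opposite
end ArtinB

namespace ArtinB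
namespace IntervalGerm

/-! ### Germs generated by atoms -/

variable {W : Type} [Group W] {I : IntervalGerm W} {G : Type} [Group G] {A : Type}

/-- The word `L` in the atoms is a shortest expression of `w`. -/
def Red (I : IntervalGerm W) (t : A → W) (L : List A) (w : W) : Prop :=
  (L.map t).prod = w ∧ (L.map fun a => I.len (t a)).sum = I.len w

/-- The letters of the word `L` can be split off one after the other. -/
def Steps (I : IntervalGerm W) (t : A → W) : List A → W → Prop
  | [], _ => True
  | a :: L, u => I.Pre (t a) u ∧ Steps I t L ((t a)⁻¹ * u)

/-- The atoms `a` and `b` have a least common multiple, two expressions of which are equal in the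
group `G`. -/
def Good (I : IntervalGerm W) (t : A → W) (g : A → G) (a b : A) : Prop :=
  ∃ (p q : List A) (m : W), I.Red t (a :: p) m ∧ I.Red t (b :: q) m ∧
    ((a :: p).map g).prod = ((b :: q).map g).prod ∧
    ∀ u, I.Simple u → I.Pre (t a) u → I.Pre (t b) u → I.Pre m u

/-- The germ is generated by the atoms `t a`, with local relations that hold between the elements
`g a` of the group `G`. -/
structure IsAtomic (I : IntervalGerm W) (t : A → W) (g : A → G) : Prop where
  ne_one : ∀ a, t a ≠ 1
  simple : ∀ a, I.Simple (t a)
  exists_pre : ∀ w, I.Simple w → w ≠ 1 → ∃ a, I.Pre (t a) w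
  connected : ∀ a b, ∃ d, (∀ u, I.Simple u → I.Pre (t a) u → I.Pre (t b) u → I.Pre (t d) u) ∧
    I.Good t g a d ∧ I.Good t g d b

variable {t : A → W} {g : A → G}

theorem len_prod_le (L : List A) :
    I.len (L.map t).prod ≤ (L.map fun a => I.len (t a)).sum := by
  induction L with
  | nil => simp [I.len_one]
  | cons a L ih =>
    simp only [List.map_cons, List.prod_cons, List.sum_cons]
    have := I.len_mul_le (t a) (L.map t).prod
    omega

theorem Red.cons {a : A} {L : List A} {w : W} (h : I.Red t (a :: L) w) :
    I.Pre (t a) w ∧ I.Red t L ((t a)⁻¹ * w) := by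
  obtain ⟨h1, h2⟩ := h
  simp only [List.map_cons, List.prod_cons, List.sum_cons] at h1 h2
  subst h1
  have h3 := I.len_mul_le (t a) (L.map t).prod
  have h4 := len_prod_le (I := I) (t := t) L
  simp only [Red, Pre, inv_mul_cancel_left, true_and]
  omega

theorem red_cons {a : A} {L : List A} {w : W} (h : I.Pre (t a) w)
    (h' : I.Red t L ((t a)⁻¹ * w)) : I.Red t (a :: L) w := by
  obtain ⟨h1, h2⟩ := h'
  refine ⟨by simp [h1], ?_⟩
  simp only [List.map_cons, List.sum_cons, h2]
  exact h

theorem red_append {L L' : List A} {u v : W} (h : I.Red t L u) (h' : I.Red t L' v)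
    (hp : I.Pre u (u * v)) : I.Red t (L ++ L') (u * v) := by
  refine ⟨by simp [h.1, h'.1], ?_⟩
  rw [List.map_append, List.sum_append, h.2, h'.2, (pre_mul_iff u v).1 hp]

theorem Steps.sum_add {L : List A} {u : W} (h : I.Steps t L u) :
    (L.map fun a => I.len (t a)).sum + I.len ((L.map t).prod⁻¹ * u) = I.len u := by
  induction L generalizing u with
  | nil => simp
  | cons a L ih =>
    have h1 := ih h.2
    have h2 : I.len (t a) + I.len ((t a)⁻¹ * u) = I.len u := h.1
    simp only [List.map_cons, List.prod_cons, List.sum_cons, mul_inv_rev, mul_assoc] at h1 ⊢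
    omega

theorem red_of_steps_top {L : List A} (hL : I.Steps t L I.top) : I.Red t L (L.map t).prod := by
  have h3 := hL.sum_add
  have h4 := I.len_le_add (L.map t).prod I.top
  have h5 := len_prod_le (I := I) (t := t) L
  exact ⟨rfl, by omega⟩

/-- Splitting the letters off `top` shows that both words are shortest expressions; splitting them
off `u` shows that their common value is a prefix of `u`. -/
theorem good_of_steps {a b : A} (p q : List A) (ha : I.Simple (t a)) (hb : I.Simple (t b))
    (ht : ((a :: p).map t).prod = ((b :: q).map t).prod)
    (hg : ((a :: p).map g).prod = ((b :: q).map g).prod)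
    (h : ∀ u, I.Simple u → I.Pre (t a) u → I.Pre (t b) u →
      I.Steps t (a :: p) u ∧ I.Steps t (b :: q) u) : I.Good t g a b := by
  obtain ⟨h1, h2⟩ := h I.top simple_top ha hb
  refine ⟨p, q, ((a :: p).map t).prod, red_of_steps_top h1, ht ▸ red_of_steps_top h2, hg,
    fun u hu hau hbu => ?_⟩
  have h6 := (h u hu hau hbu).1.sum_add
  rw [(red_of_steps_top h1).2] at h6
  exact h6

namespace IsAtomic

variable (h : I.IsAtomic t g)
include h

theorem len_pos (a : A) : 0 < I.len (t a) :=
  Nat.pos_of_ne_zero fun h0 => h.ne_one a (I.eq_one_of_len _ h0)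

theorem len_quot_lt {a : A} {w : W} (hp : I.Pre (t a) w) : I.len ((t a)⁻¹ * w) < I.len w := by
  have := h.len_pos a
  unfold Pre at hp
  omega

theorem exists_red (w : W) (hw : I.Simple w) : ∃ L, I.Red t L w := by
  induction hN : I.len w using Nat.strong_induction_on generalizing w with
  | _ N ih =>
    subst hN
    by_cases h1 : w = 1
    · exact ⟨[], by simp [Red, h1, I.len_one]⟩
    · obtain ⟨a, ha⟩ := h.exists_pre w hw h1
      obtain ⟨L, hL⟩ := ih _ (h.len_quot_lt ha) _ (simple_quot ha hw) rfl
      exact ⟨a :: L, red_cons ha hL⟩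

/-- Matsumoto's argument by induction on length. If the words begin with `a` and `b` and these atoms
have the least common multiple `a * p = b * q`, compare the words with `a * p * r` and `b * q * r`:
after the first letter the induction hypothesis applies, and the two comparison words agree in `G`.
For other pairs one passes through an intermediate atom. -/
theorem red_unique (w : W) (hw : I.Simple w) (L L' : List A) (hL : I.Red t L w)
    (hL' : I.Red t L' w) : (L.map g).prod = (L'.map g).prod := by
  induction hN : I.len w using Nat.strong_induction_on generalizing w L L' with
  | _ N ih =>
    subst hN
    have key : ∀ a b L L', I.Good t g a b → I.Red t (a :: L) w → I.Red t (b :: L') w →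
        ((a :: L).map g).prod = ((b :: L').map g).prod := by
      rintro a b L L' ⟨p, q, m, h1, h2, h3, h4⟩ hL hL'
      have hm := h4 w hw hL.cons.1 hL'.cons.1
      obtain ⟨r, hr⟩ := h.exists_red _ (simple_quot hm hw)
      have h5 := red_append h1 hr (by simpa using hm)
      have h6 := red_append h2 hr (by simpa using hm)
      rw [mul_inv_cancel_left] at h5 h6
      have h7 := ih _ (h.len_quot_lt hL.cons.1) _ (simple_quot hL.cons.1 hw) _ _ hL.cons.2
        (Red.cons h5).2 rfl
      have h8 := ih _ (h.len_quot_lt hL'.cons.1) _ (simple_quot hL'.cons.1 hw) _ _ hL'.cons.2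
        (Red.cons h6).2 rfl
      rw [List.map_cons, List.prod_cons, h7, List.map_cons, List.prod_cons, h8]
      simp only [List.append_eq, List.map_append, List.prod_append]
      rw [List.map_cons, List.prod_cons, List.map_cons, List.prod_cons] at h3
      rw [← mul_assoc, ← mul_assoc, h3]
    have nil : ∀ (a : A) (L : List A), I.Red t (a :: L) w → w ≠ 1 := by
      rintro a L hL rfl
      have h1 := h.len_quot_lt hL.cons.1
      rw [I.len_one] at h1
      omega
    cases L with
    | nil =>
      cases L' with
      | nil => rfl
      | cons b L' => exact absurd hL.1.symm (by simpa using nil b L' hL')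
    | cons a L =>
      cases L' with
      | nil => exact absurd hL'.1.symm (by simpa using nil a L hL)
      | cons b L' =>
        obtain ⟨d, h1, h2, h3⟩ := h.connected a b
        have hd := h1 w hw hL.cons.1 hL'.cons.1
        obtain ⟨r, hr⟩ := h.exists_red _ (simple_quot hd hw)
        have hdr := red_cons hd hr
        rw [key a d L r h2 hL hdr, key d b r L' h3 hdr hL']

omit h in
open Classical in
/-- The product in `G` of a shortest expression of `w` in the atoms. -/
noncomputable def spell (I : IntervalGerm W) (t : A → W) (g : A → G) (w : W) : G :=
  if hw : ∃ L, I.Red t L w then (hw.choose.map g).prod else 1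

theorem spell_eq {w : W} (hw : I.Simple w) {L : List A} (hL : I.Red t L w) :
    spell I t g w = (L.map g).prod := by
  have hex : ∃ L, I.Red t L w := ⟨L, hL⟩
  rw [spell, dif_pos hex]
  exact h.red_unique w hw _ _ hex.choose_spec hL

theorem spell_atom (a : A) : spell I t g (t a) = g a := by
  rw [h.spell_eq (h.simple a) (L := [a]) (by simp [Red])]
  simp

theorem isMorphism_spell : I.IsMorphism (spell I t g) := by
  intro u v h1 h2
  have hu := simple_of_pre h1 h2
  have hv := simple_of_mul h1 h2
  obtain ⟨L, hL⟩ := h.exists_red u hu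
  obtain ⟨L', hL'⟩ := h.exists_red v hv
  rw [h.spell_eq hu hL, h.spell_eq hv hL', h.spell_eq h2 (red_append hL hL' h1), List.map_append,
    List.prod_append]

omit h in
theorem _root_.ArtinB.IntervalGerm.IsMorphism.map_red {N : Type} [Group N] {f : W → N}
    (hf : I.IsMorphism f) {w : W} (hw : I.Simple w) {L : List A} (hL : I.Red t L w) :
    f w = (L.map fun a => f (t a)).prod := by
  induction L generalizing w with
  | nil =>
    have : w = 1 := by simpa using hL.1.symm
    subst this
    have := hf 1 1 (by simpa using one_pre 1) (by simpa using simple_one)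
    simpa using this
  | cons a L ih =>
    obtain ⟨h1, h2⟩ := hL.cons
    have := hf (t a) ((t a)⁻¹ * w) (by simpa using h1) (by simpa using hw)
    rw [mul_inv_cancel_left] at this
    rw [this, ih (simple_quot h1 hw) h2]
    simp

theorem realization (hgen : Subgroup.closure (Set.range g) = ⊤)
    (hlift : ∀ {N : Type} [Group N] (f : W → N), I.IsMorphism f →
      ∃ θ : G →* N, ∀ a, θ (g a) = f (t a)) : I.Realization (spell I t g) where
  mul := h.isMorphism_spell
  lift f hf := by
    obtain ⟨θ, hθ⟩ := hlift f hf
    refine ⟨θ, fun u hu => ?_⟩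
    obtain ⟨L, hL⟩ := h.exists_red u hu
    rw [h.spell_eq hu hL, map_list_prod, List.map_map, hf.map_red hu hL]
    congr 1
    exact List.map_congr_left fun a _ => hθ a
  gen := by
    rw [eq_top_iff, ← hgen, Subgroup.closure_le]
    rintro _ ⟨a, rfl⟩
    exact Subgroup.subset_closure ⟨t a, h.simple a, h.spell_atom a⟩

/-- The greatest common prefix above a given common prefix `z` is found by induction on `len u - len
z`: extend `z` by an atom and use the greatest one above that. The point is that the result does not
depend on the atom. -/
theorem hasMeets : I.HasMeets := by
  intro u v hu hv
  have key : ∀ z, I.Pre z u → I.Pre z v → ∃ w, I.Pre w u ∧ I.Pre w v ∧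
      ∀ y, I.Pre z y → I.Pre y u → I.Pre y v → I.Pre y w := by
    intro z
    induction hN : I.len u - I.len z using Nat.strong_induction_on generalizing z with
    | _ N ih =>
      subst hN
      intro hzu hzv
      -- the greatest common prefix above `z * t a`
      have up : ∀ a, I.Pre (t a) (z⁻¹ * u) → I.Pre (t a) (z⁻¹ * v) →
          I.Pre z (z * t a) ∧ I.Pre (z * t a) u ∧ I.Pre (z * t a) v ∧
          ∃ w, I.Pre w u ∧ I.Pre w v ∧
          ∀ y, I.Pre (z * t a) y → I.Pre y u → I.Pre y v → I.Pre y w := by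
        intro a hau hav
        have h1 := pre_mul_of_pre (a := z) (w := z⁻¹ * u) (by simpa using hzu) hau
        have h2 := pre_mul_of_pre (a := z) (w := z⁻¹ * v) (by simpa using hzv) hav
        rw [mul_inv_cancel_left] at h1 h2
        refine ⟨h1.1, h1.2, h2.2, ih _ ?_ _ rfl h1.2 h2.2⟩
        have h3 := (pre_mul_iff _ _).1 h1.1
        have h4 := h.len_pos a
        have h5 : I.len (z * t a) + _ = I.len u := h1.2
        omega
      -- If `m` is the least common multiple of `a` and `b`, then `z * m` lies below both `w` and
      -- `w'`. Each of them therefore lies above the starting point of the other, and maximality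
      -- makes them equal.
      have same : ∀ a b w w', I.Good t g a b →
          I.Pre (t a) (z⁻¹ * u) → I.Pre (t a) (z⁻¹ * v) →
          I.Pre (t b) (z⁻¹ * u) → I.Pre (t b) (z⁻¹ * v) →
          (I.Pre w u ∧ I.Pre w v ∧
            ∀ y, I.Pre (z * t a) y → I.Pre y u → I.Pre y v → I.Pre y w) →
          (I.Pre w' u ∧ I.Pre w' v ∧
            ∀ y, I.Pre (z * t b) y → I.Pre y u → I.Pre y v → I.Pre y w') → w = w' := by
        rintro a b w w' ⟨p, q, m, h1, h2, -, h4⟩ hau hav hbu hbv hw hw'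
        have hmu := h4 _ (simple_quot hzu hu) hau hbu
        have hmv := h4 _ (simple_quot hzv hv) hav hbv
        have h5 := pre_mul_of_pre (a := z) (w := z⁻¹ * u) (by simpa using hzu) hmu
        have h6 := pre_mul_of_pre (a := z) (w := z⁻¹ * v) (by simpa using hzv) hmv
        rw [mul_inv_cancel_left] at h5 h6
        have ham := (pre_mul_of_pre h5.1 h1.cons.1).2
        have hbm := (pre_mul_of_pre h5.1 h2.cons.1).2
        have h7 := hw.2.2 _ ham h5.2 h6.2
        have h8 := hw'.2.2 _ hbm h5.2 h6.2
        exact pre_antisymm (hw'.2.2 w (pre_trans hbm h7) hw.1 hw.2.1)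
          (hw.2.2 w' (pre_trans ham h8) hw'.1 hw'.2.1)
      by_cases hex : ∃ a, I.Pre (t a) (z⁻¹ * u) ∧ I.Pre (t a) (z⁻¹ * v)
      · obtain ⟨a, hau, hav⟩ := hex
        obtain ⟨hza, hau', hav', w, hw⟩ := up a hau hav
        refine ⟨w, hw.1, hw.2.1, fun y hzy hyu hyv => ?_⟩
        by_cases hne : z = y
        · subst hne
          exact pre_trans hza (hw.2.2 _ (pre_refl _) hau' hav')
        · obtain ⟨b, hb⟩ := h.exists_pre (z⁻¹ * y) (simple_quot hzy (simple_of_pre hyu hu))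
            (by rwa [Ne, inv_mul_eq_one])
          have hbu := pre_trans hb (pre_quot hzy hyu)
          have hbv := pre_trans hb (pre_quot hzy hyv)
          obtain ⟨d, hd1, hd2, hd3⟩ := h.connected a b
          have hdu := hd1 _ (simple_quot hzu hu) hau hbu
          have hdv := hd1 _ (simple_quot hzv hv) hav hbv
          obtain ⟨-, -, -, wd, hwd⟩ := up d hdu hdv
          obtain ⟨-, -, -, wb, hwb⟩ := up b hbu hbv
          rw [same a d w wd hd2 hau hav hdu hdv hw hwd, same d b wd wb hd3 hdu hdv hbu hbv hwd hwb]
          refine hwb.2.2 y ?_ hyu hyv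
          have := (pre_mul_of_pre (a := z) (w := z⁻¹ * y) (by simpa using hzy) hb).2
          rwa [mul_inv_cancel_left] at this
      · refine ⟨z, hzu, hzv, fun y hzy hyu hyv => ?_⟩
        by_cases hne : z = y
        · subst hne
          exact pre_refl _
        · obtain ⟨b, hb⟩ := h.exists_pre (z⁻¹ * y) (simple_quot hzy (simple_of_pre hyu hu))
            (by rwa [Ne, inv_mul_eq_one])
          exact absurd ⟨b, pre_trans hb (pre_quot hzy hyu), pre_trans hb (pre_quot hzy hyv)⟩ hex
  obtain ⟨w, h1, h2, h3⟩ := key 1 (one_pre u) (one_pre v)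
  exact ⟨w, h1, h2, fun z hzu hzv => h3 z (one_pre z) hzu hzv⟩

end IsAtomic
end IntervalGerm
open IntervalGerm

/-! ### The classical Garside structure of the braid group -/

theorem adjSwap_val {m : ℕ} (i : Fin (m - 1)) (x : Fin m) :
    (adjSwap i x).val =
      if x.val = i.val then i.val + 1 else if x.val = i.val + 1 then i.val else x.val := by
  unfold adjSwap
  rw [Equiv.swap_apply_def]
  simp only [Fin.ext_iff]
  split_ifs <;> rfl

theorem adjSwap_inv {m : ℕ} (i : Fin (m - 1)) : (adjSwap i)⁻¹ = adjSwap i := Equiv.swap_inv _ _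

theorem adjSwap_mul_self {m : ℕ} (i : Fin (m - 1)) : adjSwap i * adjSwap i = 1 :=
  Equiv.swap_mul_self _ _

/-! ### Inversions, descents and positive permutation braids -/

section Inversions

variable {m : ℕ}

/-- The left end of the `i`-th pair of neighbouring positions. -/
def posL (i : Fin (m - 1)) : Fin m := ⟨i.val, by omega⟩

/-- The right end of the `i`-th pair of neighbouring positions. -/
def posR (i : Fin (m - 1)) : Fin m := ⟨i.val + 1, by omega⟩

/-- The values `i` and `i + 1` are taken by `w` in the wrong order. -/
def IsDescent (i : Fin (m - 1)) (w : Equiv.Perm (Fin m)) : Prop := w⁻¹ (posR i) < w⁻¹ (posL i)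

/-- Left multiplication exchanges the values `i` and `i + 1`, so only the pair of positions holding
these values changes its status. -/
theorem inversions_adjSwap_mul (i : Fin (m - 1)) (w : Equiv.Perm (Fin m))
    (h : ¬ IsDescent i w) : inversions (adjSwap i * w) = inversions w + 1 := by
  have hlt : w⁻¹ (posL i) < w⁻¹ (posR i) := by
    refine lt_of_le_of_ne (not_lt.1 h) fun e => ?_
    have := w⁻¹.injective e
    simp [posL, posR] at this
  have hv : ∀ a, w (w⁻¹ a) = a := w.apply_symm_apply
  unfold inversions
  rw [← Finset.card_insert_of_notMem (a := (w⁻¹ (posL i), w⁻¹ (posR i)))]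
  · congr 1
    ext ⟨p, q⟩
    obtain ⟨a, rfl⟩ := w⁻¹.surjective p
    obtain ⟨b, rfl⟩ := w⁻¹.surjective q
    rw [Finset.mem_insert, Finset.mem_filter, Finset.mem_filter]
    simp only [Finset.mem_univ, true_and, Prod.mk.injEq, Equiv.Perm.mul_apply, hv,
      EmbeddingLike.apply_eq_iff_eq]
    have key : ¬ (a = posR i ∧ b = posL i) ∨ ¬ w⁻¹ a < w⁻¹ b := by
      by_cases h1 : a = posR i ∧ b = posL i
      · right
        rw [h1.1, h1.2]
        exact not_lt.2 hlt.le
      · exact Or.inl h1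
    have key2 : a = posL i ∧ b = posR i → w⁻¹ a < w⁻¹ b := by
      rintro ⟨rfl, rfl⟩
      exact hlt
    have hne : w⁻¹ a < w⁻¹ b → a ≠ b := by
      rintro h rfl
      exact lt_irrefl _ h
    have key3 : a ≠ b → ¬ (a = posR i ∧ b = posL i) →
        (adjSwap i b < adjSwap i a ↔ (a = posL i ∧ b = posR i) ∨ b < a) := by
      intro h1 h2
      rw [Fin.lt_def, adjSwap_val, adjSwap_val]
      simp only [posL, posR, Fin.ext_iff, Fin.lt_def, ne_eq] at *
      grind
    by_cases hab : w⁻¹ a < w⁻¹ b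
    · rw [and_iff_right hab, and_iff_right hab]
      exact key3 (hne hab) (key.resolve_right fun h => h hab)
    · exact ⟨fun h => absurd h.1 hab, fun h => absurd (h.elim key2 And.left) hab⟩
  · simp [posL, posR]

theorem inversions_adjSwap_mul' (i : Fin (m - 1)) (w : Equiv.Perm (Fin m))
    (h : IsDescent i w) : inversions (adjSwap i * w) + 1 = inversions w := by
  have h1 : ¬ IsDescent i (adjSwap i * w) := by
    unfold IsDescent at *
    rw [mul_inv_rev, adjSwap_inv, Equiv.Perm.mul_apply, Equiv.Perm.mul_apply]
    have e1 : adjSwap i (posR i) = posL i := by ext; rw [adjSwap_val]; simp [posL, posR]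
    have e2 : adjSwap i (posL i) = posR i := by ext; rw [adjSwap_val]; simp [posL, posR]
    rw [e1, e2]
    exact not_lt.2 h.le
  have := inversions_adjSwap_mul i _ h1
  rw [← mul_assoc, adjSwap_mul_self, one_mul] at this
  exact this.symm

theorem exists_isDescent {w : Equiv.Perm (Fin m)} (hw : w ≠ 1) : ∃ i, IsDescent i w := by
  by_contra hcon
  push Not at hcon
  apply hw
  cases m with
  | zero => exact Subsingleton.elim _ _
  | succ k =>
    have h1 : StrictMono (w⁻¹ : Equiv.Perm (Fin (k + 1))) := by
      rw [Fin.strictMono_iff_lt_succ]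
      intro i
      have h2 := not_lt.1 (hcon i)
      refine lt_of_le_of_ne h2 fun e => ?_
      have := w⁻¹.injective e
      simp [Fin.ext_iff] at this
    have h3 := (h1.range_inj strictMono_id).1 (by simp)
    have h4 : w⁻¹ = 1 := Equiv.ext fun x => congrFun h3 x
    simpa using h4

theorem inversions_one : inversions (1 : Equiv.Perm (Fin m)) = 0 := by
  unfold inversions
  rw [Finset.card_eq_zero, Finset.filter_eq_empty_iff]
  rintro ⟨a, b⟩ - ⟨h1, h2⟩
  exact lt_asymm h1 h2

theorem inversions_mul_le (u v : Equiv.Perm (Fin m)) :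
    inversions (u * v) ≤ inversions u + inversions v := by
  induction hN : inversions u generalizing u with
  | zero =>
    by_cases hu : u = 1
    · simp [hu]
    · obtain ⟨i, hi⟩ := exists_isDescent hu
      have := inversions_adjSwap_mul' i u hi
      omega
  | succ N ih =>
    have hu : u ≠ 1 := by
      rintro rfl
      rw [inversions_one] at hN
      omega
    obtain ⟨i, hi⟩ := exists_isDescent hu
    have h1 := inversions_adjSwap_mul' i u hi
    have h2 := ih (adjSwap i * u) (by omega)
    rw [mul_assoc] at h2
    by_cases h3 : IsDescent i (u * v)
    · have := inversions_adjSwap_mul' i _ h3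
      omega
    · have := inversions_adjSwap_mul i _ h3
      omega

theorem eq_one_of_inversions {w : Equiv.Perm (Fin m)} (h : inversions w = 0) : w = 1 := by
  by_contra hw
  obtain ⟨i, hi⟩ := exists_isDescent hw
  have := inversions_adjSwap_mul' i w hi
  omega

theorem inversions_inv (w : Equiv.Perm (Fin m)) : inversions w⁻¹ = inversions w := by
  unfold inversions
  refine Finset.card_bij' (fun p _ => (w⁻¹ p.2, w⁻¹ p.1)) (fun p _ => (w p.2, w p.1)) ?_ ?_ ?_ ?_
  all_goals simp +contextual

theorem inversions_mul_rev (w : Equiv.Perm (Fin m)) :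
    inversions (w * Fin.revPerm) = (Finset.univ.filter fun p : Fin m × Fin m =>
      p.1 < p.2 ∧ w p.1 < w p.2).card := by
  unfold inversions
  refine Finset.card_bij' (fun p _ => (p.2.rev, p.1.rev)) (fun p _ => (p.2.rev, p.1.rev))
    ?_ ?_ ?_ ?_
  all_goals simp +contextual

/-- Precomposing with the reversal turns inversions into non-inversions, so the two counts together
exhaust all pairs. This is why every permutation lies below the reversal. -/
theorem inversions_mul_rev_add (w : Equiv.Perm (Fin m)) :
    inversions (w * Fin.revPerm) + inversions w =
      (Finset.univ.filter fun p : Fin m × Fin m => p.1 < p.2).card := by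
  rw [inversions_mul_rev, inversions, ← Finset.card_union_of_disjoint]
  · congr 1
    ext ⟨a, b⟩
    simp only [Finset.mem_union, Finset.mem_filter, Finset.mem_univ, true_and]
    constructor
    · tauto
    · intro h
      have : w a ≠ w b := fun e => h.ne (w.injective e)
      rcases lt_or_gt_of_ne this with h' | h'
      · exact Or.inl ⟨h, h'⟩
      · exact Or.inr ⟨h, h'⟩
  · rw [Finset.disjoint_left]
    simp only [Finset.mem_filter, Finset.mem_univ, true_and]
    rintro p ⟨-, h1⟩ ⟨-, h2⟩
    exact lt_asymm h1 h2

theorem inversions_rev : inversions (Fin.revPerm : Equiv.Perm (Fin m)) =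
    (Finset.univ.filter fun p : Fin m × Fin m => p.1 < p.2).card := by
  have := inversions_mul_rev_add (1 : Equiv.Perm (Fin m))
  rwa [one_mul, inversions_one] at this

theorem revPerm_inv : (Fin.revPerm : Equiv.Perm (Fin m))⁻¹ = Fin.revPerm := rfl

theorem inversions_conj_rev (w : Equiv.Perm (Fin m)) :
    inversions (Fin.revPerm⁻¹ * w * Fin.revPerm) = inversions w := by
  have h1 := inversions_mul_rev_add (Fin.revPerm⁻¹ * w)
  have h2 := inversions_mul_rev_add w⁻¹
  rw [← inversions_inv (Fin.revPerm⁻¹ * w), mul_inv_rev, inv_inv] at h1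
  rw [inversions_inv w] at h2
  omega

/-- The germ of permutations, with the weak order. -/
def permGerm (m : ℕ) : IntervalGerm (Equiv.Perm (Fin m)) where
  len := inversions
  top := Fin.revPerm
  len_one := inversions_one
  len_mul_le := inversions_mul_le
  eq_one_of_len _ := eq_one_of_inversions
  len_conj := inversions_conj_rev

theorem permGerm_simple (w : Equiv.Perm (Fin m)) : (permGerm m).Simple w := by
  change inversions w + inversions (w⁻¹ * Fin.revPerm) = inversions Fin.revPerm
  have := inversions_mul_rev_add w⁻¹
  rw [inversions_inv] at this
  rw [inversions_rev]
  omega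

theorem inversions_adjSwap (i : Fin (m - 1)) : inversions (adjSwap i) = 1 := by
  have := inversions_adjSwap_mul i 1 (by simp [IsDescent, posL, posR, Fin.lt_def])
  rwa [mul_one, inversions_one] at this

theorem pre_adjSwap_iff (i : Fin (m - 1)) (w : Equiv.Perm (Fin m)) :
    (permGerm m).Pre (adjSwap i) w ↔ IsDescent i w := by
  change inversions (adjSwap i) + inversions ((adjSwap i)⁻¹ * w) = inversions w ↔ _
  rw [inversions_adjSwap, adjSwap_inv]
  by_cases h : IsDescent i w
  · have := inversions_adjSwap_mul' i w h
    simp only [h, iff_true]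
    omega
  · have := inversions_adjSwap_mul i w h
    simp only [h, iff_false]
    omega

theorem isDescent_mul (i j : Fin (m - 1)) (w : Equiv.Perm (Fin m)) :
    IsDescent i ((adjSwap j)⁻¹ * w) ↔ w⁻¹ (adjSwap j (posR i)) < w⁻¹ (adjSwap j (posL i)) := by
  unfold IsDescent
  rw [mul_inv_rev, inv_inv]
  rfl

theorem steps_comm {i j : Fin (m - 1)} (hij : i.val + 1 < j.val ∨ j.val + 1 < i.val)
    {w : Equiv.Perm (Fin m)} (hi : IsDescent i w) (hj : IsDescent j w) :
    (permGerm m).Steps adjSwap [i, j] w := by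
  simp only [Steps, pre_adjSwap_iff, isDescent_mul, and_true]
  have e1 : adjSwap i (posR j) = posR j := by
    ext; rw [adjSwap_val]; simp only [posR]; grind
  have e2 : adjSwap i (posL j) = posL j := by
    ext; rw [adjSwap_val]; simp only [posL]; grind
  rw [e1, e2]
  exact ⟨hi, hj⟩

/-- Descents at `i` and `i + 1` say that `w⁻¹` is decreasing on three consecutive values; the three
swaps of either word remove these three inversions one by one. -/
theorem steps_braid {i j : Fin (m - 1)} (hij : i.val + 1 = j.val)
    {w : Equiv.Perm (Fin m)} (hi : IsDescent i w) (hj : IsDescent j w) :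
    (permGerm m).Steps adjSwap [i, j, i] w ∧ (permGerm m).Steps adjSwap [j, i, j] w := by
  have e0 : posR i = posL j := by ext; simpa [posR, posL] using hij
  have e1 : adjSwap i (posR j) = posR j := by
    ext; rw [adjSwap_val]; simp only [posR]; grind
  have e2 : adjSwap i (posL j) = posL i := by
    ext; rw [adjSwap_val]; simp only [posL]; grind
  have e3 : adjSwap j (posL j) = posR j := by
    ext; rw [adjSwap_val]; simp only [posL, posR]; grind
  have e4 : adjSwap j (posL i) = posL i := by
    ext; rw [adjSwap_val]; simp only [posL]; grind
  have e5 : adjSwap i (posL i) = posL j := by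
    ext; rw [adjSwap_val]; simp only [posL]; grind
  have e6 : adjSwap j (posR j) = posL j := by
    ext; rw [adjSwap_val]; simp only [posL, posR]; grind
  have h2 : w⁻¹ (posL j) < w⁻¹ (posL i) := by rw [← e0]; exact hi
  have h3 : w⁻¹ (posR j) < w⁻¹ (posL j) := hj
  simp only [Steps, pre_adjSwap_iff, isDescent_mul, and_true]
  simp only [IsDescent, mul_inv_rev, inv_inv, Equiv.Perm.mul_apply, e0, e1, e2, e3, e4, e5, e6]
  exact ⟨⟨h2, h3.trans h2, h3⟩, ⟨h3, h3.trans h2, h2⟩⟩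

theorem isDescent_rev (i : Fin (m - 1)) : IsDescent i (Fin.revPerm : Equiv.Perm (Fin m)) := by
  unfold IsDescent
  rw [revPerm_inv]
  simp [posL, posR]

theorem adjSwap_comm {i j : Fin (m - 1)} (hij : i.val + 1 < j.val ∨ j.val + 1 < i.val) :
    adjSwap i * adjSwap j = adjSwap j * adjSwap i := by
  ext x
  simp only [Equiv.Perm.mul_apply, adjSwap_val]
  grind

theorem adjSwap_braid {i j : Fin (m - 1)} (hij : i.val + 1 = j.val) :
    adjSwap i * (adjSwap j * adjSwap i) = adjSwap j * (adjSwap i * adjSwap j) := by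
  ext x
  simp only [Equiv.Perm.mul_apply, adjSwap_val]
  grind

theorem permGerm_isAtomic (m : ℕ) : (permGerm m).IsAtomic adjSwap (σ (m := m)) where
  ne_one i h := by
    have := inversions_adjSwap i
    rw [h, inversions_one] at this
    omega
  simple _ := permGerm_simple _
  exists_pre w _ hw := by
    obtain ⟨i, hi⟩ := exists_isDescent hw
    exact ⟨i, (pre_adjSwap_iff i w).2 hi⟩
  connected := by
    have good : ∀ i j : Fin (m - 1), i.val ≤ j.val →
        (permGerm m).Good adjSwap (σ (m := m)) i j ∧
          (permGerm m).Good adjSwap (σ (m := m)) j i := by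
      intro i j hij
      rcases Nat.lt_trichotomy (i.val + 1) j.val with h | h | h
      · constructor
        · refine good_of_steps [j] [i] (permGerm_simple _) (permGerm_simple _)
            (by simpa using adjSwap_comm (Or.inl h)) (by simpa using sigma_comm i j h) ?_
          intro u _ hi hj
          rw [pre_adjSwap_iff] at hi hj
          exact ⟨steps_comm (Or.inl h) hi hj, steps_comm (Or.inr h) hj hi⟩
        · refine good_of_steps [i] [j] (permGerm_simple _) (permGerm_simple _)
            (by simpa using (adjSwap_comm (Or.inl h)).symm)
            (by simpa using (sigma_comm i j h).symm) ?_
          intro u _ hi hj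
          rw [pre_adjSwap_iff] at hi hj
          exact ⟨steps_comm (Or.inr h) hi hj, steps_comm (Or.inl h) hj hi⟩
      · have hs := sigma_braid i j h
        rw [mul_assoc, mul_assoc] at hs
        constructor
        · refine good_of_steps [j, i] [i, j] (permGerm_simple _) (permGerm_simple _)
            (by simpa using adjSwap_braid h) (by simpa using hs) ?_
          intro u _ hi hj
          rw [pre_adjSwap_iff] at hi hj
          exact steps_braid h hi hj
        · refine good_of_steps [i, j] [j, i] (permGerm_simple _) (permGerm_simple _)
            (by simpa using (adjSwap_braid h).symm) (by simpa using hs.symm) ?_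
          intro u _ hj hi
          rw [pre_adjSwap_iff] at hi hj
          exact (steps_braid h hi hj).symm
      · obtain rfl : i = j := Fin.ext (by omega)
        have : (permGerm m).Good adjSwap (σ (m := m)) i i :=
          good_of_steps [] [] (permGerm_simple _) (permGerm_simple _) rfl rfl fun u _ hi _ =>
            ⟨⟨hi, trivial⟩, ⟨hi, trivial⟩⟩
        exact ⟨this, this⟩
    intro i j
    refine ⟨j, fun _ _ _ h => h, ?_, (good j j le_rfl).1⟩
    rcases le_total i.val j.val with h | h
    · exact (good i j h).1
    · exact (good j i h).2

/-- The positive permutation braid of a permutation. -/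
noncomputable def permBraid (m : ℕ) : Equiv.Perm (Fin m) → BraidGroup m :=
  IsAtomic.spell (permGerm m) adjSwap σ

theorem closure_range_sigma (m : ℕ) : Subgroup.closure (Set.range (σ (m := m))) = ⊤ :=
  PresentedGroup.closure_range_of _

/-- Both sides of a braid relation are shortest words of one permutation, so a germ morphism
respects the relations and extends to the braid group. -/
theorem permBraid_realization (m : ℕ) : (permGerm m).Realization (permBraid m) := by
  refine (permGerm_isAtomic m).realization (closure_range_sigma m) ?_
  intro N _ f hf
  refine ⟨PresentedGroup.toGroup (f := fun i => f (adjSwap i)) ?_, fun i => ?_⟩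
  · have key : ∀ L : List (Fin (m - 1)), (permGerm m).Steps adjSwap L Fin.revPerm →
        f (L.map adjSwap).prod = (L.map fun i => f (adjSwap i)).prod := fun L hL =>
      hf.map_red (permGerm_simple _) (red_of_steps_top hL)
    rintro r ⟨i, j, ⟨h, rfl⟩ | ⟨h, rfl⟩⟩
    · simp only [map_mul, map_inv, FreeGroup.lift_apply_of, mul_inv_eq_one]
      have hs := steps_braid h (isDescent_rev i) (isDescent_rev j)
      have h1 := key _ hs.1
      have h2 := key _ hs.2
      simp only [List.map_cons, List.map_nil, List.prod_cons, List.prod_nil, mul_one] at h1 h2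
      rw [mul_assoc, mul_assoc, ← h1, ← h2, adjSwap_braid h]
    · simp only [map_mul, map_inv, FreeGroup.lift_apply_of, mul_inv_eq_one]
      have h1 := key _ (steps_comm (Or.inl h) (isDescent_rev i) (isDescent_rev j))
      have h2 := key _ (steps_comm (Or.inr h) (isDescent_rev j) (isDescent_rev i))
      simp only [List.map_cons, List.map_nil, List.prod_cons, List.prod_nil, mul_one] at h1 h2
      rw [← h1, ← h2, adjSwap_comm (Or.inl h)]
  · exact PresentedGroup.toGroup.of _

/-- Inverting permutations preserves the number of inversions and exchanges prefixes with suffixes.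
-/
theorem permGerm_op_hasMeets (m : ℕ) : (permGerm m).op.HasMeets := by
  have key : ∀ u v : (Equiv.Perm (Fin m))ᵐᵒᵖ,
      (permGerm m).op.Pre u v ↔ (permGerm m).Pre u.unop⁻¹ v.unop⁻¹ := by
    intro u v
    change inversions u.unop + inversions (v.unop * u.unop⁻¹) = inversions v.unop ↔
      inversions u.unop⁻¹ + inversions (u.unop⁻¹⁻¹ * v.unop⁻¹) = inversions v.unop⁻¹
    rw [inversions_inv, inversions_inv, ← inversions_inv (v.unop * u.unop⁻¹), mul_inv_rev]
  intro u v _ _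
  obtain ⟨w, h1, h2, h3⟩ := (permGerm_isAtomic m).hasMeets u.unop⁻¹ v.unop⁻¹
    (permGerm_simple _) (permGerm_simple _)
  refine ⟨MulOpposite.op w⁻¹, (key _ _).2 (by simpa using h1), (key _ _).2 (by simpa using h2),
    fun z hz1 hz2 => (key _ _).2 ?_⟩
  simpa using h3 _ ((key _ _).1 hz1) ((key _ _).1 hz2)

theorem isDance_iff (w : Equiv.Perm (Fin m)) (x : BraidGroup m) :
    IsDance w x ↔ x = permBraid m w := by
  have hlen : ∀ L : List (Fin (m - 1)),
      (L.map fun i => (permGerm m).len (adjSwap i)).sum = L.length := by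
    intro L
    induction L with
    | nil => rfl
    | cons i L ih =>
      rw [List.map_cons, List.sum_cons, ih, List.length_cons, add_comm]
      exact congrArg _ (inversions_adjSwap i)
  constructor
  · rintro ⟨L, rfl, h2, h3⟩
    exact ((permGerm_isAtomic m).spell_eq (permGerm_simple w)
      ⟨h2, (hlen L).trans h3⟩).symm
  · rintro rfl
    obtain ⟨L, hL⟩ := (permGerm_isAtomic m).exists_red w (permGerm_simple w)
    exact ⟨L, ((permGerm_isAtomic m).spell_eq (permGerm_simple w) hL).symm, hL.1,
      (hlen L).symm.trans hL.2⟩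

theorem classicalSimpleA_eq (m : ℕ) :
    classicalSimpleA m = permBraid m '' {u | (permGerm m).Simple u} := by
  ext x
  constructor
  · rintro ⟨w, hw⟩
    exact ⟨w, permGerm_simple w, ((isDance_iff w x).1 hw).symm⟩
  · rintro ⟨w, -, rfl⟩
    exact ⟨w, (isDance_iff w _).2 rfl⟩

theorem revPerm_ne_one (hm : 2 ≤ m) : (Fin.revPerm : Equiv.Perm (Fin m)) ≠ 1 := by
  intro h
  have := congrArg (fun w : Equiv.Perm (Fin m) => (w ⟨0, by omega⟩).val) h
  simp only [Fin.revPerm_apply, Fin.val_rev, Equiv.Perm.one_apply] at this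
  omega

theorem isGarside_classicalSimpleA (hm : 2 ≤ m) :
    IsGarside (classicalSimpleA m) (permBraid m Fin.revPerm) := by
  rw [classicalSimpleA_eq]
  exact (permBraid_realization m).isGarside (permGerm_isAtomic m).hasMeets (revPerm_ne_one hm)

theorem isGarside_classicalSimpleA_op (hm : 2 ≤ m) :
    IsGarside (MulOpposite.unop ⁻¹' (classicalSimpleA m))
      (MulOpposite.op (permBraid m Fin.revPerm)) := by
  rw [classicalSimpleA_eq]
  exact (permBraid_realization m).isGarside_op (permGerm_op_hasMeets m) (revPerm_ne_one hm)

end Inversions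
open IntervalGerm

/-! ### The classical Garside structure of the Artin group of type `B` -/

theorem IntervalGerm.Realization.top_mul {W G : Type} [Group W] [Group G] {I : IntervalGerm W}
    {b : W → G} (hb : I.Realization b) {u : W} (hu : I.Simple u) :
    b I.top * b u = b (I.top * u * I.top⁻¹) * b I.top := by
  have h2 := hb.mul_compl (simple_conj' hu)
  have h3 := hb.mul_compl (simple_compl (simple_conj' hu))
  have e : ((I.top * u * I.top⁻¹)⁻¹ * I.top)⁻¹ * I.top = u := by group
  rw [e] at h3
  nth_rw 1 [← h2]
  rw [mul_assoc, h3]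

section TypeB

variable {n : ℕ}

theorem s_four (i j : Fin n) (hi : i.val = 0) (hj : j.val = 1) :
    s i * s j * s i * s j = s j * s i * s j * s i := by
  have := PresentedGroup.one_of_mem (rels := typeBRels n) ⟨i, j, Or.inl ⟨hi, hj, rfl⟩⟩
  simp only [map_mul, map_inv] at this
  exact mul_inv_eq_one.mp this

theorem s_comm (i j : Fin n) (h : i.val + 1 < j.val) : s i * s j = s j * s i := by
  have := PresentedGroup.one_of_mem (rels := typeBRels n) ⟨i, j, Or.inr (Or.inl ⟨h, rfl⟩)⟩
  simp only [map_mul, map_inv] at this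
  exact mul_inv_eq_one.mp this

theorem s_braid (i j : Fin n) (h0 : 1 ≤ i.val) (h : i.val + 1 = j.val) :
    s i * s j * s i = s j * s i * s j := by
  have := PresentedGroup.one_of_mem (rels := typeBRels n) ⟨i, j, Or.inr (Or.inr ⟨h0, h, rfl⟩)⟩
  simp only [map_mul, map_inv] at this
  exact mul_inv_eq_one.mp this

theorem Psi_s (i : Fin n) : Psi n (s i) = psiGen n i := PresentedGroup.toGroup.of _

/-- The permutations that commute with the half turn. -/
def symPerm (n : ℕ) : Subgroup (Equiv.Perm (Fin (2 * n))) where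
  carrier := {w | ∀ i, w i.rev = (w i).rev}
  one_mem' _ := rfl
  mul_mem' {u v} hu hv i := by
    rw [Equiv.Perm.mul_apply, hv, hu]
    rfl
  inv_mem' {u} hu i := by
    apply u.injective
    rw [hu]
    simp

theorem mem_symPerm_iff (w : Equiv.Perm (Fin (2 * n))) :
    w ∈ symPerm n ↔ Fin.revPerm * w * Fin.revPerm⁻¹ = w := by
  rw [mul_inv_eq_iff_eq_mul]
  constructor
  · intro h
    ext i
    simp [h i]
  · intro h i
    have := congrArg (fun u : Equiv.Perm (Fin (2 * n)) => u i) h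
    exact this.symm

theorem rev_mem_symPerm (n : ℕ) : Fin.revPerm ∈ symPerm n := fun _ => rfl

/-- The germ of the symmetric permutations. -/
def symGerm (n : ℕ) : IntervalGerm (symPerm n) where
  len w := inversions w.1
  top := ⟨Fin.revPerm, rev_mem_symPerm n⟩
  len_one := inversions_one
  len_mul_le u v := inversions_mul_le u.1 v.1
  eq_one_of_len _ h := Subtype.ext (eq_one_of_inversions h)
  len_conj u := inversions_conj_rev u.1

theorem symGerm_simple (w : symPerm n) : (symGerm n).Simple w := permGerm_simple w.1

theorem symGerm_pre_iff (u v : symPerm n) :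
    (symGerm n).Pre u v ↔ (permGerm (2 * n)).Pre u.1 v.1 := Iff.rfl

/-- The index of the right one of the two half twists in `Ψ (s i)`. -/
def hiIdx (i : Fin n) : Fin (2 * n - 1) := ⟨n - 1 + i.val, by omega⟩

/-- The index of the left one of the two half twists in `Ψ (s i)`. -/
def loIdx (i : Fin n) : Fin (2 * n - 1) := ⟨n - 1 - i.val, by omega⟩

/-- The permutation of `Ψ (s i)`. -/
def symSwap' (i : Fin n) : Equiv.Perm (Fin (2 * n)) :=
  if i.val = 0 then adjSwap (hiIdx i) else adjSwap (hiIdx i) * adjSwap (loIdx i)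

theorem symSwap'_val (i : Fin n) (x : Fin (2 * n)) : (symSwap' i x).val =
    if x.val = n - 1 + i.val then n + i.val else if x.val = n + i.val then n - 1 + i.val else
    if x.val + 1 + i.val = n then n - i.val else if x.val + i.val = n then n - 1 - i.val else
    x.val := by
  unfold symSwap'
  have := i.isLt
  by_cases hi : i.val = 0
  · rw [if_pos hi, adjSwap_val]
    simp only [hiIdx]
    grind
  · rw [if_neg hi, Equiv.Perm.mul_apply, adjSwap_val, adjSwap_val]
    simp only [hiIdx, loIdx]
    grind

theorem symSwap'_mem (i : Fin n) : symSwap' i ∈ symPerm n := by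
  intro x
  ext
  have := i.isLt
  have := x.isLt
  simp only [symSwap'_val, Fin.val_rev]
  grind

/-- The permutation of `Ψ (s i)`, as a symmetric permutation. -/
def symSwap (i : Fin n) : symPerm n := ⟨symSwap' i, symSwap'_mem i⟩

theorem isDescent_lo_iff (i : Fin n) (w : symPerm n) :
    IsDescent (loIdx i) w.1 ↔ IsDescent (hiIdx i) w.1 := by
  have hw := (symPerm n).inv_mem w.2
  have e1 : posR (loIdx i) = (posL (hiIdx i)).rev := by
    ext; simp only [posL, posR, loIdx, hiIdx, Fin.val_rev]; omega
  have e2 : posL (loIdx i) = (posR (hiIdx i)).rev := by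
    ext; simp only [posL, posR, loIdx, hiIdx, Fin.val_rev]; omega
  unfold IsDescent
  rw [e1, e2, hw, hw, Fin.rev_lt_rev]

theorem steps_hi_lo {i : Fin n} (hi : i.val ≠ 0) {w : symPerm n} (h : IsDescent (hiIdx i) w.1) :
    (permGerm (2 * n)).Steps adjSwap [hiIdx i, loIdx i] w.1 :=
  steps_comm (Or.inr (by simp only [hiIdx, loIdx]; omega)) h ((isDescent_lo_iff i w).2 h)

theorem red_symSwap {i : Fin n} (hi : i.val ≠ 0) :
    (permGerm (2 * n)).Red adjSwap [hiIdx i, loIdx i] (symSwap' i) := by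
  have := red_of_steps_top (I := permGerm (2 * n))
    (steps_hi_lo hi (w := ⟨Fin.revPerm, rev_mem_symPerm n⟩) (isDescent_rev _))
  simpa [symSwap', hi] using this

/-- Lengths are inversions in the full symmetric group, so the atoms with `i ≠ 0` have length two.
By symmetry their two commuting adjacent swaps are descents of `w` simultaneously. -/
theorem pre_symSwap_iff (i : Fin n) (w : symPerm n) :
    (symGerm n).Pre (symSwap i) w ↔ IsDescent (hiIdx i) w.1 := by
  rw [symGerm_pre_iff]
  by_cases hi : i.val = 0
  · simp only [symSwap, symSwap', hi, if_true]
    exact pre_adjSwap_iff _ _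
  · have hred := red_symSwap hi
    constructor
    · intro h
      rw [← pre_adjSwap_iff]
      exact pre_trans hred.cons.1 h
    · intro h
      have h1 := (steps_hi_lo hi h).sum_add
      rw [hred.1, hred.2] at h1
      exact h1

theorem isDescent_symSwap_mul (i : Fin (2 * n - 1)) (j : Fin n) (w : symPerm n) :
    IsDescent i ((symSwap j)⁻¹ * w).1 ↔
      w.1⁻¹ (symSwap' j (posR i)) < w.1⁻¹ (symSwap' j (posL i)) := by
  unfold IsDescent
  rw [show (((symSwap j)⁻¹ * w).1)⁻¹ = w.1⁻¹ * symSwap' j by simp [symSwap]]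
  rfl

theorem steps_sym_comm {i j : Fin n} (hij : i.val + 1 < j.val ∨ j.val + 1 < i.val)
    {w : symPerm n} (hi : IsDescent (hiIdx i) w.1) (hj : IsDescent (hiIdx j) w.1) :
    (symGerm n).Steps symSwap [i, j] w := by
  simp only [Steps, pre_symSwap_iff, isDescent_symSwap_mul, and_true]
  have e1 : symSwap' i (posR (hiIdx j)) = posR (hiIdx j) := by
    ext; rw [symSwap'_val]; simp only [posR, hiIdx]; grind
  have e2 : symSwap' i (posL (hiIdx j)) = posL (hiIdx j) := by
    ext; rw [symSwap'_val]; simp only [posL, hiIdx]; grind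
  rw [e1, e2]
  exact ⟨hi, hj⟩

theorem steps_sym_braid {i j : Fin n} (h0 : 1 ≤ i.val) (hij : i.val + 1 = j.val)
    {w : symPerm n} (hi : IsDescent (hiIdx i) w.1) (hj : IsDescent (hiIdx j) w.1) :
    (symGerm n).Steps symSwap [i, j, i] w ∧ (symGerm n).Steps symSwap [j, i, j] w := by
  have e0 : posR (hiIdx i) = posL (hiIdx j) := by ext; simp only [posR, posL, hiIdx]; omega
  have e1 : symSwap' i (posR (hiIdx j)) = posR (hiIdx j) := by
    ext; rw [symSwap'_val]; simp only [posR, hiIdx]; grind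
  have e2 : symSwap' i (posL (hiIdx j)) = posL (hiIdx i) := by
    ext; rw [symSwap'_val]; simp only [posL, hiIdx]; grind
  have e3 : symSwap' j (posL (hiIdx j)) = posR (hiIdx j) := by
    ext; rw [symSwap'_val]; simp only [posL, posR, hiIdx]; grind
  have e4 : symSwap' j (posL (hiIdx i)) = posL (hiIdx i) := by
    ext; rw [symSwap'_val]; simp only [posL, hiIdx]; grind
  have e5 : symSwap' i (posL (hiIdx i)) = posL (hiIdx j) := by
    ext; rw [symSwap'_val]; simp only [posL, hiIdx]; grind
  have e6 : symSwap' j (posR (hiIdx j)) = posL (hiIdx j) := by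
    ext; rw [symSwap'_val]; simp only [posL, posR, hiIdx]; grind
  have h2 : w.1⁻¹ (posL (hiIdx j)) < w.1⁻¹ (posL (hiIdx i)) := by rw [← e0]; exact hi
  have h3 : w.1⁻¹ (posR (hiIdx j)) < w.1⁻¹ (posL (hiIdx j)) := hj
  simp only [Steps, pre_symSwap_iff, isDescent_symSwap_mul, and_true]
  simp only [IsDescent, Subgroup.coe_mul, Subgroup.coe_inv, symSwap, mul_inv_rev, inv_inv,
    Equiv.Perm.mul_apply, e0, e1, e2, e3, e4, e5, e6]
  exact ⟨⟨h2, h3.trans h2, h3⟩, ⟨h3, h3.trans h2, h2⟩⟩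

/-- By symmetry the two descents make `w⁻¹` decreasing on the four middle values, and both words of
length four undo all six inversions among them. -/
theorem steps_sym_four {i j : Fin n} (h0 : i.val = 0) (hj1 : j.val = 1)
    {w : symPerm n} (hi : IsDescent (hiIdx i) w.1) (hj : IsDescent (hiIdx j) w.1) :
    (symGerm n).Steps symSwap [i, j, i, j] w ∧ (symGerm n).Steps symSwap [j, i, j, i] w := by
  have hn := j.isLt
  have e0 : posR (hiIdx i) = posL (hiIdx j) := by ext; simp only [posR, posL, hiIdx]; omega
  have e0' : posR (loIdx j) = posL (hiIdx i) := by
    ext; simp only [posR, posL, hiIdx, loIdx]; omega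
  have a0 : symSwap' i (posL (loIdx j)) = posL (loIdx j) := by
    ext; rw [symSwap'_val]; simp only [posL, loIdx]; grind
  have a2 : symSwap' i (posL (hiIdx j)) = posL (hiIdx i) := by
    ext; rw [symSwap'_val]; simp only [posL, hiIdx]; grind
  have a3 : symSwap' i (posR (hiIdx j)) = posR (hiIdx j) := by
    ext; rw [symSwap'_val]; simp only [posR, hiIdx]; grind
  have b0 : symSwap' j (posL (loIdx j)) = posL (hiIdx i) := by
    ext; rw [symSwap'_val]; simp only [posL, hiIdx, loIdx]; grind
  have b1 : symSwap' j (posL (hiIdx i)) = posL (loIdx j) := by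
    ext; rw [symSwap'_val]; simp only [posL, hiIdx, loIdx]; grind
  have b2 : symSwap' j (posL (hiIdx j)) = posR (hiIdx j) := by
    ext; rw [symSwap'_val]; simp only [posL, posR, hiIdx]; grind
  have b3 : symSwap' j (posR (hiIdx j)) = posL (hiIdx j) := by
    ext; rw [symSwap'_val]; simp only [posL, posR, hiIdx]; grind
  have h1 : w.1⁻¹ (posL (hiIdx i)) < w.1⁻¹ (posL (loIdx j)) := by
    rw [← e0']; exact (isDescent_lo_iff j w).2 hj
  have h2 : w.1⁻¹ (posL (hiIdx j)) < w.1⁻¹ (posL (hiIdx i)) := by rw [← e0]; exact hi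
  have h3 : w.1⁻¹ (posR (hiIdx j)) < w.1⁻¹ (posL (hiIdx j)) := hj
  simp only [Steps, pre_symSwap_iff, isDescent_symSwap_mul, and_true]
  simp only [IsDescent, Subgroup.coe_mul, Subgroup.coe_inv, symSwap, mul_inv_rev, inv_inv,
    Equiv.Perm.mul_apply, e0, a0, a2, a3, b0, b1, b2, b3]
  exact ⟨⟨h2, h3.trans h2, (h3.trans h2).trans h1, h1⟩,
    ⟨h3, h3.trans (h2.trans h1), h2.trans h1, h2⟩⟩

theorem exists_braidPerm (m : ℕ) :
    ∃ θ : BraidGroup m →* Equiv.Perm (Fin m), ∀ i, θ (σ i) = adjSwap i := by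
  obtain ⟨θ, hθ⟩ := (permBraid_realization m).lift (fun u => u) fun _ _ _ _ => rfl
  refine ⟨θ, fun i => ?_⟩
  rw [← (permGerm_isAtomic m).spell_atom i]
  exact hθ _ (permGerm_simple _)

/-- It yields the type `B` relations between the symmetric swaps from those in the Artin group,
without computing with permutations. -/
theorem exists_symPermHom (n : ℕ) :
    ∃ θ : ArtinGroupB n →* Equiv.Perm (Fin (2 * n)), ∀ i, θ (s i) = symSwap' i := by
  obtain ⟨θ, hθ⟩ := exists_braidPerm (2 * n)
  refine ⟨θ.comp (Psi n), fun i => ?_⟩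
  rw [MonoidHom.comp_apply, Psi_s, psiGen, symSwap']
  split_ifs with h
  · rw [hθ]
    congr 1
    exact Fin.ext (by simp [hiIdx, h])
  · rw [map_mul, hθ, hθ]
    rfl

theorem symSwap_four {i j : Fin n} (hi : i.val = 0) (hj : j.val = 1) :
    symSwap i * (symSwap j * (symSwap i * symSwap j)) =
      symSwap j * (symSwap i * (symSwap j * symSwap i)) := by
  obtain ⟨θ, hθ⟩ := exists_symPermHom n
  have := congrArg θ (s_four i j hi hj)
  simp only [map_mul, hθ, mul_assoc] at this
  exact Subtype.ext this

theorem symSwap_comm {i j : Fin n} (h : i.val + 1 < j.val) :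
    symSwap i * symSwap j = symSwap j * symSwap i := by
  obtain ⟨θ, hθ⟩ := exists_symPermHom n
  have := congrArg θ (s_comm i j h)
  simp only [map_mul, hθ] at this
  exact Subtype.ext this

theorem symSwap_braid {i j : Fin n} (h0 : 1 ≤ i.val) (h : i.val + 1 = j.val) :
    symSwap i * (symSwap j * symSwap i) = symSwap j * (symSwap i * symSwap j) := by
  obtain ⟨θ, hθ⟩ := exists_symPermHom n
  have := congrArg θ (s_braid i j h0 h)
  simp only [map_mul, hθ, mul_assoc] at this
  exact Subtype.ext this

theorem symGerm_isAtomic (n : ℕ) : (symGerm n).IsAtomic symSwap (s (n := n)) where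
  ne_one i h := by
    have h1 : IsDescent (hiIdx i) ((1 : symPerm n)).1 := by
      rw [← pre_symSwap_iff, h]
      exact pre_refl _
    simp [IsDescent, posL, posR, Fin.lt_def] at h1
  simple _ := symGerm_simple _
  exists_pre w _ hw := by
    obtain ⟨i, hi⟩ := exists_isDescent (w := w.1) fun h => hw (Subtype.ext h)
    have hlt := i.isLt
    rcases le_total (n - 1) i.val with h | h
    · refine ⟨⟨i.val - (n - 1), by omega⟩, (pre_symSwap_iff _ w).2 ?_⟩
      convert hi using 1
      exact Fin.ext (by simp only [hiIdx]; omega)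
    · refine ⟨⟨n - 1 - i.val, by omega⟩, (pre_symSwap_iff _ w).2 ((isDescent_lo_iff _ w).1 ?_)⟩
      convert hi using 1
      exact Fin.ext (by simp only [loIdx]; omega)
  connected := by
    have good : ∀ i j : Fin n, i.val ≤ j.val →
        (symGerm n).Good symSwap (s (n := n)) i j ∧ (symGerm n).Good symSwap (s (n := n)) j i := by
      intro i j hij
      rcases Nat.lt_trichotomy (i.val + 1) j.val with h | h | h
      · constructor
        · refine good_of_steps [j] [i] (symGerm_simple _) (symGerm_simple _)
            (by simpa using symSwap_comm h) (by simpa using s_comm i j h) ?_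
          intro u _ hi hj
          rw [pre_symSwap_iff] at hi hj
          exact ⟨steps_sym_comm (Or.inl h) hi hj, steps_sym_comm (Or.inr h) hj hi⟩
        · refine good_of_steps [i] [j] (symGerm_simple _) (symGerm_simple _)
            (by simpa using (symSwap_comm h).symm)
            (by simpa using (s_comm i j h).symm) ?_
          intro u _ hi hj
          rw [pre_symSwap_iff] at hi hj
          exact ⟨steps_sym_comm (Or.inr h) hi hj, steps_sym_comm (Or.inl h) hj hi⟩
      · rcases Nat.eq_zero_or_pos i.val with h0 | h0
        · have hj1 : j.val = 1 := by omega
          have hs := s_four i j h0 hj1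
          simp only [mul_assoc] at hs
          constructor
          · refine good_of_steps [j, i, j] [i, j, i] (symGerm_simple _) (symGerm_simple _)
              (by simpa using symSwap_four h0 hj1) (by simpa using hs) ?_
            intro u _ hi hj
            rw [pre_symSwap_iff] at hi hj
            exact steps_sym_four h0 hj1 hi hj
          · refine good_of_steps [i, j, i] [j, i, j] (symGerm_simple _) (symGerm_simple _)
              (by simpa using (symSwap_four h0 hj1).symm) (by simpa using hs.symm) ?_
            intro u _ hj hi
            rw [pre_symSwap_iff] at hi hj
            exact (steps_sym_four h0 hj1 hi hj).symm
        · have hs := s_braid i j h0 h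
          simp only [mul_assoc] at hs
          constructor
          · refine good_of_steps [j, i] [i, j] (symGerm_simple _) (symGerm_simple _)
              (by simpa using symSwap_braid h0 h) (by simpa using hs) ?_
            intro u _ hi hj
            rw [pre_symSwap_iff] at hi hj
            exact steps_sym_braid h0 h hi hj
          · refine good_of_steps [i, j] [j, i] (symGerm_simple _) (symGerm_simple _)
              (by simpa using (symSwap_braid h0 h).symm) (by simpa using hs.symm) ?_
            intro u _ hj hi
            rw [pre_symSwap_iff] at hi hj
            exact (steps_sym_braid h0 h hi hj).symm
      · obtain rfl : i = j := Fin.ext (by omega)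
        have : (symGerm n).Good symSwap (s (n := n)) i i :=
          good_of_steps [] [] (symGerm_simple _) (symGerm_simple _) rfl rfl fun u _ hi _ =>
            ⟨⟨hi, trivial⟩, ⟨hi, trivial⟩⟩
        exact ⟨this, this⟩
    intro i j
    refine ⟨j, fun _ _ _ h => h, ?_, (good j j le_rfl).1⟩
    rcases le_total i.val j.val with h | h
    · exact (good i j h).1
    · exact (good j i h).2

/-- The classical simple element of `A(B_n)` given by a symmetric permutation. -/
noncomputable def symBraid (n : ℕ) : symPerm n → ArtinGroupB n :=
  IsAtomic.spell (symGerm n) symSwap s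

theorem symBraid_realization (n : ℕ) : (symGerm n).Realization (symBraid n) := by
  refine (symGerm_isAtomic n).realization (PresentedGroup.closure_range_of _) ?_
  intro N _ f hf
  refine ⟨PresentedGroup.toGroup (f := fun i => f (symSwap i)) ?_, fun i => ?_⟩
  · have key : ∀ L : List (Fin n), (symGerm n).Steps symSwap L (symGerm n).top →
        f (L.map symSwap).prod = (L.map fun i => f (symSwap i)).prod := fun L hL =>
      hf.map_red (symGerm_simple _) (red_of_steps_top hL)
    rintro r ⟨i, j, ⟨h0, h1, rfl⟩ | ⟨h, rfl⟩ | ⟨h0, h, rfl⟩⟩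
    · simp only [map_mul, map_inv, FreeGroup.lift_apply_of, mul_inv_eq_one]
      have hs := steps_sym_four h0 h1 (w := (symGerm n).top) (isDescent_rev _) (isDescent_rev _)
      have h2 := key _ hs.1
      have h3 := key _ hs.2
      simp only [List.map_cons, List.map_nil, List.prod_cons, List.prod_nil, mul_one] at h2 h3
      simp only [mul_assoc]
      rw [← h2, ← h3, symSwap_four h0 h1]
    · simp only [map_mul, map_inv, FreeGroup.lift_apply_of, mul_inv_eq_one]
      have h1 := key _ (steps_sym_comm (Or.inl h) (w := (symGerm n).top) (isDescent_rev _)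
        (isDescent_rev _))
      have h2 := key _ (steps_sym_comm (Or.inr h) (w := (symGerm n).top) (isDescent_rev _)
        (isDescent_rev _))
      simp only [List.map_cons, List.map_nil, List.prod_cons, List.prod_nil, mul_one] at h1 h2
      rw [← h1, ← h2, symSwap_comm h]
    · simp only [map_mul, map_inv, FreeGroup.lift_apply_of, mul_inv_eq_one]
      have hs := steps_sym_braid h0 h (w := (symGerm n).top) (isDescent_rev _) (isDescent_rev _)
      have h1 := key _ hs.1
      have h2 := key _ hs.2
      simp only [List.map_cons, List.map_nil, List.prod_cons, List.prod_nil, mul_one] at h1 h2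
      simp only [mul_assoc]
      rw [← h1, ← h2, symSwap_braid h0 h]
  · exact PresentedGroup.toGroup.of _

/-! ### Kernel and image of `Ψ` -/

theorem permBraid_symSwap (i : Fin n) : permBraid (2 * n) (symSwap' i) = psiGen n i := by
  by_cases hi : i.val = 0
  · rw [symSwap', if_pos hi, psiGen, if_pos hi]
    refine ((permGerm_isAtomic (2 * n)).spell_atom _).trans ?_
    congr 1
    exact Fin.ext (by simp [hiIdx, hi])
  · refine ((permGerm_isAtomic (2 * n)).spell_eq (permGerm_simple _) (red_symSwap hi)).trans ?_
    rw [psiGen, if_neg hi]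
    simp [hiIdx, loIdx]

theorem Psi_symBraid (w : symPerm n) : Psi n (symBraid n w) = permBraid (2 * n) w.1 := by
  obtain ⟨L, hL⟩ := (symGerm_isAtomic n).exists_red w (symGerm_simple w)
  have h1 : (symGerm n).IsMorphism fun w : symPerm n => permBraid (2 * n) w.1 :=
    fun u v huv _ => (permBraid_realization (2 * n)).mul u.1 v.1 huv (permGerm_simple _)
  have h2 := h1.map_red (symGerm_simple w) hL
  have h3 := (symGerm_isAtomic n).spell_eq (symGerm_simple w) hL
  rw [h2, symBraid, h3, map_list_prod, List.map_map]
  congr 1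
  refine List.map_congr_left fun i _ => ?_
  rw [Function.comp_apply, Psi_s]
  exact (permBraid_symSwap i).symm

theorem permBraid_injective (m : ℕ) : Function.Injective (permBraid m) := fun _ _ h =>
  (permBraid_realization m).injOn (permGerm_isAtomic m).hasMeets (permGerm_simple _)
    (permGerm_simple _) h

theorem rev_mul_permBraid (m : ℕ) (u : Equiv.Perm (Fin m)) :
    permBraid m Fin.revPerm * permBraid m u =
      permBraid m (Fin.revPerm * u * Fin.revPerm⁻¹) * permBraid m Fin.revPerm :=
  (permBraid_realization m).top_mul (permGerm_simple u)

theorem commute_permBraid_iff (u : Equiv.Perm (Fin (2 * n))) :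
    Commute (permBraid (2 * n) Fin.revPerm) (permBraid (2 * n) u) ↔ u ∈ symPerm n := by
  rw [mem_symPerm_iff, commute_iff_eq, rev_mul_permBraid, mul_left_inj]
  exact (permBraid_injective _).eq_iff

/-- Injectivity of `Ψ` is not yet available here, so the comparison is made in the germs: the head
of the image commutes with `Δ`, hence comes from a symmetric permutation, and both prefix orders are
the order of permutations. -/
theorem leftWeighted_Psi (hn : 1 ≤ n) {x y : ArtinGroupB n}
    (hx : x ∈ symBraid n '' {u | (symGerm n).Simple u})
    (hy : y ∈ symBraid n '' {u | (symGerm n).Simple u})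
    (hw : LeftWeighted (symBraid n '' {u | (symGerm n).Simple u}) x y) :
    LeftWeighted (classicalSimpleA (2 * n)) (Psi n x) (Psi n y) := by
  have hA := isGarside_classicalSimpleA (m := 2 * n) (by omega)
  have hmA := (permGerm_isAtomic (2 * n)).hasMeets
  have hmB := (symGerm_isAtomic n).hasMeets
  have hRA := permBraid_realization (2 * n)
  have hRB := symBraid_realization n
  obtain ⟨u, -, rfl⟩ := hx
  obtain ⟨v, -, rfl⟩ := hy
  have mem : ∀ u, permBraid (2 * n) u ∈ classicalSimpleA (2 * n) := fun u => by
    rw [classicalSimpleA_eq]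
    exact ⟨u, permGerm_simple u, rfl⟩
  rw [Psi_symBraid, Psi_symBraid]
  obtain ⟨z, hz⟩ := hA.exists_isHead (mul_mem (Submonoid.subset_closure (mem u.1))
    (Submonoid.subset_closure (mem v.1)))
  obtain ⟨h1, h2, h3⟩ := hA.head_mul (mem u.1) (Submonoid.subset_closure (mem v.1)) hz
  have hzc := hA.commute_of_isHead 1 (by
    rw [pow_one]
    exact ((commute_permBraid_iff u.1).2 u.2).mul_right ((commute_permBraid_iff v.1).2 v.2)) hz
  rw [pow_one] at hzc
  have hzS := hz.1
  rw [classicalSimpleA_eq] at hzS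
  obtain ⟨w, -, rfl⟩ := hzS
  have hwm := (commute_permBraid_iff w).1 hzc
  rw [classicalSimpleA_eq, hRA.isPrefix_iff hmA (permGerm_simple _) (permGerm_simple _)] at h1
  have e : (permBraid (2 * n) u.1)⁻¹ * permBraid (2 * n) w = permBraid (2 * n) (u.1⁻¹ * w) := by
    rw [inv_mul_eq_iff_eq_mul, ← hRA.mul _ _ (by simpa using h1) (permGerm_simple _),
      mul_inv_cancel_left]
  rw [e, classicalSimpleA_eq, hRA.isPrefix_iff hmA (permGerm_simple _) (permGerm_simple _)] at h3
  set w' : symPerm n := ⟨w, hwm⟩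
  have h4 : symBraid n w' = symBraid n u * symBraid n (u⁻¹ * w') := by
    rw [← hRB.mul _ _ (by rw [mul_inv_cancel_left]; exact h1) (symGerm_simple _),
      mul_inv_cancel_left]
  have h5 : IsPrefix (symBraid n '' {u | (symGerm n).Simple u}) (symBraid n w')
      (symBraid n u * symBraid n v) := by
    rw [h4, isPrefix_mul_left, hRB.isPrefix_iff hmB (symGerm_simple _) (symGerm_simple _)]
    exact h3
  have h6 := hw _ ⟨w', symGerm_simple _, rfl⟩ h5
  rw [hRB.isPrefix_iff hmB (symGerm_simple _) (symGerm_simple _)] at h6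
  intro t ht htp
  refine isPrefix_trans (hz.2.2 t ht htp) ?_
  rw [classicalSimpleA_eq, hRA.isPrefix_iff hmA (permGerm_simple _) (permGerm_simple _)]
  exact h6

/-- The normal form of `β` maps factor by factor to a normal form of `Ψ β`. If `Ψ β = 1`, that form
is empty with exponent zero, so the same holds for `β`. -/
theorem Psi_injective (hn : 1 ≤ n) : Function.Injective (Psi n) := by
  have hA := isGarside_classicalSimpleA (m := 2 * n) (by omega)
  have hB := (symBraid_realization n).isGarside (symGerm_isAtomic n).hasMeets
    fun h => revPerm_ne_one (m := 2 * n) (by omega) (congrArg Subtype.val h)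
  rw [injective_iff_map_eq_one]
  intro β hβ
  obtain ⟨⟨xs, p⟩, ⟨h1, h2, h3⟩, -⟩ := hB.existsUnique_zpow_mul β
  simp only at h1 h2 h3
  have hproper : ∀ x ∈ xs.map (Psi n), x ∈ classicalSimpleA (2 * n) ∧ x ≠ 1 ∧
      x ≠ permBraid (2 * n) Fin.revPerm := by
    intro y hy
    obtain ⟨x, hx, rfl⟩ := List.mem_map.1 hy
    obtain ⟨⟨u, -, rfl⟩, h5, h6⟩ := h2 x hx
    rw [Psi_symBraid]
    refine ⟨by rw [classicalSimpleA_eq]; exact ⟨_, permGerm_simple _, rfl⟩, fun e => h5 ?_,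
      fun e => h6 ?_⟩
    · rw [← (permBraid_realization (2 * n)).map_one] at e
      have : u = 1 := Subtype.ext (permBraid_injective _ e)
      rw [this, (symBraid_realization n).map_one]
    · have : u = (symGerm n).top := Subtype.ext (permBraid_injective _ e)
      rw [this]
  have hchain : (xs.map (Psi n)).IsChain (LeftWeighted (classicalSimpleA (2 * n))) := by
    clear h1 hproper
    induction xs with
    | nil => simp
    | cons x l ih =>
      cases l with
      | nil => simp
      | cons y l =>
        rw [List.isChain_cons_cons] at h3
        rw [List.map_cons, List.map_cons, List.isChain_cons_cons]
        exact ⟨leftWeighted_Psi hn (h2 x (by simp)).1 (h2 y (by simp)).1 h3.1,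
          ih (fun z hz => h2 z (by simp at hz ⊢; tauto)) h3.2⟩
  have hprod : (1 : BraidGroup (2 * n)) =
      permBraid (2 * n) Fin.revPerm ^ p * (xs.map (Psi n)).prod := by
    rw [← hβ, h1, map_mul, map_zpow, map_list_prod, Psi_symBraid]
    rfl
  have := (hA.existsUnique_zpow_mul 1).unique (y₁ := (xs.map (Psi n), p)) (y₂ := ([], 0))
    ⟨hprod, hproper, hchain⟩ ⟨by simp, by simp, by simp⟩
  obtain ⟨h7, rfl⟩ := Prod.mk.inj this
  rw [List.map_eq_nil_iff] at h7
  simp [h1, h7]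

theorem Psi_isCentralizerEmbedding (hn : 1 ≤ n) :
    IsCentralizerEmbedding (Psi n) (permBraid (2 * n) Fin.revPerm) (symBraid n (symGerm n).top)
      1 where
  injective := Psi_injective hn
  map_top := Psi_symBraid _
  exists_iff g := by
    have hA := isGarside_classicalSimpleA (m := 2 * n) (by omega)
    constructor
    · rintro ⟨β, rfl⟩
      rw [pow_one]
      have hβ : β ∈ Subgroup.closure (Set.range (s (n := n))) := by
        rw [show Subgroup.closure (Set.range (s (n := n))) = ⊤ from
          PresentedGroup.closure_range_of _]
        trivial
      induction hβ using Subgroup.closure_induction with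
      | mem x hx =>
        obtain ⟨i, rfl⟩ := hx
        rw [Psi_s, ← permBraid_symSwap, commute_permBraid_iff]
        exact symSwap'_mem i
      | one => simp
      | mul x y _ _ hx hy => rw [map_mul]; exact hx.mul_right hy
      | inv x _ hx => rw [map_inv]; exact hx.inv_right
    · intro hg
      obtain ⟨k, hk⟩ := hA.exists_pow_mul_mem g
      obtain ⟨l, hl, hp⟩ := Submonoid.exists_list_of_mem_closure hk
      obtain ⟨l', -, h2, h3⟩ := hA.exists_commuting_list 1 l hl (by
        rw [hp]
        exact (Commute.pow_pow_self _ _ _).mul_right hg)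
      have h4 : l'.prod ∈ (Psi n).range := by
        refine Subgroup.list_prod_mem _ fun x hx => ?_
        obtain ⟨hxS, hxc⟩ := h2 x hx
        rw [classicalSimpleA_eq] at hxS
        obtain ⟨w, -, rfl⟩ := hxS
        rw [pow_one, commute_permBraid_iff] at hxc
        exact ⟨symBraid n ⟨w, hxc⟩, Psi_symBraid _⟩
      have h5 : permBraid (2 * n) Fin.revPerm ∈ (Psi n).range :=
        ⟨symBraid n (symGerm n).top, Psi_symBraid _⟩
      rw [h3, hp] at h4
      exact (Subgroup.mul_mem_cancel_left _ (pow_mem h5 k)).1 h4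

/-- The symmetry of the permutation is automatic: elements of the image commute with `Δ`, and a
permutation braid commuting with `Δ` has a symmetric permutation. -/
theorem classicalSimpleB_eq (hn : 1 ≤ n) :
    classicalSimpleB n = Psi n ⁻¹' (classicalSimpleA (2 * n)) := by
  ext x
  constructor
  · rintro ⟨w, -, hw⟩
    exact ⟨w, hw⟩
  · rintro ⟨w, hw⟩
    refine ⟨w, ?_, hw⟩
    have h1 := ((Psi_isCentralizerEmbedding hn).exists_iff _).1 ⟨x, rfl⟩
    rw [(isDance_iff w _).1 hw, pow_one, commute_permBraid_iff] at h1
    exact h1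

end TypeB
/-! ### The classical Garside elements -/

section Words

variable {m : ℕ}

/-- `x` is given by a positive word of length `k` with permutation `w`. -/
def IsWord (k : ℕ) (w : Equiv.Perm (Fin m)) (x : BraidGroup m) : Prop :=
  ∃ L : List (Fin (m - 1)), L.length = k ∧ (L.map adjSwap).prod = w ∧ (L.map σ).prod = x

theorem isWord_one : IsWord 0 (1 : Equiv.Perm (Fin m)) 1 := ⟨[], rfl, rfl, rfl⟩

theorem isWord_sigma (i : Fin (m - 1)) : IsWord 1 (adjSwap i) (σ i) := ⟨[i], rfl, by simp, by simp⟩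

theorem IsWord.mul {k l : ℕ} {u v : Equiv.Perm (Fin m)} {x y : BraidGroup m} (hx : IsWord k u x)
    (hy : IsWord l v y) : IsWord (k + l) (u * v) (x * y) := by
  obtain ⟨L, rfl, rfl, rfl⟩ := hx
  obtain ⟨L', rfl, rfl, rfl⟩ := hy
  exact ⟨L ++ L', by simp, by simp, by simp⟩

theorem IsWord.pow {k : ℕ} {u : Equiv.Perm (Fin m)} {x : BraidGroup m} (hx : IsWord k u x)
    (j : ℕ) : IsWord (j * k) (u ^ j) (x ^ j) := by
  induction j with
  | zero => simpa using isWord_one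
  | succ j ih =>
    rw [pow_succ, pow_succ, Nat.succ_mul]
    exact ih.mul hx

theorem card_filter_lt (m : ℕ) :
    (Finset.univ.filter fun p : Fin m × Fin m => p.1 < p.2).card * 2 = m * (m - 1) := by
  have h : (Finset.univ.filter fun p : Fin m × Fin m => p.1 < p.2).card =
      ∑ b : Fin m, b.val := by
    rw [Finset.card_filter, Fintype.sum_prod_type_right]
    refine Finset.sum_congr rfl fun b _ => ?_
    rw [← Finset.card_filter]
    have : (Finset.univ.filter fun a : Fin m => a < b) = Finset.Iio b := by ext; simp
    rw [this, Fin.card_Iio]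
  rw [h, Fin.sum_univ_eq_sum_range (fun i => i), Finset.sum_range_id_mul_two]

theorem IsWord.eq_permBraid_rev {k : ℕ} {x : BraidGroup m} (hx : IsWord k Fin.revPerm x)
    (hk : k * 2 = m * (m - 1)) : x = permBraid m Fin.revPerm := by
  obtain ⟨L, h1, h2, h3⟩ := hx
  refine (isDance_iff _ _).1 ⟨L, h3, h2, ?_⟩
  have h4 := card_filter_lt m
  rw [inversions_rev]
  omega

end Words

theorem sigmaRun_isWord (m k : ℕ) (hk : k ≤ m - 1) : ∃ w : Equiv.Perm (Fin m),
    IsWord k w (sigmaRun m k hk) ∧ ∀ x : Fin m, (w x).val =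
      if x.val < k then x.val + 1 else if x.val = k then 0 else x.val := by
  induction k with
  | zero =>
    refine ⟨1, by simpa [sigmaRun] using isWord_one, fun x => ?_⟩
    simp only [Equiv.Perm.one_apply]
    grind
  | succ k ih =>
    obtain ⟨w, h1, h2⟩ := ih (by omega)
    refine ⟨w * adjSwap ⟨k, by omega⟩, ?_, fun x => ?_⟩
    · have : sigmaRun m (k + 1) hk = sigmaRun m k (by omega) * σ ⟨k, by omega⟩ := by
        simp only [sigmaRun, List.ofFn_succ_last, List.prod_append]
        simp
        rfl
      rw [this]
      exact h1.mul (isWord_sigma _)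
    · rw [Equiv.Perm.mul_apply, h2, adjSwap_val]
      simp only
      grind

theorem sigmaRun_congr (m : ℕ) {k k' : ℕ} (h : k = k') (hk : k ≤ m - 1) (hk' : k' ≤ m - 1) :
    sigmaRun m k hk = sigmaRun m k' hk' := by
  subst h
  rfl

theorem DeltaA_eq (m : ℕ) : DeltaA m = permBraid m Fin.revPerm := by
  -- The last `j` runs reverse the positions `0, …, j` with as many letters as there are pairs among
  -- them. A word for the full reversal of that length is reduced.
  have key : ∀ j k : ℕ, ∀ hjk : j + k = m - 1, ∃ (l : ℕ) (w : Equiv.Perm (Fin m)),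
      l * 2 = (j + 1) * j ∧
      IsWord l w (List.ofFn fun i : Fin j => sigmaRun m (j - i.val) (by omega)).prod ∧
      ∀ x : Fin m, (w x).val = if x.val ≤ j then j - x.val else x.val := by
    intro j
    induction j with
    | zero =>
      intro k _
      refine ⟨0, 1, rfl, by simpa using isWord_one, fun x => ?_⟩
      simp only [Equiv.Perm.one_apply]
      grind
    | succ j ih =>
      intro k hjk
      obtain ⟨l, w, h1, h2, h3⟩ := ih (k + 1) (by omega)
      obtain ⟨w', h4, h5⟩ := sigmaRun_isWord m (j + 1) (by omega)
      refine ⟨(j + 1) + l, w' * w, by rw [add_mul, h1]; ring, ?_, fun x => ?_⟩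
      · rw [List.ofFn_succ, List.prod_cons]
        have e : (List.ofFn fun i : Fin j => sigmaRun m (j + 1 - i.succ.val) (by omega)) =
            List.ofFn fun i : Fin j => sigmaRun m (j - i.val) (by omega) :=
          congrArg List.ofFn (funext fun i => sigmaRun_congr m (by simp) _ _)
        rw [e]
        exact h4.mul h2
      · rw [Equiv.Perm.mul_apply, h5, h3]
        grind
  obtain ⟨l, w, h1, h2, h3⟩ := key (m - 1) 0 rfl
  have hw : w = Fin.revPerm := by
    ext x
    rw [h3, Fin.revPerm_apply, Fin.val_rev]
    grind
  subst hw
  refine h2.eq_permBraid_rev ?_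
  rw [h1]
  cases m with
  | zero => rfl
  | succ m => simp

theorem Psi_DeltaB_eq {n : ℕ} (hn : 1 ≤ n) :
    Psi n (DeltaB n) = permBraid (2 * n) Fin.revPerm := by
  -- The first generator contributes one letter and each later one two, whence `2 * k - 1`. The
  -- permutation is described on the right half only; symmetry determines it on the left.
  have key : ∀ k (hk : k ≤ n), ∃ (l : ℕ) (w : Equiv.Perm (Fin (2 * n))),
      l = 2 * k - 1 ∧ IsWord l w
        (Psi n (List.ofFn fun i : Fin k => s (n := n) (Fin.castLE hk i)).prod) ∧
      w ∈ symPerm n ∧ ∀ x : Fin (2 * n), n ≤ x.val → (w x).val =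
        if x.val + 1 < n + k then x.val + 1 else if x.val + 1 = n + k then n - 1 else x.val := by
    intro k hk
    induction k with
    | zero =>
      refine ⟨0, 1, rfl, by simpa using isWord_one, one_mem _, fun x hx => ?_⟩
      simp only [Equiv.Perm.one_apply]
      grind
    | succ k ih =>
      obtain ⟨l, w, h1, h2, h3, h4⟩ := ih (by omega)
      have hs : IsWord (if k = 0 then 1 else 2) (symSwap' ⟨k, by omega⟩)
          (Psi n (s (n := n) ⟨k, by omega⟩)) := by
        rw [Psi_s, psiGen, symSwap']
        simp only
        split_ifs with h
        · subst h
          exact isWord_sigma _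
        · exact (isWord_sigma _).mul (isWord_sigma _)
      refine ⟨l + if k = 0 then 1 else 2, w * symSwap' ⟨k, by omega⟩, by split_ifs <;> omega, ?_,
        mul_mem h3 (symSwap'_mem _), fun x hx => ?_⟩
      · have : (List.ofFn fun i : Fin (k + 1) => s (n := n) (Fin.castLE hk i)).prod =
            (List.ofFn fun i : Fin k => s (n := n) (Fin.castLE (by omega) i)).prod *
              s ⟨k, by omega⟩ := by
          rw [List.ofFn_succ_last, List.prod_append]
          simp
          rfl
        rw [this, map_mul]
        exact h2.mul hs
      · rw [Equiv.Perm.mul_apply]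
        have hv := symSwap'_val (n := n) ⟨k, by omega⟩ x
        simp only at hv
        have hklt : k < n := hk
        by_cases hk0 : k = 0 ∧ x.val = n
        · obtain ⟨rfl, hx0⟩ := hk0
          have e : symSwap' (n := n) ⟨0, by omega⟩ x = x.rev := by
            ext
            rw [hv, Fin.val_rev]
            grind
          rw [e, h3, Fin.val_rev, h4 x hx]
          grind
        · generalize symSwap' (n := n) ⟨k, by omega⟩ x = y at hv ⊢
          have hy : (1 ≤ k ∧ x.val + 1 = n + k ∧ y.val = n + k) ∨
              (1 ≤ k ∧ x.val = n + k ∧ y.val + 1 = n + k) ∨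
              (x.val + 1 ≠ n + k ∧ x.val ≠ n + k ∧ y.val = x.val) := by
            split_ifs at hv <;> omega
          rw [h4 y (by omega)]
          split_ifs <;> omega
  obtain ⟨l, w, h1, h2, h3, h4⟩ := key n le_rfl
  have h5 := h2.pow n
  -- The permutation `w` moves `n, …, 2 * n - 1` upwards, then jumps to `n - 1` and runs down to
  -- `0`. After `n` steps every point has reached its mirror image.
  have hpow : ∀ j, j ≤ n → ∀ x : Fin (2 * n), n ≤ x.val → ((w ^ j) x).val =
      if x.val + j < 2 * n then x.val + j else 3 * n - 1 - x.val - j := by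
    intro j
    induction j with
    | zero =>
      intro _ x hx
      have := x.isLt
      simp only [pow_zero, Equiv.Perm.one_apply]
      grind
    | succ j ih =>
      intro hj x hx
      have h6 := ih (by omega) x hx
      have hxl := x.isLt
      rw [pow_succ', Equiv.Perm.mul_apply]
      generalize (w ^ j) x = y at h6 ⊢
      by_cases h7 : x.val + j < 2 * n
      · rw [if_pos h7] at h6
        rw [h4 y (by omega)]
        split_ifs <;> omega
      · rw [if_neg h7] at h6
        have h8 := h4 y.rev (by rw [Fin.val_rev]; omega)
        rw [h3, Fin.val_rev, Fin.val_rev] at h8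
        have := (w y).isLt
        split_ifs at h8 ⊢ <;> omega
  have hw : w ^ n = Fin.revPerm := by
    have hsym := pow_mem h3 n
    ext x
    rw [Fin.revPerm_apply, Fin.val_rev]
    by_cases hx : n ≤ x.val
    · have := x.isLt
      rw [hpow n le_rfl x hx]
      split_ifs <;> omega
    · have h6 := hpow n le_rfl x.rev (by rw [Fin.val_rev]; omega)
      rw [hsym, Fin.val_rev, Fin.val_rev] at h6
      have := ((w ^ n) x).isLt
      have := x.isLt
      split_ifs at h6 <;> omega
  rw [hw, ← map_pow] at h5
  refine IsWord.eq_permBraid_rev (k := n * l) ?_ ?_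
  · exact h5
  · rw [h1]
    ring

theorem Psi_DeltaB {n : ℕ} (hn : 1 ≤ n) : Psi n (DeltaB n) = DeltaA (2 * n) := by
  rw [Psi_DeltaB_eq hn, DeltaA_eq]

theorem Psi_isCentralizerEmbedding_Delta {n : ℕ} (hn : 1 ≤ n) :
    IsCentralizerEmbedding (Psi n) (DeltaA (2 * n)) (DeltaB n) 1 where
  injective := Psi_injective hn
  map_top := Psi_DeltaB hn
  exists_iff := by
    rw [DeltaA_eq]
    exact (Psi_isCentralizerEmbedding hn).exists_iff

/-! ### Band generators -/

section Band

variable {G : Type} [Group G]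

/-- The conjugate of `g a` by `g (a + 1) ⋯ g (b - 1)`, for `a < b`. -/
def bandGen (g : ℕ → G) (a : ℕ) : ℕ → G
  | 0 => g a
  | b + 1 => if b ≤ a then g a else (g b)⁻¹ * bandGen g a b * g b

theorem bandGen_succ_self (g : ℕ → G) (a : ℕ) : bandGen g a (a + 1) = g a := by
  rw [bandGen, if_pos le_rfl]

theorem bandGen_succ (g : ℕ → G) {a b : ℕ} (h : a < b) :
    bandGen g a (b + 1) = (g b)⁻¹ * bandGen g a b * g b := by
  rw [bandGen, if_neg (by omega)]

/-- The elements `g 0, …, g (M - 1)` satisfy the braid relations. -/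
structure IsBraidSeq (g : ℕ → G) (M : ℕ) : Prop where
  comm : ∀ i j, i + 1 < j → j < M → Commute (g i) (g j)
  braid : ∀ i, i + 1 < M → g i * g (i + 1) * g i = g (i + 1) * g i * g (i + 1)

theorem commute_conj {x y z : G} (hz : Commute z y) (hx : Commute z x) :
    Commute z (y⁻¹ * x * y) := (hz.inv_right.mul_right hx).mul_right hz

theorem braid_conj {x y : G} (z : G) (h : x * y * x = y * x * y) :
    (z⁻¹ * x * z) * (z⁻¹ * y * z) * (z⁻¹ * x * z) =
      (z⁻¹ * y * z) * (z⁻¹ * x * z) * (z⁻¹ * y * z) := by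
  have := congrArg (fun w => z⁻¹ * w * z) h
  simp only [mul_assoc] at this ⊢
  simpa using this

namespace IsBraidSeq

variable {g : ℕ → G} {M : ℕ} (h : IsBraidSeq g M)
include h

theorem inv : IsBraidSeq (fun i => (g i)⁻¹) M where
  comm i j hij hj := (h.comm i j hij hj).inv_inv
  braid i hi := by
    have := congrArg (·⁻¹) (h.braid i hi)
    simpa [mul_assoc] using this

theorem commute_outer {a b j : ℕ} (hab : a < b) (hb : b ≤ M) (hj : j < M)
    (hout : j + 1 < a ∨ b < j) : Commute (g j) (bandGen g a b) := by
  induction b, hab using Nat.le_induction with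
  | base =>
    rw [bandGen_succ_self]
    rcases hout with h1 | h1
    · exact h.comm _ _ h1 (by omega)
    · exact (h.comm _ _ h1 hj).symm
  | succ b hab ih =>
    have hab : a < b := hab
    rw [bandGen_succ g hab]
    refine commute_conj ?_ (ih (by omega) (by omega))
    rcases hout with h1 | h1
    · exact h.comm _ _ (by omega) (by omega)
    · exact (h.comm _ _ (by omega) hj).symm

/-- For `b = j + 2` the band is the conjugate of `bandGen g a j` by `g j * g (j + 1)`. The same
conjugation turns `g (j + 1)`, which commutes with `bandGen g a j`, into `g j`. -/
theorem commute_inner {a b j : ℕ} (hb : b ≤ M) (haj : a < j) (hjb : j + 1 < b) :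
    Commute (g j) (bandGen g a b) := by
  induction b, hjb using Nat.le_induction with
  | base =>
    rw [bandGen_succ g (by omega), bandGen_succ g haj]
    have h1 := h.braid j (by omega)
    have h2 := h.commute_outer haj (by omega) (j := j + 1) (by omega) (by omega)
    set x := g j
    set y := g (j + 1)
    set X := bandGen g a j
    have h3 : x * (x * y)⁻¹ = (x * y)⁻¹ * y := by
      rw [mul_inv_eq_iff_eq_mul, mul_assoc, eq_inv_mul_iff_mul_eq, h1, mul_assoc]
    rw [commute_iff_eq]
    calc x * (y⁻¹ * (x⁻¹ * X * x) * y) = x * (x * y)⁻¹ * (X * (x * y)) := by group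
      _ = (x * y)⁻¹ * (y * X) * (x * y) := by rw [h3]; group
      _ = (x * y)⁻¹ * X * (y * x * y) := by rw [h2.eq]; group
      _ = y⁻¹ * (x⁻¹ * X * x) * y * x := by rw [← h1]; group
  | succ b hjb ih =>
    have hjb' : j + 1 < b := hjb
    rw [bandGen_succ g (by omega)]
    exact commute_conj (h.comm _ _ hjb' (by omega)) (ih (by omega))

theorem braid_right {a b : ℕ} (hab : a < b) (hb : b < M) :
    bandGen g a b * g b * bandGen g a b = g b * bandGen g a b * g b := by
  induction b, hab using Nat.le_induction with
  | base =>
    rw [bandGen_succ_self]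
    exact h.braid a hb
  | succ b hab ih =>
    have hab : a < b := hab
    have h1 := ih (by omega)
    have h2 := h.commute_outer hab (by omega) (j := b + 1) hb (by omega)
    have h3 := h.braid b hb
    rw [bandGen_succ g hab]
    set X := bandGen g a b
    have h4 : (g b)⁻¹ * X * g b = X⁻¹⁻¹ * g b * X⁻¹ := by
      rw [inv_inv, eq_mul_inv_iff_mul_eq, mul_assoc, mul_assoc, inv_mul_eq_iff_eq_mul,
        ← mul_assoc, ← mul_assoc, h1]
    have h5 : g (b + 1) = X⁻¹⁻¹ * g (b + 1) * X⁻¹ := by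
      rw [inv_inv, ← h2.eq, mul_inv_cancel_right]
    have h6 := braid_conj X⁻¹ h3
    rwa [← h4, ← h5] at h6

theorem braid_left {a b : ℕ} (hab : a + 1 < b) (hb : b ≤ M) :
    bandGen g (a + 1) b * g a * bandGen g (a + 1) b =
      g a * bandGen g (a + 1) b * g a := by
  induction b, hab using Nat.le_induction with
  | base =>
    rw [bandGen_succ_self]
    exact (h.braid a (by omega)).symm
  | succ b hab ih =>
    have hab : a + 1 < b := hab
    have h2 := h.comm a b hab (by omega)
    have h5 : g a = (g b)⁻¹ * g a * g b := by rw [mul_assoc, h2.eq, inv_mul_cancel_left]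
    rw [bandGen_succ g hab]
    have h6 := braid_conj (g b) (ih (by omega))
    rwa [← h5] at h6

theorem triangle_left {a b c : ℕ} (hab : a < b) (hbc : b < c) (hc : c ≤ M) :
    bandGen g a b * bandGen g b c = bandGen g b c * bandGen g a c := by
  induction c, hbc using Nat.le_induction with
  | base =>
    rw [bandGen_succ_self, bandGen_succ g hab]
    group
  | succ c hbc ih =>
    have hbc : b < c := hbc
    have h1 := ih (by omega)
    have h2 := h.commute_outer hab (by omega) (j := c) (by omega) (by omega)
    rw [bandGen_succ g hbc, bandGen_succ g (by omega)]
    have h3 : bandGen g a b = (g c)⁻¹ * bandGen g a b * g c := by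
      rw [mul_assoc, ← h2.eq, inv_mul_cancel_left]
    rw [h3]
    simp only [mul_assoc, mul_inv_cancel_left]
    rw [← mul_assoc (bandGen g a b), h1, mul_assoc]

theorem triangle_right {a b c : ℕ} (hab : a < b) (hbc : b < c) (hc : c ≤ M) :
    bandGen g b c * bandGen g a c = bandGen g a c * bandGen g a b := by
  induction c, hbc using Nat.le_induction with
  | base =>
    rw [bandGen_succ_self, bandGen_succ g hab]
    have h1 := h.braid_right hab (by omega)
    rw [mul_assoc (g b)⁻¹, mul_inv_cancel_left, mul_assoc (g b)⁻¹, h1]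
    group
  | succ c hbc ih =>
    have hbc : b < c := hbc
    have h1 := ih (by omega)
    have h2 := h.commute_outer hab (by omega) (j := c) (by omega) (by omega)
    rw [bandGen_succ g hbc, bandGen_succ g (by omega)]
    have h3 : bandGen g a b = (g c)⁻¹ * bandGen g a b * g c := by
      rw [mul_assoc, ← h2.eq, inv_mul_cancel_left]
    rw [h3]
    simp only [mul_assoc, mul_inv_cancel_left]
    rw [← mul_assoc (bandGen g b c), h1, mul_assoc]

omit h in
theorem commute_bandGen {z : G} {a b : ℕ} (hab : a < b)
    (hz : ∀ j, a ≤ j → j < b → Commute z (g j)) : Commute z (bandGen g a b) := by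
  induction b, hab using Nat.le_induction with
  | base =>
    rw [bandGen_succ_self]
    exact hz a le_rfl (by omega)
  | succ b hab ih =>
    have hab : a < b := hab
    rw [bandGen_succ g hab]
    exact commute_conj (hz b (by omega) (by omega)) (ih fun j h1 h2 => hz j h1 (by omega))

theorem commute_disjoint {a b c d : ℕ} (hab : a < b) (hbc : b < c) (hcd : c < d) (hd : d ≤ M) :
    Commute (bandGen g a b) (bandGen g c d) :=
  commute_bandGen hcd fun j h1 h2 =>
    (h.commute_outer hab (by omega) (by omega) (by omega)).symm

theorem commute_nested {a b c d : ℕ} (hac : a < c) (hcd : c < d) (hdb : d < b) (hb : b ≤ M) :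
    Commute (bandGen g a b) (bandGen g c d) :=
  commute_bandGen hcd fun j h1 h2 => (h.commute_inner hb (by omega) (by omega)).symm

end IsBraidSeq
end Band

/-! ### Half twists along chords -/

section Chords

variable (n : ℕ)

theorem sigmaNat_isBraidSeq : IsBraidSeq (sigmaNat n) (2 * n - 1) where
  comm i j hij hj := by
    rw [sigmaNat, sigmaNat, dif_pos (by omega), dif_pos hj]
    exact sigma_comm _ _ hij
  braid i hi := by
    rw [sigmaNat, sigmaNat, dif_pos (by omega), dif_pos hi]
    exact sigma_braid _ _ rfl

/-- The half twist along the side of the circle from the puncture `c` to `c + 1`. -/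
def sideTwist (c : ℕ) : BraidGroup (2 * n) :=
  if c + 1 < n then sigmaNat n c else if c + 1 = n then band n c c else sigmaNat n (3 * n - 2 - c)

theorem band_middle (k : ℕ) (hn : 1 ≤ n) :
    band n (n - 1) k = (bandGen (fun i => (sigmaNat n i)⁻¹) (n - 1) (n + k))⁻¹ := by
  induction k with
  | zero =>
    obtain ⟨m, rfl⟩ : ∃ m, n = m + 1 := ⟨n - 1, by omega⟩
    simp only [Nat.add_sub_cancel, Nat.add_zero]
    rw [bandGen_succ_self, inv_inv, band]
  | succ k ih =>
    rw [← add_assoc, bandGen_succ _ (by omega), band, if_neg (by omega), ih,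
      show n - 1 + 1 + k = n + k by omega]
    group

/-- Only the side from `p_1` to `q_n` is not a generator `σ`. By `band_middle` it is the inverse of
a band in the inverse generators, which again satisfy the braid relations, so the general facts on
bands apply to it. -/
theorem sideTwist_isBraidSeq : IsBraidSeq (sideTwist n) (2 * n - 1) := by
  have hs := sigmaNat_isBraidSeq n
  have hi := hs.inv
  have mid : ∀ c, c + 1 = n → sideTwist n c =
      (bandGen (fun i => (sigmaNat n i)⁻¹) (n - 1) (2 * n - 1))⁻¹ := by
    intro c hc
    rw [sideTwist, if_neg (by omega), if_pos hc]
    have := band_middle n (n - 1) (by omega)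
    rw [show n + (n - 1) = 2 * n - 1 by omega] at this
    rw [← this, show c = n - 1 by omega]
  have lo : ∀ c, c + 1 < n → sideTwist n c = sigmaNat n c := fun c hc => by
    rw [sideTwist, if_pos hc]
  have hi' : ∀ c, n ≤ c → sideTwist n c = sigmaNat n (3 * n - 2 - c) := fun c hc => by
    rw [sideTwist, if_neg (by omega), if_neg (by omega)]
  constructor
  · intro i j hij hj
    rcases Nat.lt_trichotomy (i + 1) n with h1 | h1 | h1
    · rw [lo i h1]
      rcases Nat.lt_trichotomy (j + 1) n with h2 | h2 | h2
      · rw [lo j h2]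
        exact hs.comm _ _ hij hj
      · rw [mid j h2]
        have := hi.commute_outer (a := n - 1) (b := 2 * n - 1) (j := i) (by omega) le_rfl
          (by omega) (by omega)
        exact Commute.inv_left_iff.1 this.inv_right
      · rw [hi' j (by omega)]
        exact hs.comm _ _ (by omega) (by omega)
    · rw [mid i h1, hi' j (by omega)]
      have := hi.commute_inner (a := n - 1) (b := 2 * n - 1) (j := 3 * n - 2 - j) le_rfl
        (by omega) (by omega)
      exact (Commute.inv_left_iff.1 this.inv_right).symm
    · rw [hi' i (by omega), hi' j (by omega)]
      exact (hs.comm _ _ (by omega) (by omega)).symm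
  · intro i hi1
    have inv_braid : ∀ x y : BraidGroup (2 * n), x * y⁻¹ * x = y⁻¹ * x * y⁻¹ →
        x⁻¹ * y * x⁻¹ = y * x⁻¹ * y := by
      intro x y h
      have := congrArg (·⁻¹) h
      simpa [mul_assoc] using this
    rcases Nat.lt_trichotomy (i + 1) n with h1 | h1 | h1
    · rw [lo i h1]
      by_cases h2 : i + 2 = n
      · rw [mid (i + 1) (by omega)]
        have := hi.braid_left (a := i) (b := 2 * n - 1) (by omega) le_rfl
        rw [show n - 1 = i + 1 by omega]
        exact (inv_braid _ _ this).symm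
      · rw [lo (i + 1) (by omega)]
        exact hs.braid _ (by omega)
    · have hsplit := bandGen_succ (fun i => (sigmaNat n i)⁻¹) (a := n - 1) (b := 2 * n - 2)
        (by omega)
      rw [show 2 * n - 2 + 1 = 2 * n - 1 by omega] at hsplit
      rw [mid i h1, hi' (i + 1) (by omega), show 3 * n - 2 - (i + 1) = 2 * n - 2 by omega, hsplit]
      have := hi.braid_right (a := n - 1) (b := 2 * n - 2) (by omega) (by omega)
      refine inv_braid _ _ ?_
      have h2 := braid_conj (sigmaNat n (2 * n - 2))⁻¹ this
      have h3 : (sigmaNat n (2 * n - 2))⁻¹⁻¹ * (sigmaNat n (2 * n - 2))⁻¹ *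
          (sigmaNat n (2 * n - 2))⁻¹ = (sigmaNat n (2 * n - 2))⁻¹ := by group
      simp only [h3] at h2
      exact h2
    · rw [hi' i (by omega), hi' (i + 1) (by omega)]
      have := hs.braid (3 * n - 2 - (i + 1)) (by omega)
      rw [show 3 * n - 2 - (i + 1) + 1 = 3 * n - 2 - i by omega] at this
      exact this.symm

theorem band_eq_of_left {c d : ℕ} (hcd : c < d) (hd : d < n) :
    band n c (d - c - 1) = bandGen (sideTwist n) c d := by
  induction d, hcd using Nat.le_induction with
  | base =>
    rw [bandGen_succ_self, sideTwist, if_pos hd, show c + 1 - c - 1 = 0 by omega, band]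
  | succ d hcd ih =>
    have hcd : c < d := hcd
    rw [bandGen_succ _ hcd, ← ih (by omega), show d + 1 - c - 1 = (d - c - 1) + 1 by omega, band,
      show c + 1 + (d - c - 1) = d by omega, if_pos (by omega), sideTwist, if_pos hd]

/-- The chord across is the third side of the triangle with vertices at the line positions `c`, `n -
1` and `n + k`; it arises by twisting the first side along the second. The later conjugators pass
through because they commute with the twist from `c` to `n - 1`. -/
theorem band_across {c : ℕ} (hc : c + 1 < n) (k : ℕ) (hk : k < n) :
    band n c (n - 1 - c + k) =
      (band n (n - 1) k)⁻¹ * band n c (n - 2 - c) * band n (n - 1) k := by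
  induction k with
  | zero =>
    have h1 : band n c (n - 2 - c + 1) =
        if c + 1 + (n - 2 - c) < n then (sigmaNat n (c + 1 + (n - 2 - c)))⁻¹ *
          band n c (n - 2 - c) * sigmaNat n (c + 1 + (n - 2 - c))
        else sigmaNat n (c + 1 + (n - 2 - c)) * band n c (n - 2 - c) *
          (sigmaNat n (c + 1 + (n - 2 - c)))⁻¹ := rfl
    rw [if_pos (by omega), show c + 1 + (n - 2 - c) = n - 1 by omega] at h1
    rw [show n - 1 - c + 0 = (n - 2 - c) + 1 by omega, h1]
    rfl
  | succ k ih =>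
    have hcomm : Commute (sigmaNat n (n + k)) (band n c (n - 2 - c)) := by
      have h1 := band_eq_of_left n (c := c) (d := n - 1) (by omega) (by omega)
      rw [show n - 1 - c - 1 = n - 2 - c by omega] at h1
      have h2 := (sideTwist_isBraidSeq n).commute_outer (a := c) (b := n - 1)
        (j := 3 * n - 2 - (n + k)) (by omega) (by omega) (by omega) (by omega)
      rw [sideTwist, if_neg (by omega), if_neg (by omega),
        show 3 * n - 2 - (3 * n - 2 - (n + k)) = n + k by omega] at h2
      rw [h1]
      exact h2
    rw [← add_assoc, band, if_neg (by omega), show c + 1 + (n - 1 - c + k) = n + k by omega,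
      ih (by omega), band, if_neg (by omega), show n - 1 + 1 + k = n + k by omega]
    set x := sigmaNat n (n + k)
    set U := band n (n - 1) k
    set Z := band n c (n - 2 - c)
    calc x * (U⁻¹ * Z * U) * x⁻¹ = x * U⁻¹ * (x⁻¹ * (x * Z)) * U * x⁻¹ := by group
      _ = (x * U * x⁻¹)⁻¹ * Z * (x * U * x⁻¹) := by rw [hcomm.eq]; group

/-- Here the left end of the arc is moved instead of the right one. On the right half the circle
order reverses the line order, so this is the recursion that `bandGen` requires. -/
theorem band_shift {i k : ℕ} (hi : n ≤ i) (hk : i + 1 + k < 2 * n - 1) :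
    band n i (k + 1) = (sigmaNat n i)⁻¹ * band n (i + 1) k * sigmaNat n i := by
  induction k with
  | zero =>
    rw [band, band, band, if_neg (by omega)]
    have := (sigmaNat_isBraidSeq n).braid i (by omega)
    rw [add_zero, mul_inv_eq_iff_eq_mul]
    simp only [mul_assoc] at this ⊢
    rw [eq_inv_mul_iff_mul_eq, this]
  | succ k ih =>
    rw [band, if_neg (by omega), ih (by omega), band, if_neg (by omega),
      show i + 1 + 1 + k = i + 1 + (k + 1) by omega]
    have h1 := (sigmaNat_isBraidSeq n).comm i (i + 1 + (k + 1)) (by omega) (by omega)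
    set x := sigmaNat n i
    set y := sigmaNat n (i + 1 + (k + 1))
    calc y * (x⁻¹ * band n (i + 1) k * x) * y⁻¹ = (y * x⁻¹) * band n (i + 1) k * (x * y⁻¹) := by
          group
      _ = x⁻¹ * (y * band n (i + 1) k * y⁻¹) * x := by
          rw [h1.symm.inv_right.eq, h1.inv_right.eq]; group

theorem band_eq_of_across {c d : ℕ} (hc : c < n) (hle : n ≤ d) (hd : d < 2 * n) :
    band n c (3 * n - 1 - d - c - 1) = bandGen (sideTwist n) c d := by
  induction d, hle using Nat.le_induction with
  | base =>
    by_cases h3 : c + 1 = n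
    · have h4 := bandGen_succ_self (sideTwist n) c
      rw [h3, sideTwist, if_neg (by omega), if_pos h3] at h4
      rw [h4]
      congr 1
      omega
    · have h4 := bandGen_succ (sideTwist n) (a := c) (b := n - 1) (by omega)
      rw [show n - 1 + 1 = n by omega,
        ← band_eq_of_left n (c := c) (d := n - 1) (by omega) (by omega), sideTwist,
        if_neg (by omega), if_pos (by omega)] at h4
      have := band_across n (c := c) (by omega) (n - 1) (by omega)
      rw [show n - 1 - c + (n - 1) = 3 * n - 1 - n - c - 1 by omega,
        show n - 2 - c = n - 1 - c - 1 by omega] at this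
      rw [this, h4]
  | succ d hle ih =>
    rw [bandGen_succ _ (by omega), ← ih (by omega), sideTwist, if_neg (by omega),
      if_neg (by omega), show 3 * n - 1 - d - c - 1 = (3 * n - 1 - (d + 1) - c - 1) + 1 by omega]
    conv_rhs => rw [band, if_neg (by omega),
      show c + 1 + (3 * n - 1 - (d + 1) - c - 1) = 3 * n - 2 - d by omega]
    group

theorem band_eq_of_right {c d : ℕ} (hc : n ≤ c) (hcd : c < d) (hd : d < 2 * n) :
    band n (3 * n - 1 - d) (d - c - 1) = bandGen (sideTwist n) c d := by
  induction d, hcd using Nat.le_induction with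
  | base =>
    rw [bandGen_succ_self, sideTwist, if_neg (by omega), if_neg (by omega),
      show c + 1 - c - 1 = 0 by omega, band]
    congr 1
    omega
  | succ d hcd ih =>
    have hcd : c < d := hcd
    rw [bandGen_succ _ hcd, ← ih (by omega), sideTwist, if_neg (by omega), if_neg (by omega),
      show d + 1 - c - 1 = (d - c - 1) + 1 by omega,
      show 3 * n - 1 - (d + 1) = 3 * n - 2 - d by omega,
      band_shift n (by omega) (by omega), show 3 * n - 2 - d + 1 = 3 * n - 1 - d by omega]

/-- All relations between chord twists thus become formal consequences of the braid relations
between the side twists. -/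
theorem chordTwist_eq (c d : Fin (2 * n)) (hcd : c < d) :
    chordTwist n c d = bandGen (sideTwist n) c.val d.val := by
  have hcd' : c.val < d.val := hcd
  have hd := d.isLt
  rw [chordTwist]
  simp only [linePos]
  by_cases h1 : d.val < n
  · rw [if_pos (by omega), if_pos h1, min_eq_left (by omega), max_eq_right (by omega),
      band_eq_of_left n hcd' h1]
  rw [if_neg h1]
  by_cases h2 : c.val < n
  · rw [if_pos h2, min_eq_left (by omega), max_eq_right (by omega),
      band_eq_of_across n h2 (by omega) hd]
  · rw [if_neg h2, min_eq_right (by omega), max_eq_left (by omega),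
      ← band_eq_of_right n (by omega) hcd' hd]
    congr 1
    omega

end Chords
/-! ### The absolute length of permutations -/

section Fix

variable {m : ℕ}

/-- The functions that are constant on the cycles of a permutation. -/
def fixSpace (u : Equiv.Perm (Fin m)) : Submodule ℚ (Fin m → ℚ) where
  carrier := {f | ∀ x, f (u x) = f x}
  add_mem' hf hg x := by simp [hf x, hg x]
  zero_mem' _ := rfl
  smul_mem' c f hf x := by simp [hf x]

theorem mem_fixSpace {u : Equiv.Perm (Fin m)} {f : Fin m → ℚ} :
    f ∈ fixSpace u ↔ ∀ x, f (u x) = f x := Iff.rfl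

/-- The length of a permutation with respect to all transpositions. -/
noncomputable def absLen (u : Equiv.Perm (Fin m)) : ℕ := m - Module.finrank ℚ (fixSpace u)

theorem absLen_add_finrank (u : Equiv.Perm (Fin m)) :
    absLen u + Module.finrank ℚ (fixSpace u) = m := by
  have h := Submodule.finrank_le (fixSpace u)
  rw [Module.finrank_fin_fun] at h
  rw [absLen]
  omega

theorem inf_le_fixSpace_mul (u v : Equiv.Perm (Fin m)) :
    fixSpace u ⊓ fixSpace v ≤ fixSpace (u * v) := by
  rintro f ⟨h1, h2⟩ x
  rw [Equiv.Perm.mul_apply, h1, h2]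

theorem finrank_le_inf (u v : Equiv.Perm (Fin m)) :
    Module.finrank ℚ (fixSpace u) + Module.finrank ℚ (fixSpace v) ≤
      m + Module.finrank ℚ ↥(fixSpace u ⊓ fixSpace v) := by
  rw [← Submodule.finrank_sup_add_finrank_inf_eq]
  have h := Submodule.finrank_le (fixSpace u ⊔ fixSpace v)
  rw [Module.finrank_fin_fun] at h
  omega

theorem absLen_mul_le (u v : Equiv.Perm (Fin m)) : absLen (u * v) ≤ absLen u + absLen v := by
  have h1 := finrank_le_inf u v
  have h2 := Submodule.finrank_mono (inf_le_fixSpace_mul u v)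
  have h3 := absLen_add_finrank u
  have h4 := absLen_add_finrank v
  have h5 := absLen_add_finrank (u * v)
  omega

theorem absLen_one : absLen (1 : Equiv.Perm (Fin m)) = 0 := by
  have h : fixSpace (1 : Equiv.Perm (Fin m)) = ⊤ := by
    rw [eq_top_iff]
    intro f _ x
    rfl
  rw [absLen, h, finrank_top, Module.finrank_fin_fun, Nat.sub_self]

theorem eq_one_of_absLen (u : Equiv.Perm (Fin m)) (h : absLen u = 0) : u = 1 := by
  have h1 := absLen_add_finrank u
  have h2 : fixSpace u = ⊤ := by
    apply Submodule.eq_top_of_finrank_eq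
    rw [Module.finrank_fin_fun]
    omega
  ext x
  have h3 : (fun y : Fin m => (y.val : ℚ)) ∈ fixSpace u := by rw [h2]; trivial
  have h4 := h3 x
  simpa using h4

theorem absLen_conj_le (c u : Equiv.Perm (Fin m)) : absLen (c⁻¹ * u * c) ≤ absLen u := by
  have h1 : (fixSpace u).map (LinearEquiv.funCongrLeft ℚ ℚ c).toLinearMap ≤
      fixSpace (c⁻¹ * u * c) := by
    rintro _ ⟨f, hf, rfl⟩ x
    have := hf (c x)
    simpa using this
  have h2 := Submodule.finrank_mono h1
  have h3 := LinearEquiv.finrank_map_eq (LinearEquiv.funCongrLeft ℚ ℚ c) (fixSpace u)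
  have h4 := absLen_add_finrank u
  have h5 := absLen_add_finrank (c⁻¹ * u * c)
  have h6 : Module.finrank ℚ (fixSpace u) ≤ Module.finrank ℚ (fixSpace (c⁻¹ * u * c)) :=
    h3.symm.le.trans h2
  omega

theorem absLen_conj (c u : Equiv.Perm (Fin m)) : absLen (c⁻¹ * u * c) = absLen u := by
  refine le_antisymm (absLen_conj_le c u) ?_
  have := absLen_conj_le c⁻¹ (c⁻¹ * u * c)
  rwa [show c⁻¹⁻¹ * (c⁻¹ * u * c) * c⁻¹ = u by group] at this

/-- Additivity of lengths is the equality case of the dimension count: the invariants of the product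
are then exactly the common invariants of the factors. -/
theorem fixSpace_le_of_absLen {u v : Equiv.Perm (Fin m)}
    (h : absLen u + absLen v = absLen (u * v)) :
    fixSpace (u * v) ≤ fixSpace u ∧ fixSpace (u * v) ≤ fixSpace v := by
  have h1 := finrank_le_inf u v
  have h3 := absLen_add_finrank u
  have h4 := absLen_add_finrank v
  have h5 := absLen_add_finrank (u * v)
  have h6 := Submodule.eq_of_le_of_finrank_le (inf_le_fixSpace_mul u v) (by omega)
  rw [← h6]
  exact ⟨inf_le_left, inf_le_right⟩

theorem mem_fixSpace_swap_iff {i j : Fin m} {f : Fin m → ℚ} :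
    f ∈ fixSpace (Equiv.swap i j) ↔ f i = f j := by
  constructor
  · intro h
    have := h j
    rwa [Equiv.swap_apply_right] at this
  · intro h x
    rw [Equiv.swap_apply_def]
    split_ifs with h1 h2
    · rw [h1, h]
    · rw [h2, h]
    · rfl

theorem absLen_swap {i j : Fin m} (h : i ≠ j) : absLen (Equiv.swap i j) = 1 := by
  have h0 : absLen (Equiv.swap i j) ≠ 0 := fun h0 => h (by
    have := eq_one_of_absLen _ h0
    exact Equiv.swap_eq_refl_iff.1 this)
  let φ : (Fin m → ℚ) →ₗ[ℚ] ℚ := LinearMap.proj (R := ℚ) (φ := fun _ => ℚ) i - LinearMap.proj j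
  have h1 := LinearMap.finrank_range_add_finrank_ker φ
  have h2 : LinearMap.ker φ ≤ fixSpace (Equiv.swap i j) := by
    intro f hf
    rw [mem_fixSpace_swap_iff]
    exact sub_eq_zero.1 hf
  have h3 := Submodule.finrank_mono h2
  have h4 := Submodule.finrank_le (LinearMap.range φ)
  rw [Module.finrank_self] at h4
  rw [Module.finrank_fin_fun] at h1
  have h5 := absLen_add_finrank (Equiv.swap i j)
  omega

/-- Multiplying by a transposition of two points of one cycle shortens a permutation. -/
theorem absLen_swap_mul {i j : Fin m} {u : Equiv.Perm (Fin m)} {f : Fin m → ℚ}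
    (h : ∀ f ∈ fixSpace u, f i = f j) (hf : f ∈ fixSpace (Equiv.swap i j * u))
    (hf' : f ∉ fixSpace u) : 1 + absLen (Equiv.swap i j * u) = absLen u := by
  have hij : i ≠ j := by
    rintro rfl
    rw [Equiv.swap_self] at hf
    exact hf' hf
  have h1 : fixSpace u ≤ fixSpace (Equiv.swap i j * u) := fun f hf x => by
    rw [Equiv.Perm.mul_apply, mem_fixSpace_swap_iff.2 (h f hf), hf x]
  have h2 : fixSpace u < fixSpace (Equiv.swap i j * u) := lt_of_le_of_ne h1 fun e => hf' (e ▸ hf)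
  have h3 := Submodule.finrank_lt_finrank_of_lt h2
  have h4 := absLen_mul_le (Equiv.swap i j) (Equiv.swap i j * u)
  rw [Equiv.swap_mul_self_mul, absLen_swap hij] at h4
  have h5 := absLen_add_finrank u
  have h6 := absLen_add_finrank (Equiv.swap i j * u)
  omega

/-- The product fixes `x`, so the indicator function of `x` becomes a new invariant. -/
theorem absLen_swap_apply_mul {x : Fin m} {v : Equiv.Perm (Fin m)} (h : v x ≠ x) :
    1 + absLen (Equiv.swap x (v x) * v) = absLen v := by
  refine absLen_swap_mul (f := Pi.single x 1) (fun f hf => (hf x).symm) ?_ ?_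
  · intro y
    simp only [Equiv.Perm.mul_apply, Pi.single_apply]
    congr 1
    rw [Equiv.swap_apply_eq_iff, Equiv.swap_apply_left]
    simp
  · intro hx
    have := hx x
    simp [h] at this

end Fix

/-! ### Noncrossing permutations -/

section NonCrossing

variable {m : ℕ}

/-- The permutation `u` maps `[i, j)` onto `(i, j]`. -/
def Shifts (u : Equiv.Perm (Fin m)) (i j : Fin m) : Prop :=
  ∀ x, (i ≤ x ∧ x < j) ↔ (i < u x ∧ u x ≤ j)

/-- The relation of lying on a common block of a noncrossing permutation. -/
def Linked (u : Equiv.Perm (Fin m)) (i j : Fin m) : Prop := Shifts u i j ∧ Shifts u j i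

/-- Permutations that rotate the blocks of a noncrossing partition. -/
def IsNC (u : Equiv.Perm (Fin m)) : Prop := ∀ x, Linked u x (u x)

variable {u : Equiv.Perm (Fin m)} {i j k l : Fin m}

theorem shifts_of_le (h : j ≤ i) : Shifts u i j := fun x => by
  simp only [Fin.le_def, Fin.lt_def] at *
  omega

theorem linked_of_shifts (h : i ≤ j) (h' : Shifts u i j) : Linked u i j := ⟨h', shifts_of_le h⟩

theorem linked_refl (i : Fin m) : Linked u i i := ⟨shifts_of_le le_rfl, shifts_of_le le_rfl⟩

theorem Linked.symm (h : Linked u i j) : Linked u j i := ⟨h.2, h.1⟩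

theorem Linked.trans (h : Linked u i j) (h' : Linked u j k) : Linked u i k := by
  constructor <;> intro x
  all_goals
    have h1 := h.1 x
    have h2 := h.2 x
    have h3 := h'.1 x
    have h4 := h'.2 x
    simp only [Fin.le_def, Fin.lt_def] at *
    omega

theorem linked_of_crossing (h : Linked u i j) (h' : Linked u k l) (hik : i < k) (hkj : k < j)
    (hjl : j < l) : Linked u i k := by
  refine linked_of_shifts hik.le fun x => ?_
  have h1 := h.1 x
  have h3 := h'.1 x
  simp only [Fin.le_def, Fin.lt_def] at *
  omega

/-- The points `k` and `l` lie on the same side of the interval `[i, j)`. -/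
def SameSide (i j k l : Fin m) : Prop := (i ≤ k ∧ k < j) ↔ (i ≤ l ∧ l < j)

theorem swap_val (i j x : Fin m) :
    (Equiv.swap i j x).val = if x.val = i.val then j.val else if x.val = j.val then i.val
      else x.val := by
  rw [Equiv.swap_apply_def]
  simp only [Fin.ext_iff]
  split_ifs <;> rfl

/-- Splitting the chord off a block cuts the block along `[i, j)`, and links on either side survive.
Since `i` and `j` need not be linked in `u`, the lemma also serves for joining blocks, in
`IsNC.of_swap_mul`. -/
theorem Linked.swap_mul (hij : i < j) (hs : SameSide i j k l) (h : Linked u k l) :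
    Linked (Equiv.swap i j * u) k l := by
  constructor <;> intro x
  all_goals
    have h1 := h.1 x
    have h2 := h.2 x
    simp only [SameSide, Equiv.Perm.mul_apply, Fin.le_def, Fin.lt_def, swap_val] at *
    generalize (u x).val = y at *
    generalize x.val = x at *
    split_ifs <;> omega

theorem sameSide_apply (hij : i < j) (h : Linked u i j) (x : Fin m) :
    SameSide i j x ((Equiv.swap i j * u) x) := by
  have h1 := h.1 x
  simp only [SameSide, Equiv.Perm.mul_apply, Fin.le_def, Fin.lt_def, swap_val] at *
  generalize (u x).val = y at *
  generalize x.val = x at *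
  split_ifs <;> omega

theorem Linked.swap_apply (h : Linked u i j) (x : Fin m) : Linked u x (Equiv.swap i j x) := by
  rw [Equiv.swap_apply_def]
  split_ifs with h1 h2
  · rwa [h1]
  · rw [h2]; exact h.symm
  · exact linked_refl _

theorem IsNC.swap_mul (hu : IsNC u) (hij : i < j) (h : Linked u i j) :
    IsNC (Equiv.swap i j * u) := fun x =>
  Linked.swap_mul hij (sameSide_apply hij h x) ((hu x).trans (h.swap_apply (u x)))

theorem IsNC.of_swap_mul (hu : IsNC u) (hij : i < j) (h : Linked (Equiv.swap i j * u) i j) :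
    IsNC (Equiv.swap i j * u) := by
  intro x
  have h1 := sameSide_apply hij h x
  rw [← mul_assoc, Equiv.swap_mul_self, one_mul] at h1
  exact (Linked.swap_mul hij h1 (hu x)).trans (h.swap_apply (u x))

-- The invariant function has equal sums over `[i, j)` and over its image `(i, j]`; cancelling the
-- common points leaves the two end points.
open Finset in
theorem eq_of_shifts (hij : i < j) (h : Shifts u i j) {f : Fin m → ℚ} (hf : f ∈ fixSpace u) :
    f i = f j := by
  have h1 : ∑ x ∈ Ico i j, f x = ∑ x ∈ Ioc i j, f x := by
    refine sum_equiv u (fun x => ?_) fun x _ => (hf x).symm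
    simpa using h x
  rw [← Ioo_insert_left hij, ← Ioo_insert_right hij, sum_insert (by simp), sum_insert (by simp)]
    at h1
  exact add_right_cancel h1

theorem eq_of_linked (h : Linked u i j) {f : Fin m → ℚ} (hf : f ∈ fixSpace u) : f i = f j := by
  rcases lt_trichotomy i j with h1 | rfl | h1
  · exact eq_of_shifts h1 h.1 hf
  · rfl
  · exact (eq_of_shifts h1 h.2 hf).symm

/-- For the converse, test with the indicator function of the points linked to `i`. -/
theorem IsNC.linked_iff (hu : IsNC u) : Linked u i j ↔ ∀ f ∈ fixSpace u, f i = f j := by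
  classical
  refine ⟨fun h f hf => eq_of_linked h hf, fun h => ?_⟩
  have h1 := h (fun x => if Linked u i x then 1 else 0) fun x => by
    have : Linked u i (u x) ↔ Linked u i x :=
      ⟨fun h => h.trans (hu x).symm, fun h => h.trans (hu x)⟩
    simp only [this]
  by_contra h2
  simp [linked_refl, h2] at h1

/-- The indicator function of `[i, j)` is invariant under the product but not under `u`, where `i`
and `j` lie in one block. -/
theorem absLen_swap_mul_of_linked (hij : i < j) (h : Linked u i j) :
    1 + absLen (Equiv.swap i j * u) = absLen u := by
  classical
  refine absLen_swap_mul (f := fun x => if i ≤ x ∧ x < j then 1 else 0)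
    (fun f hf => eq_of_linked h hf) (fun x => ?_) fun hf => ?_
  · have : (i ≤ _ ∧ _ < j) ↔ (i ≤ _ ∧ _ < j) := sameSide_apply hij h x
    simp only [this]
  · have := eq_of_linked h hf
    simp [hij] at this

variable (m) in
/-- The interval below the long cycle for the absolute length. -/
noncomputable def dualGerm : IntervalGerm (Equiv.Perm (Fin m)) where
  len := absLen
  top := finRotate m
  len_one := absLen_one
  len_mul_le := absLen_mul_le
  eq_one_of_len := eq_one_of_absLen
  len_conj := absLen_conj _

theorem IsNC.pre_swap_iff (hu : IsNC u) (hij : i < j) :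
    (dualGerm m).Pre (Equiv.swap i j) u ↔ Linked u i j := by
  change absLen _ + absLen ((Equiv.swap i j)⁻¹ * u) = absLen u ↔ _
  rw [Equiv.swap_inv]
  constructor
  · intro h
    rw [hu.linked_iff]
    intro f hf
    rw [← mem_fixSpace_swap_iff]
    have h1 := fixSpace_le_of_absLen (u := Equiv.swap i j) (v := Equiv.swap i j * u)
      (by rwa [Equiv.swap_mul_self_mul])
    rw [Equiv.swap_mul_self_mul] at h1
    exact h1.1 hf
  · intro h
    rw [absLen_swap hij.ne, absLen_swap_mul_of_linked hij h]

theorem finRotate_val (x : Fin m) :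
    (finRotate m x).val = if x.val + 1 = m then 0 else x.val + 1 := by
  cases m with
  | zero => exact x.elim0
  | succ m =>
    rw [coe_finRotate]
    simp only [Fin.ext_iff, Fin.val_last]
    split_ifs <;> omega

theorem linked_finRotate (i j : Fin m) : Linked (finRotate m) i j := by
  constructor <;> intro x
  all_goals
    simp only [Fin.le_def, Fin.lt_def, finRotate_val]
    split_ifs <;> omega

theorem isNC_finRotate : IsNC (finRotate m) := fun _ => linked_finRotate _ _

/-- Remove transpositions of `x` and `v x` from the left factor one at a time: additivity of length
makes the two points linked in `v * u`, so each removal cuts a block and keeps the product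
noncrossing. -/
theorem isNC_of_mul (v u : Equiv.Perm (Fin m)) (h : IsNC (v * u))
    (hl : absLen v + absLen u = absLen (v * u)) : IsNC u := by
  induction hN : absLen v generalizing v with
  | zero => rwa [eq_one_of_absLen v hN, one_mul] at h
  | succ N ih =>
    have h1 : v ≠ 1 := by
      rintro rfl
      rw [absLen_one] at hN
      omega
    obtain ⟨x, hx⟩ : ∃ x, v x ≠ x := by
      by_contra! h2
      exact h1 (Equiv.ext h2)
    have h2 := absLen_swap_apply_mul hx
    have h3 : Linked (v * u) x (v x) := by
      rw [h.linked_iff]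
      intro f hf
      exact ((fixSpace_le_of_absLen hl).1 hf x).symm
    have key : ∀ i j, i < j → Linked (v * u) i j → 1 + absLen (Equiv.swap i j * v) = absLen v →
        IsNC u := by
      intro i j hij hL hv
      have h4 := absLen_swap_mul_of_linked hij hL
      refine ih (Equiv.swap i j * v) ?_ ?_ (by omega)
      · rw [mul_assoc]
        exact h.swap_mul hij hL
      · rw [mul_assoc]
        omega
    rcases lt_or_gt_of_ne hx with h4 | h4
    · exact key _ _ h4 h3.symm (by rwa [Equiv.swap_comm])
    · exact key _ _ h4 h3 h2

theorem linked_swap_finRotate (hu : IsNC u) (x : Fin m) :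
    Linked (Equiv.swap (finRotate m x) (u x) * u) (finRotate m x) (u x) := by
  constructor <;> intro y
  all_goals
    have h1 := (hu x).1 y
    have h2 := (hu x).2 y
    have h3 : (u y).val = (u x).val ↔ y.val = x.val := by
      rw [← Fin.ext_iff, ← Fin.ext_iff]; exact u.injective.eq_iff
    have h4 := y.isLt
    have h5 := (u y).isLt
    have h6 := x.isLt
    have h7 := (u x).isLt
    simp only [Equiv.Perm.mul_apply, Fin.le_def, Fin.lt_def, swap_val, finRotate_val] at *
    generalize (u x).val = ux at *
    generalize (u y).val = uy at *
    generalize x.val = x at *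
    generalize y.val = y at *
    split_ifs <;> omega

/-- One direction is `isNC_of_mul` applied to the long cycle. For the other, correct `u` at a point
`x` where it differs from the long cycle: this joins blocks, remains noncrossing and leaves fewer
disagreements, and `u` is a quotient of the larger simple permutation. -/
theorem simple_iff_isNC : (dualGerm m).Simple u ↔ IsNC u := by
  constructor
  · intro h
    refine isNC_of_mul (finRotate m * u⁻¹) u (by simpa using isNC_finRotate) ?_
    have h1 : finRotate m * u⁻¹ = (finRotate m)⁻¹⁻¹ * (u⁻¹ * finRotate m) * (finRotate m)⁻¹ := by
      group
    rw [inv_mul_cancel_right, h1, absLen_conj, add_comm]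
    exact h
  · intro h
    induction hN : (Finset.univ.filter fun x => u x ≠ finRotate m x).card
      using Nat.strong_induction_on generalizing u with
    | _ N ih =>
      subst hN
      by_cases h1 : u = finRotate m
      · rw [h1]
        exact IntervalGerm.simple_top
      obtain ⟨x, hx⟩ : ∃ x, u x ≠ finRotate m x := by
        by_contra! h2
        exact h1 (Equiv.ext h2)
      have h2 := linked_swap_finRotate h x
      have h3 : (Finset.univ.filter fun y =>
          (Equiv.swap (finRotate m x) (u x) * u) y ≠ finRotate m y).card <
          (Finset.univ.filter fun x => u x ≠ finRotate m x).card := by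
        apply Finset.card_lt_card
        rw [Finset.ssubset_iff_of_subset]
        · exact ⟨x, by simpa using hx, by simp⟩
        · intro y h4
          rw [Finset.mem_filter] at h4 ⊢
          refine ⟨Finset.mem_univ _, fun h5 => h4.2 ?_⟩
          rw [Equiv.Perm.mul_apply, h5, Equiv.swap_apply_of_ne_of_ne]
          · intro h6
            rw [(finRotate m).injective h6] at h5
            exact hx h5
          · intro h6
            rw [← h5] at h6
            rw [u.injective h6] at h5
            exact hx h5
      have key : ∀ i j, i < j → Linked (Equiv.swap i j * u) i j →
          (Finset.univ.filter fun y => (Equiv.swap i j * u) y ≠ finRotate m y).card <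
          (Finset.univ.filter fun x => u x ≠ finRotate m x).card → (dualGerm m).Simple u := by
        intro i j hij hL hc
        have h4 := h.of_swap_mul hij hL
        have h5 := IntervalGerm.simple_quot ((h4.pre_swap_iff hij).2 hL) (ih _ hc h4 rfl)
        rwa [Equiv.swap_inv, Equiv.swap_mul_self_mul] at h5
      rcases lt_or_gt_of_ne hx with h4 | h4
      · rw [Equiv.swap_comm] at h2 h3
        exact key _ _ h4 h2.symm h3
      · exact key _ _ h4 h2 h3

end NonCrossing
/-! ### Chords as atoms of the dual germ -/

section Chord

open IntervalGerm

variable {m : ℕ} {G : Type} [Group G]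

variable (m) in
/-- The chords of the circle with `m` marked points. -/
abbrev Chord : Type := {p : Fin m × Fin m // p.1 < p.2}

/-- The transposition of the end points of a chord. -/
def chordSwap (p : Chord m) : Equiv.Perm (Fin m) := Equiv.swap p.1.1 p.1.2

theorem simple_chordSwap (p : Chord m) : (dualGerm m).Simple (chordSwap p) :=
  (isNC_finRotate.pre_swap_iff p.2).2 (linked_finRotate _ _)

theorem pre_chordSwap_iff {u : Equiv.Perm (Fin m)} (hu : (dualGerm m).Simple u) (p : Chord m) :
    (dualGerm m).Pre (chordSwap p) u ↔ Linked u p.1.1 p.1.2 :=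
  (simple_iff_isNC.1 hu).pre_swap_iff p.2

theorem steps_of_linked {u : Equiv.Perm (Fin m)} (hu : (dualGerm m).Simple u) {a b : Chord m}
    (hs : SameSide a.1.1 a.1.2 b.1.1 b.1.2) (ha : Linked u a.1.1 a.1.2)
    (hb : Linked u b.1.1 b.1.2) : (dualGerm m).Steps chordSwap [a, b] u := by
  have h1 := (pre_chordSwap_iff hu a).2 ha
  refine ⟨h1, (pre_chordSwap_iff (simple_quot h1 hu) b).2 ?_, trivial⟩
  rw [chordSwap, Equiv.swap_inv]
  exact Linked.swap_mul a.2 hs hb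

theorem good_chords (g : Chord m → G) {a b c d : Chord m}
    (hac : SameSide a.1.1 a.1.2 c.1.1 c.1.2) (hbd : SameSide b.1.1 b.1.2 d.1.1 d.1.2)
    (ht : chordSwap a * chordSwap c = chordSwap b * chordSwap d) (hg : g a * g c = g b * g d)
    (hl : ∀ u : Equiv.Perm (Fin m), Linked u a.1.1 a.1.2 → Linked u b.1.1 b.1.2 →
      Linked u c.1.1 c.1.2 ∧ Linked u d.1.1 d.1.2) : (dualGerm m).Good chordSwap g a b := by
  refine good_of_steps [c] [d] (simple_chordSwap a) (simple_chordSwap b) (by simpa using ht)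
    (by simpa using hg) fun u hu ha hb => ?_
  rw [pre_chordSwap_iff hu] at ha hb
  obtain ⟨hc, hd⟩ := hl u ha hb
  exact ⟨steps_of_linked hu hac ha hc, steps_of_linked hu hbd hb hd⟩

theorem _root_.ArtinB.IntervalGerm.Good.symm {W A : Type} [Group W] {I : IntervalGerm W}
    {t : A → W} {g : A → G} {a b : A} (h : I.Good t g a b) : I.Good t g b a := by
  obtain ⟨p, q, w, h1, h2, h3, h4⟩ := h
  exact ⟨q, p, w, h2, h1, h3.symm, fun u hu hb ha => h4 u hu ha hb⟩

theorem chordSwap_triangle {a b c : Fin m} (hab : a < b) (hbc : b < c) :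
    Equiv.swap a b * Equiv.swap b c = Equiv.swap b c * Equiv.swap a c ∧
    Equiv.swap b c * Equiv.swap a c = Equiv.swap a c * Equiv.swap a b := by
  have h1 : a.val < b.val := hab
  have h2 : b.val < c.val := hbc
  constructor <;>
  · ext x
    simp only [Equiv.Perm.mul_apply, swap_val]
    generalize x.val = x
    split_ifs <;> omega

theorem chordSwap_comm {a b c d : Fin m} (hac : a ≠ c) (had : a ≠ d) (hbc : b ≠ c) (hbd : b ≠ d) :
    Equiv.swap a b * Equiv.swap c d = Equiv.swap c d * Equiv.swap a b := by
  rw [Ne, Fin.ext_iff] at *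
  ext x
  simp only [Equiv.Perm.mul_apply, swap_val]
  generalize x.val = x
  split_ifs <;> omega

/-- The relations between the half twists along the chords. -/
structure IsBandFamily (g : Chord m → G) : Prop where
  left : ∀ a b c (hab : a < b) (hbc : b < c),
    g ⟨(a, b), hab⟩ * g ⟨(b, c), hbc⟩ = g ⟨(b, c), hbc⟩ * g ⟨(a, c), hab.trans hbc⟩
  right : ∀ a b c (hab : a < b) (hbc : b < c),
    g ⟨(b, c), hbc⟩ * g ⟨(a, c), hab.trans hbc⟩ = g ⟨(a, c), hab.trans hbc⟩ * g ⟨(a, b), hab⟩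
  disjoint : ∀ a b c d (hab : a < b) (_ : b < c) (hcd : c < d),
    Commute (g ⟨(a, b), hab⟩) (g ⟨(c, d), hcd⟩)
  nested : ∀ a b c d (hab : a < b) (hbc : b < c) (hcd : c < d),
    Commute (g ⟨(a, d), (hab.trans hbc).trans hcd⟩) (g ⟨(b, c), hbc⟩)

theorem IsBraidSeq.isBandFamily {g : ℕ → G} (h : IsBraidSeq g (m - 1)) :
    IsBandFamily fun p : Chord m => bandGen g p.1.1 p.1.2 where
  left _ _ c hab hbc := h.triangle_left hab hbc (Nat.le_sub_one_of_lt c.isLt)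
  right _ _ c hab hbc := h.triangle_right hab hbc (Nat.le_sub_one_of_lt c.isLt)
  disjoint _ _ _ d hab hbc hcd := h.commute_disjoint hab hbc hcd (Nat.le_sub_one_of_lt d.isLt)
  nested _ _ _ d hab hbc hcd := h.commute_nested hab hbc hcd (Nat.le_sub_one_of_lt d.isLt)

variable {g : Chord m → G}

/-- Chords that share an end point, are disjoint or are nested have an explicit relation of length
two. Two crossing chords are compared through the chord joining their left ends, which lies below
everything above both of them. -/
theorem IsBandFamily.isAtomic (h : IsBandFamily g) : (dualGerm m).IsAtomic chordSwap g where
  ne_one p hp := p.2.ne (Equiv.swap_eq_refl_iff.1 hp)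
  simple := simple_chordSwap
  exists_pre w hw hw1 := by
    obtain ⟨x, hx⟩ : ∃ x, w x ≠ x := by
      by_contra! h2
      exact hw1 (Equiv.ext h2)
    have h1 := simple_iff_isNC.1 hw x
    rcases lt_or_gt_of_ne hx with h2 | h2
    · exact ⟨⟨(_, _), h2⟩, (pre_chordSwap_iff hw _).2 h1.symm⟩
    · exact ⟨⟨(_, _), h2⟩, (pre_chordSwap_iff hw _).2 h1⟩
  connected := by
    have refl : ∀ a : Chord m, (dualGerm m).Good chordSwap g a a := fun a =>
      good_of_steps [] [] (simple_chordSwap a) (simple_chordSwap a) rfl rfl fun u _ h _ =>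
        ⟨⟨h, trivial⟩, ⟨h, trivial⟩⟩
    -- the three pairs of sides of a triangle
    have tri1 : ∀ a b c (hab : a < b) (hbc : b < c),
        (dualGerm m).Good chordSwap g ⟨(a, b), hab⟩ ⟨(b, c), hbc⟩ := fun a b c hab hbc => by
      refine good_chords g (c := ⟨(b, c), hbc⟩) (d := ⟨(a, c), hab.trans hbc⟩) ?_ ?_
        (chordSwap_triangle hab hbc).1 (h.left a b c hab hbc) fun u h1 h2 => ⟨h2, h1.trans h2⟩
      all_goals
        simp only [SameSide, Fin.le_def, Fin.lt_def] at *
        omega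
    have tri2 : ∀ a b c (hab : a < b) (hbc : b < c),
        (dualGerm m).Good chordSwap g ⟨(b, c), hbc⟩ ⟨(a, c), hab.trans hbc⟩ :=
      fun a b c hab hbc => by
      refine good_chords g (c := ⟨(a, c), hab.trans hbc⟩) (d := ⟨(a, b), hab⟩) ?_ ?_
        (chordSwap_triangle hab hbc).2 (h.right a b c hab hbc)
        fun u h1 h2 => ⟨h2, h2.trans h1.symm⟩
      all_goals
        simp only [SameSide, Fin.le_def, Fin.lt_def] at *
        omega
    have tri3 : ∀ a b c (hab : a < b) (hbc : b < c),
        (dualGerm m).Good chordSwap g ⟨(a, b), hab⟩ ⟨(a, c), hab.trans hbc⟩ :=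
      fun a b c hab hbc => by
      refine good_chords g (c := ⟨(b, c), hbc⟩) (d := ⟨(a, b), hab⟩) ?_ ?_
        ((chordSwap_triangle hab hbc).1.trans (chordSwap_triangle hab hbc).2)
        ((h.left a b c hab hbc).trans (h.right a b c hab hbc))
        fun u h1 h2 => ⟨h1.symm.trans h2, h1⟩
      all_goals
        simp only [SameSide, Fin.le_def, Fin.lt_def] at *
        omega
    have disj : ∀ a b c d (hab : a < b) (hbc : b < c) (hcd : c < d),
        (dualGerm m).Good chordSwap g ⟨(a, b), hab⟩ ⟨(c, d), hcd⟩ := fun a b c d hab hbc hcd => by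
      refine good_chords g (c := ⟨(c, d), hcd⟩) (d := ⟨(a, b), hab⟩) ?_ ?_
        (chordSwap_comm (hab.trans hbc).ne ((hab.trans hbc).trans hcd).ne hbc.ne
          (hbc.trans hcd).ne) (h.disjoint a b c d hab hbc hcd) fun u h1 h2 => ⟨h2, h1⟩
      all_goals
        simp only [SameSide, Fin.le_def, Fin.lt_def] at *
        omega
    have nest : ∀ a b c d (hab : a < b) (hbc : b < c) (hcd : c < d),
        (dualGerm m).Good chordSwap g ⟨(a, d), (hab.trans hbc).trans hcd⟩ ⟨(b, c), hbc⟩ :=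
      fun a b c d hab hbc hcd => by
      refine good_chords g (c := ⟨(b, c), hbc⟩) (d := ⟨(a, d), (hab.trans hbc).trans hcd⟩) ?_ ?_
        (chordSwap_comm hab.ne (hab.trans hbc).ne (hbc.trans hcd).ne' hcd.ne')
        (h.nested a b c d hab hbc hcd) fun u h1 h2 => ⟨h2, h1⟩
      all_goals
        simp only [SameSide, Fin.le_def, Fin.lt_def] at *
        omega
    have of_good : ∀ a b, (dualGerm m).Good chordSwap g a b → ∃ d, (∀ u, (dualGerm m).Simple u →
        (dualGerm m).Pre (chordSwap a) u → (dualGerm m).Pre (chordSwap b) u →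
        (dualGerm m).Pre (chordSwap d) u) ∧
        (dualGerm m).Good chordSwap g a d ∧ (dualGerm m).Good chordSwap g d b :=
      fun a b hab => ⟨b, fun _ _ _ hb => hb, hab, refl b⟩
    have key : ∀ a b : Chord m, a.1.1 ≤ b.1.1 → ∃ d, (∀ u, (dualGerm m).Simple u →
        (dualGerm m).Pre (chordSwap a) u → (dualGerm m).Pre (chordSwap b) u →
        (dualGerm m).Pre (chordSwap d) u) ∧
        (dualGerm m).Good chordSwap g a d ∧ (dualGerm m).Good chordSwap g d b := by
      rintro ⟨⟨i, j⟩, hij⟩ ⟨⟨k, l⟩, hkl⟩ hik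
      rcases eq_or_lt_of_le hik with h1 | h1
      · obtain rfl : i = k := h1
        apply of_good
        rcases lt_trichotomy j l with h2 | h2 | h2
        · exact tri3 i j l hij h2
        · subst h2; exact refl _
        · exact (tri3 i l j hkl h2).symm
      · clear hik
        have hik : i < k := h1
        rcases lt_trichotomy j k with h2 | h2 | h2
        · exact of_good _ _ (disj i j k l hij h2 hkl)
        · subst h2; exact of_good _ _ (tri1 i j l hij hkl)
        rcases lt_trichotomy l j with h3 | h3 | h3
        · exact of_good _ _ (nest i k l j hik hkl h3)
        · subst h3; exact of_good _ _ (tri2 i k l hik hkl).symm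
        · refine ⟨⟨(i, k), hik⟩, fun u hu ha hb => ?_, (tri3 i k j hik h2).symm,
            tri1 i k l hik hkl⟩
          rw [pre_chordSwap_iff hu] at ha hb ⊢
          exact linked_of_crossing ha hb hik h2 h3
    intro a b
    rcases le_total a.1.1 b.1.1 with h1 | h1
    · exact key a b h1
    · obtain ⟨d, h2, h3, h4⟩ := key b a h1
      exact ⟨d, fun u hu ha hb => h2 u hu hb ha, h4.symm, h3.symm⟩

/-- Each side of a band relation is a shortest expression of a permutation below the long cycle, so
`f` is multiplicative on it; the relation then comes from transpositions. -/
theorem IsMorphism.isBandFamily {N : Type} [Group N] {f : Equiv.Perm (Fin m) → N}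
    (hf : (dualGerm m).IsMorphism f) : IsBandFamily fun p : Chord m => f (chordSwap p) := by
  have key : ∀ a b : Chord m, SameSide a.1.1 a.1.2 b.1.1 b.1.2 →
      f (chordSwap a) * f (chordSwap b) = f (chordSwap a * chordSwap b) := by
    intro a b hs
    have h1 := steps_of_linked simple_top hs (linked_finRotate _ _) (linked_finRotate _ _)
    have h2 := red_of_steps_top h1
    have h4 := hf (chordSwap a) (chordSwap b) (by simpa using h2.cons.1) ?_
    · exact h4.symm
    · have h5 := h1.sum_add
      rw [h2.2] at h5
      simpa [IntervalGerm.Simple, IntervalGerm.Pre] using h5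
  constructor
  · intro a b c hab hbc
    rw [key, key, chordSwap, chordSwap, (chordSwap_triangle hab hbc).1]
    · rfl
    all_goals
      simp only [SameSide, Fin.le_def, Fin.lt_def] at *
      omega
  · intro a b c hab hbc
    rw [key, key, chordSwap, chordSwap, (chordSwap_triangle hab hbc).2]
    · rfl
    all_goals
      simp only [SameSide, Fin.le_def, Fin.lt_def] at *
      omega
  · intro a b c d hab hbc hcd
    rw [commute_iff_eq, key, key, chordSwap, chordSwap, chordSwap_comm (hab.trans hbc).ne
      ((hab.trans hbc).trans hcd).ne hbc.ne (hbc.trans hcd).ne]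
    all_goals
      simp only [SameSide, Fin.le_def, Fin.lt_def] at *
      omega
  · intro a b c d hab hbc hcd
    rw [commute_iff_eq, key, key, chordSwap, chordSwap,
      chordSwap_comm hab.ne (hab.trans hbc).ne (hbc.trans hcd).ne' hcd.ne']
    all_goals
      simp only [SameSide, Fin.le_def, Fin.lt_def] at *
      omega

/-- The absolute length is invariant under conjugation, so prefixes and suffixes are the same. -/
theorem dualGerm_op_hasMeets (hm : (dualGerm m).HasMeets) : (dualGerm m).op.HasMeets := by
  have key : ∀ u v : (Equiv.Perm (Fin m))ᵐᵒᵖ,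
      (dualGerm m).op.Pre u v ↔ (dualGerm m).Pre u.unop v.unop := by
    intro u v
    change absLen u.unop + absLen (v.unop * u.unop⁻¹) = absLen v.unop ↔
      absLen u.unop + absLen (u.unop⁻¹ * v.unop) = absLen v.unop
    rw [← absLen_conj u.unop (v.unop * u.unop⁻¹), ← mul_assoc, inv_mul_cancel_right]
  intro u v hu hv
  obtain ⟨w, h1, h2, h3⟩ := hm u.unop v.unop ((op_simple_iff u).1 hu) ((op_simple_iff v).1 hv)
  exact ⟨MulOpposite.op w, (key _ _).2 h1, (key _ _).2 h2, fun z hz1 hz2 =>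
    (key _ _).2 (h3 _ ((key _ _).1 hz1) ((key _ _).1 hz2))⟩

theorem finRotate_ne_one (hm : 2 ≤ m) : finRotate m ≠ 1 := by
  intro h
  have := congrArg (fun w : Equiv.Perm (Fin m) => (w ⟨0, by omega⟩).val) h
  simp only [finRotate_val, Equiv.Perm.one_apply] at this
  split_ifs at this; omega

end Chord
/-! ### The dual Garside structure of the braid group -/

section DualBraid

open IntervalGerm

variable {n : ℕ} {N : Type} [Group N]

theorem map_bandGen {G : Type} [Group G] (θ : G →* N) (g : ℕ → G) (τ : ℕ → N) {a b : ℕ}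
    (hab : a < b) (h : ∀ j, a ≤ j → j < b → θ (g j) = τ j) :
    θ (bandGen g a b) = bandGen τ a b := by
  induction b, hab using Nat.le_induction with
  | base => rw [bandGen_succ_self, bandGen_succ_self, h a le_rfl (by omega)]
  | succ b hab ih =>
    have hab : a < b := hab
    rw [bandGen_succ _ hab, bandGen_succ _ hab, map_mul, map_mul, map_inv,
      h b (by omega) (by omega), ih fun j h1 h2 => h j h1 (by omega)]

/-- The image of `σ i` in terms of the images `τ` of the half twists along the sides. -/
def sideImage (n : ℕ) (τ : ℕ → N) (i : ℕ) : N :=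
  if i + 1 < n then τ i else if i + 1 = n then bandGen τ i (2 * n - 1) else τ (3 * n - 2 - i)

theorem IsBraidSeq.sideImage {τ : ℕ → N} (h : IsBraidSeq τ (2 * n - 1)) :
    IsBraidSeq (sideImage n τ) (2 * n - 1) where
  comm i j hij hj := by
    rw [ArtinB.sideImage, ArtinB.sideImage]
    split_ifs with h1 h2 h3 h4 h5 h6
    · exact h.comm _ _ hij hj
    · exact h.commute_outer (by omega) le_rfl (by omega) (by omega)
    · exact h.comm _ _ (by omega) (by omega)
    · omega
    · omega
    · exact (h.commute_inner le_rfl (by omega) (by omega)).symm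
    · omega
    · omega
    · exact (h.comm _ _ (by omega) (by omega)).symm
  braid i hi := by
    rw [ArtinB.sideImage, ArtinB.sideImage]
    split_ifs with h1 h2 h3 h4 h5 h6
    · exact h.braid i hi
    · exact (h.braid_left (by omega) le_rfl).symm
    · omega
    · omega
    · omega
    · have h7 := h.braid_right (a := i) (b := 2 * n - 2) (by omega) (by omega)
      have h8 := bandGen_succ τ (a := i) (b := 2 * n - 2) (by omega)
      rw [show 2 * n - 2 + 1 = 2 * n - 1 by omega] at h8
      have h9 := braid_conj (τ (2 * n - 2)) h7
      rwa [← h8, inv_mul_cancel, one_mul, ← show 3 * n - 2 - (i + 1) = 2 * n - 2 by omega] at h9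
    · omega
    · omega
    · have h7 := h.braid (3 * n - 2 - (i + 1)) (by omega)
      rw [show 3 * n - 2 - (i + 1) + 1 = 3 * n - 2 - i by omega] at h7
      exact h7.symm

theorem exists_hom_of_isBraidSeq {m : ℕ} {g : ℕ → N} (h : IsBraidSeq g (m - 1)) :
    ∃ θ : BraidGroup m →* N, ∀ i : Fin (m - 1), θ (σ i) = g i := by
  refine ⟨PresentedGroup.toGroup (f := fun i => g i.val) ?_, fun i => PresentedGroup.toGroup.of _⟩
  rintro r ⟨i, j, ⟨hij, rfl⟩ | ⟨hij, rfl⟩⟩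
  · simp only [map_mul, map_inv, FreeGroup.lift_apply_of, mul_inv_eq_one, ← hij]
    exact h.braid i (by omega)
  · simp only [map_mul, map_inv, FreeGroup.lift_apply_of, mul_inv_eq_one]
    exact h.comm i j hij (by omega)

/-- The braid group has the same universal property for the side twists as for the `σ i`;
`sideImage` expresses the `σ i` through the prescribed images of the sides. -/
theorem exists_hom_sideTwist {τ : ℕ → N} (h : IsBraidSeq τ (2 * n - 1)) :
    ∃ θ : BraidGroup (2 * n) →* N, ∀ d, d < 2 * n - 1 → θ (sideTwist n d) = τ d := by
  obtain ⟨θ, hθ⟩ := exists_hom_of_isBraidSeq h.sideImage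
  have hs : ∀ i, i < 2 * n - 1 → θ (sigmaNat n i) = sideImage n τ i := fun i hi => by
    rw [sigmaNat, dif_pos hi, hθ]
  refine ⟨θ, fun d hd => ?_⟩
  rw [sideTwist]
  split_ifs with h1 h2
  · rw [hs d hd, sideImage, if_pos h1]
  -- Each conjugation by a `σ` of the right half shortens the band by one side. As `d = n - 1`,
  -- after `d` steps only the side `d` is left.
  · have key : ∀ k, k < n → θ (band n d k) = bandGen τ d (2 * n - 1 - k) := by
      intro k hk
      induction k with
      | zero => rw [band, hs d hd, sideImage, if_neg h1, if_pos h2, Nat.sub_zero]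
      | succ k ih =>
        have h3 := bandGen_succ τ (a := d) (b := 2 * n - 1 - (k + 1)) (by omega)
        rw [show 2 * n - 1 - (k + 1) + 1 = 2 * n - 1 - k by omega] at h3
        rw [band, if_neg (by omega), map_mul, map_mul, map_inv, ih (by omega), h3,
          hs _ (by omega), sideImage, if_neg (by omega), if_neg (by omega),
          show 3 * n - 2 - (d + 1 + k) = 2 * n - 1 - (k + 1) by omega]
        group
    rw [key d (by omega), show 2 * n - 1 - d = d + 1 by omega, bandGen_succ_self]
  · rw [hs _ (by omega), sideImage, if_neg (by omega), if_neg (by omega)]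
    congr 1
    omega

/-- The values on the sides determine the rest: the triangle relations give the braid relation for
adjacent sides and express longer chords by conjugation. -/
theorem IsBandFamily.exists_isBraidSeq {m : ℕ} {g : Chord m → N} (h : IsBandFamily g) :
    ∃ τ : ℕ → N, IsBraidSeq τ (m - 1) ∧ ∀ p : Chord m, g p = bandGen τ p.1.1 p.1.2 := by
  refine ⟨fun d => if hd : d + 1 < m then
    g ⟨(⟨d, by omega⟩, ⟨d + 1, hd⟩), Nat.lt_succ_self d⟩ else 1, ⟨fun i j hij hj => ?_,
    fun i hi => ?_⟩, ?_⟩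
  · rw [dif_pos (by omega), dif_pos (by omega)]
    exact h.disjoint _ _ _ _ _ (by simpa [Fin.lt_def] using hij) _
  · rw [dif_pos (by omega), dif_pos (by omega)]
    have h1 := h.left ⟨i, by omega⟩ ⟨i + 1, by omega⟩ ⟨i + 1 + 1, by omega⟩
      (Nat.lt_succ_self _) (Nat.lt_succ_self _)
    have h2 := h.right ⟨i, by omega⟩ ⟨i + 1, by omega⟩ ⟨i + 1 + 1, by omega⟩
      (Nat.lt_succ_self _) (Nat.lt_succ_self _)
    rw [h1, mul_assoc, ← h2, ← h1, mul_assoc]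
  · rintro ⟨⟨⟨a, ha⟩, ⟨b, hb⟩⟩, hab⟩
    have hab' : a < b := hab
    dsimp only
    induction b, hab' using Nat.le_induction with
    | base => rw [bandGen_succ_self, dif_pos hb]
    | succ b hab' ih =>
      have hab' : a < b := hab'
      rw [bandGen_succ _ hab', dif_pos hb, ← ih (by omega) hab', mul_assoc,
        eq_inv_mul_iff_mul_eq]
      exact (h.left ⟨a, ha⟩ ⟨b, by omega⟩ ⟨b + 1, hb⟩ hab' (Nat.lt_succ_self _)).symm

variable (n) in
/-- The half twist along a chord. -/
def chordGen (p : Chord (2 * n)) : BraidGroup (2 * n) := chordTwist n p.1.1 p.1.2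

theorem chordGen_eq :
    chordGen n = fun p : Chord (2 * n) => bandGen (sideTwist n) p.1.1 p.1.2 := by
  ext p
  exact chordTwist_eq n _ _ p.2

theorem isBandFamily_chordGen : IsBandFamily (chordGen n) := by
  rw [chordGen_eq]
  exact (sideTwist_isBraidSeq n).isBandFamily

/-- The chord of the circle that corresponds to the arc from `i` to `i + 1` on the line. -/
def sigmaChord (i : Fin (2 * n - 1)) : Chord (2 * n) :=
  if h1 : i.val + 1 < n then ⟨(⟨i, by omega⟩, ⟨i + 1, by omega⟩), Nat.lt_succ_self _⟩
  else if h2 : i.val + 1 = n then ⟨(⟨i, by omega⟩, ⟨2 * n - 1, by omega⟩),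
    Fin.mk_lt_mk.2 (by omega)⟩
  else ⟨(⟨3 * n - 2 - i, by omega⟩, ⟨3 * n - 1 - i, by omega⟩), Fin.mk_lt_mk.2 (by omega)⟩

theorem chordGen_sigmaChord (i : Fin (2 * n - 1)) : chordGen n (sigmaChord i) = σ i := by
  have h : ∀ k, k = 0 → band n i k = σ i := by
    rintro _ rfl
    rw [band, sigmaNat, dif_pos i.isLt]
  have hi := i.isLt
  rw [chordGen, chordTwist, sigmaChord]
  have e : ∀ (a b : ℕ), min a b = i.val → max a b = i.val + 1 →
      band n (min a b) (max a b - min a b - 1) = σ i := by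
    intro a b h1 h2
    rw [h1]
    exact h _ (by omega)
  apply e <;> split_ifs <;> simp only [linePos] <;> split_ifs <;> omega

theorem closure_range_chordGen : Subgroup.closure (Set.range (chordGen n)) = ⊤ := by
  rw [eq_top_iff, ← closure_range_sigma, Subgroup.closure_le]
  rintro _ ⟨i, rfl⟩
  exact Subgroup.subset_closure ⟨sigmaChord i, chordGen_sigmaChord i⟩

variable (n) in
/-- The dual simple braid of a noncrossing permutation. -/
noncomputable def dualBraid : Equiv.Perm (Fin (2 * n)) → BraidGroup (2 * n) :=
  IsAtomic.spell (dualGerm (2 * n)) chordSwap (chordGen n)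

theorem dualBraid_realization : (dualGerm (2 * n)).Realization (dualBraid n) := by
  refine isBandFamily_chordGen.isAtomic.realization closure_range_chordGen ?_
  intro N _ f hf
  obtain ⟨τ, hτ, hfτ⟩ := (IsMorphism.isBandFamily hf).exists_isBraidSeq
  obtain ⟨θ, hθ⟩ := exists_hom_sideTwist hτ
  refine ⟨θ, fun p => ?_⟩
  rw [chordGen_eq, hfτ p]
  refine map_bandGen θ _ _ p.2 fun j _ h2 => hθ j ?_
  have := p.1.2.isLt
  omega

theorem dualGerm_hasMeets : (dualGerm (2 * n)).HasMeets :=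
  (isBandFamily_chordGen (n := n)).isAtomic.hasMeets

theorem isGarside_dualBraid (hn : 1 ≤ n) :
    IsGarside (dualBraid n '' {u | (dualGerm (2 * n)).Simple u})
      (dualBraid n (finRotate (2 * n))) :=
  dualBraid_realization.isGarside dualGerm_hasMeets (finRotate_ne_one (by omega))

theorem isGarside_dualBraid_op (hn : 1 ≤ n) :
    IsGarside (MulOpposite.unop ⁻¹' (dualBraid n '' {u | (dualGerm (2 * n)).Simple u}))
      (MulOpposite.op (dualBraid n (finRotate (2 * n)))) :=
  dualBraid_realization.isGarside_op (dualGerm_op_hasMeets dualGerm_hasMeets)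
    (finRotate_ne_one (by omega))

end DualBraid
/-! ### Products of half twists along noncrossing chords -/

section ChordLists

open IntervalGerm

variable {m : ℕ}

/-- No chord of the list separates the end points of a later one. -/
def IsNested (L : List (Chord m)) : Prop :=
  L.Pairwise fun a b => SameSide a.1.1 a.1.2 b.1.1 b.1.2

theorem IsNested.steps {L : List (Chord m)} (hL : IsNested L) {u : Equiv.Perm (Fin m)}
    (hu : (dualGerm m).Simple u) (h : ∀ p ∈ L, Linked u p.1.1 p.1.2) :
    (dualGerm m).Steps chordSwap L u := by
  induction L generalizing u with
  | nil => trivial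
  | cons a L ih =>
    have h1 := (pre_chordSwap_iff hu a).2 (h a (by simp))
    obtain ⟨h2, h3⟩ := List.pairwise_cons.1 hL
    refine ⟨h1, ih h3 (simple_quot h1 hu) fun p hp => ?_⟩
    rw [chordSwap, Equiv.swap_inv]
    exact Linked.swap_mul a.2 (h2 p hp) (h p (by simp [hp]))

theorem IsNested.red {L : List (Chord m)} (hL : IsNested L) :
    (dualGerm m).Red chordSwap L (L.map chordSwap).prod ∧
      (dualGerm m).Simple (L.map chordSwap).prod := by
  have h1 := hL.steps simple_top fun _ _ => linked_finRotate _ _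
  have h2 := red_of_steps_top h1
  refine ⟨h2, ?_⟩
  have h3 := h1.sum_add
  rwa [h2.2] at h3

/-- In a shortest expression every length is additive, so the invariants of the product are the
common invariants of its transpositions. -/
theorem mem_fixSpace_of_red {L : List (Chord m)} {u : Equiv.Perm (Fin m)}
    (h : (dualGerm m).Red chordSwap L u) (f : Fin m → ℚ) :
    f ∈ fixSpace u ↔ ∀ p ∈ L, f p.1.1 = f p.1.2 := by
  induction L generalizing u with
  | nil =>
    obtain rfl : 1 = u := h.1
    simp [mem_fixSpace]
  | cons a L ih =>
    obtain ⟨h1, h2⟩ := h.cons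
    have h3 := fixSpace_le_of_absLen (u := chordSwap a) (v := (chordSwap a)⁻¹ * u)
      (by rw [mul_inv_cancel_left]; exact h1)
    have h4 := inf_le_fixSpace_mul (chordSwap a) ((chordSwap a)⁻¹ * u)
    rw [mul_inv_cancel_left] at h3 h4
    rw [List.forall_mem_cons, ← ih h2, ← mem_fixSpace_swap_iff]
    exact ⟨fun hf => ⟨h3.1 hf, h3.2 hf⟩, fun hf => h4 hf⟩

theorem IsNested.linked_iff {L : List (Chord m)} (hL : IsNested L) (i j : Fin m) :
    Linked (L.map chordSwap).prod i j ↔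
      ∀ f : Fin m → ℚ, (∀ p ∈ L, f p.1.1 = f p.1.2) → f i = f j := by
  rw [(simple_iff_isNC.1 hL.red.2).linked_iff]
  simp only [mem_fixSpace_of_red hL.red.1]

/-- The image of `x` is forced to be the cyclically next point of its block, so the blocks determine
the permutation. -/
theorem IsNC.eq_of_linked_iff {u v : Equiv.Perm (Fin m)} (hu : IsNC u) (hv : IsNC v)
    (h : ∀ i j, Linked u i j ↔ Linked v i j) : u = v := by
  ext x
  have h1 := ((h x (v x)).2 (hv x))
  have h2 := ((h x (u x)).1 (hu x))
  have h3 := h1.1 x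
  have h4 := h1.2 x
  have h5 := h2.1 x
  have h6 := h2.2 x
  simp only [Fin.le_def, Fin.lt_def] at *
  omega

/-- The chords between consecutive elements of an increasing list. -/
def chordsOf : List (Fin m) → List (Chord m)
  | [] => []
  | [_] => []
  | a :: b :: l => if h : a < b then ⟨(a, b), h⟩ :: chordsOf (b :: l) else chordsOf (b :: l)

theorem mem_of_mem_chordsOf {l : List (Fin m)} {p : Chord m} (hp : p ∈ chordsOf l) :
    p.1.1 ∈ l ∧ p.1.2 ∈ l := by
  induction l with
  | nil => simp [chordsOf] at hp
  | cons a l ih =>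
    cases l with
    | nil => simp [chordsOf] at hp
    | cons b l =>
      rw [chordsOf] at hp
      split_ifs at hp with h
      · rcases List.mem_cons.1 hp with rfl | hp
        · simp
        · exact ⟨List.mem_cons_of_mem _ (ih hp).1, List.mem_cons_of_mem _ (ih hp).2⟩
      · exact ⟨List.mem_cons_of_mem _ (ih hp).1, List.mem_cons_of_mem _ (ih hp).2⟩

theorem isNested_chordsOf {l : List (Fin m)} (hl : l.Pairwise (· < ·)) :
    IsNested (chordsOf l) := by
  induction l with
  | nil => exact List.Pairwise.nil
  | cons a l ih =>
    cases l with
    | nil => exact List.Pairwise.nil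
    | cons b l =>
      obtain ⟨h1, h2⟩ := List.pairwise_cons.1 hl
      have hab := h1 b (by simp)
      rw [chordsOf, dif_pos hab]
      refine List.pairwise_cons.2 ⟨fun p hp => ?_, ih h2⟩
      have hb : ∀ x ∈ b :: l, b ≤ x := by
        intro x hx
        rcases List.mem_cons.1 hx with rfl | hx
        · exact le_rfl
        · exact ((List.pairwise_cons.1 h2).1 x hx).le
      have h3 := hb _ (mem_of_mem_chordsOf hp).1
      have h4 := hb _ (mem_of_mem_chordsOf hp).2
      simp only [SameSide, Fin.le_def, Fin.lt_def] at *
      omega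

theorem forall_chordsOf_iff {l : List (Fin m)} (hl : l.Pairwise (· < ·)) (f : Fin m → ℚ) :
    (∀ p ∈ chordsOf l, f p.1.1 = f p.1.2) ↔ ∀ a ∈ l, ∀ b ∈ l, f a = f b := by
  refine ⟨fun h => ?_, fun h p hp =>
    h _ (mem_of_mem_chordsOf hp).1 _ (mem_of_mem_chordsOf hp).2⟩
  induction l with
  | nil => simp
  | cons a l ih =>
    cases l with
    | nil => simp
    | cons b l =>
      obtain ⟨h1, h2⟩ := List.pairwise_cons.1 hl
      have hab := h1 b (by simp)
      rw [chordsOf, dif_pos hab, List.forall_mem_cons] at h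
      have h3 := ih h2 h.2
      have h4 : f a = f b := h.1
      have h5 : ∀ x ∈ a :: b :: l, f x = f b := by
        intro x hx
        rcases List.mem_cons.1 hx with rfl | hx
        · exact h4
        · exact h3 x hx b (by simp)
      intro x hx y hy
      rw [h5 x hx, h5 y hy]

variable {n : ℕ}

theorem prod_zipWith_chordTwist {l : List (Fin (2 * n))} (hl : l.Pairwise (· < ·)) :
    (List.zipWith (chordTwist n) l l.tail).prod = ((chordsOf l).map (chordGen n)).prod := by
  induction l with
  | nil => rfl
  | cons a l ih =>
    cases l with
    | nil => rfl
    | cons b l =>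
      obtain ⟨h1, h2⟩ := List.pairwise_cons.1 hl
      rw [chordsOf, dif_pos (h1 b (by simp)), List.map_cons, List.prod_cons, ← ih h2]
      simp [chordGen]

theorem IsNested.dualBraid_prod {L : List (Chord (2 * n))} (hL : IsNested L) :
    dualBraid n (L.map chordSwap).prod = (L.map (chordGen n)).prod :=
  isBandFamily_chordGen.isAtomic.spell_eq hL.red.2 hL.red.1

/-- The sides, up to one for each, of the polygons of a collection. -/
def collectionChords (Q : List (Finset (Fin m))) : List (Chord m) :=
  Q.flatMap fun P => chordsOf P.sort

theorem pairwise_lt_sort (P : Finset (Fin m)) : P.sort.Pairwise (· < ·) :=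
  (Finset.sortedLT_sort P).pairwise

theorem isNested_collectionChords {Q : List (Finset (Fin m))} (hQ : Q.Pairwise NonCrossing) :
    IsNested (collectionChords Q) := by
  rw [IsNested, collectionChords, List.pairwise_flatMap]
  refine ⟨fun P _ => isNested_chordsOf (pairwise_lt_sort P), hQ.imp ?_⟩
  intro P P' h p hp q hq
  obtain ⟨h1, h2⟩ := h
  obtain ⟨hp1, hp2⟩ := mem_of_mem_chordsOf hp
  obtain ⟨hq1, hq2⟩ := mem_of_mem_chordsOf hq
  rw [Finset.mem_sort] at hp1 hp2 hq1 hq2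
  have h3 := h2 _ hp1 _ hp2 _ hq1 _ hq2
  have h4 := h2 _ hp1 _ hp2 _ hq2 _ hq1
  have e1 := Finset.disjoint_left.1 h1 hp1
  have n1 : p.1.1 ≠ q.1.1 := fun e => e1 (e ▸ hq1)
  have n2 : p.1.1 ≠ q.1.2 := fun e => e1 (e ▸ hq2)
  have e2 := Finset.disjoint_left.1 h1 hp2
  have n3 : p.1.2 ≠ q.1.1 := fun e => e2 (e ▸ hq1)
  have n4 : p.1.2 ≠ q.1.2 := fun e => e2 (e ▸ hq2)
  have h5 := p.2
  have h6 := q.2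
  simp only [SameSide, Fin.le_def, Fin.lt_def, Ne, Fin.ext_iff] at *
  omega

theorem collectionRotation_eq (Q : List (Finset (Fin (2 * n)))) :
    collectionRotation n Q = ((collectionChords Q).map (chordGen n)).prod := by
  rw [collectionRotation, collectionChords, List.map_flatMap, List.flatMap_def, List.prod_flatten,
    List.map_map]
  congr 1
  refine List.map_congr_left fun P _ => ?_
  rw [polygonRotation, prod_zipWith_chordTwist (pairwise_lt_sort P)]
  rfl

theorem linked_collection_iff {Q : List (Finset (Fin m))} (hQ : Q.Pairwise NonCrossing)
    (i j : Fin m) : Linked ((collectionChords Q).map chordSwap).prod i j ↔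
      i = j ∨ ∃ P ∈ Q, i ∈ P ∧ j ∈ P := by
  classical
  have hf : ∀ f : Fin m → ℚ, (∀ p ∈ collectionChords Q, f p.1.1 = f p.1.2) ↔
      ∀ P ∈ Q, ∀ a ∈ P, ∀ b ∈ P, f a = f b := by
    intro f
    have h1 := fun P : Finset (Fin m) => forall_chordsOf_iff (pairwise_lt_sort P) f
    simp only [Finset.mem_sort] at h1
    simp only [← h1, collectionChords, List.mem_flatMap]
    exact ⟨fun h P hP p hp => h p ⟨P, hP, hp⟩, fun h p ⟨P, hP, hp⟩ => h P hP p hp⟩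
  rw [(isNested_collectionChords hQ).linked_iff]
  simp only [hf]
  constructor
  · intro h
    have h1 := h (fun x => if i = x ∨ ∃ P ∈ Q, i ∈ P ∧ x ∈ P then 1 else 0) ?_
    · by_contra h2
      simp [h2] at h1
    · intro P hP a ha b hb
      have key : ∀ a ∈ P, (i = a ∨ ∃ P ∈ Q, i ∈ P ∧ a ∈ P) → i ∈ P := by
        rintro a ha (rfl | ⟨P', hP', h1, h2⟩)
        · exact ha
        · by_cases e : P = P'
          · rwa [e]
          · have : Std.Symm fun P P' : Finset (Fin m) => Disjoint P P' := ⟨fun _ _ h => h.symm⟩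
            have := (hQ.imp fun h => h.1 : Q.Pairwise fun P P' => Disjoint P P').forall hP hP' e
            exact absurd h2 (Finset.disjoint_left.1 this ha)
      have : ∀ a ∈ P, (i = a ∨ ∃ P ∈ Q, i ∈ P ∧ a ∈ P) ↔ i ∈ P := fun a ha =>
        ⟨key a ha, fun hi => Or.inr ⟨P, hP, hi, ha⟩⟩
      simp only [this a ha, this b hb]
  · rintro (rfl | ⟨P, hP, hi, hj⟩) f hf
    · rfl
    · exact hf P hP i hi j hj

/-! ### Polygon collections correspond to noncrossing permutations -/

open Classical in
/-- The nontrivial blocks of a noncrossing permutation. -/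
noncomputable def blocks (u : Equiv.Perm (Fin m)) : List (Finset (Fin m)) :=
  ((Finset.univ.image fun x => Finset.univ.filter (Linked u x)).filter (2 ≤ ·.card)).toList

open Classical in
theorem mem_blocks {u : Equiv.Perm (Fin m)} {P : Finset (Fin m)} :
    P ∈ blocks u ↔ 2 ≤ P.card ∧ ∃ x, Finset.univ.filter (Linked u x) = P := by
  simp [blocks, and_comm]

theorem pairwise_blocks (u : Equiv.Perm (Fin m)) : (blocks u).Pairwise NonCrossing := by
  classical
  refine (Finset.nodup_toList _).pairwise_of_forall_ne ?_
  intro P hP P' hP' hne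
  obtain ⟨-, x, rfl⟩ := mem_blocks.1 hP
  obtain ⟨-, y, rfl⟩ := mem_blocks.1 hP'
  have key : ∀ a, Linked u x a → ¬ Linked u y a := by
    intro a h1 h2
    apply hne
    have h3 := h1.trans h2.symm
    ext z
    simp only [Finset.mem_filter, Finset.mem_univ, true_and]
    exact ⟨fun h => h3.symm.trans h, fun h => h3.trans h⟩
  refine ⟨Finset.disjoint_left.2 fun a ha hb => ?_, ?_⟩
  · simp only [Finset.mem_filter, Finset.mem_univ, true_and] at ha hb
    exact key a ha hb
  · intro a ha c hc b hb d hd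
    simp only [Finset.mem_filter, Finset.mem_univ, true_and] at ha hc hb hd
    refine ⟨fun ⟨h1, h2, h3⟩ => ?_, fun ⟨h1, h2, h3⟩ => ?_⟩
    · have := linked_of_crossing (ha.symm.trans hc) (hb.symm.trans hd) h1 h2 h3
      exact key b (ha.trans this) hb
    · have := linked_of_crossing (hb.symm.trans hd) (ha.symm.trans hc) h1 h2 h3
      exact key b (ha.trans this.symm) hb

theorem linked_iff_blocks (u : Equiv.Perm (Fin m)) (i j : Fin m) :
    Linked u i j ↔ i = j ∨ ∃ P ∈ blocks u, i ∈ P ∧ j ∈ P := by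
  classical
  constructor
  · intro h
    by_cases e : i = j
    · exact Or.inl e
    · refine Or.inr ⟨Finset.univ.filter (Linked u i), mem_blocks.2 ⟨?_, i, rfl⟩, ?_, ?_⟩
      · rw [Nat.succ_le_iff, Finset.one_lt_card]
        exact ⟨i, by simp [linked_refl], j, by simpa using h, e⟩
      · simp [linked_refl]
      · simpa using h
  · rintro (rfl | ⟨P, hP, hi, hj⟩)
    · exact linked_refl i
    · obtain ⟨-, x, rfl⟩ := mem_blocks.1 hP
      simp only [Finset.mem_filter, Finset.mem_univ, true_and] at hi hj
      exact hi.symm.trans hj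

theorem isPolygonCollection_blocks (u : Equiv.Perm (Fin (2 * n))) :
    IsPolygonCollection (blocks u) :=
  ⟨fun _ hP => (mem_blocks.1 hP).1, pairwise_blocks u⟩

theorem collectionRotation_blocks {u : Equiv.Perm (Fin (2 * n))} (hu : IsNC u) :
    collectionRotation n (blocks u) = dualBraid n u := by
  have h1 := isNested_collectionChords (pairwise_blocks u)
  rw [collectionRotation_eq, ← h1.dualBraid_prod]
  congr 1
  refine (simple_iff_isNC.1 h1.red.2).eq_of_linked_iff hu fun i j => ?_
  rw [linked_collection_iff (pairwise_blocks u), linked_iff_blocks]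

theorem dualSimpleA_eq :
    dualSimpleA n = dualBraid n '' {u | (dualGerm (2 * n)).Simple u} := by
  ext x
  constructor
  · rintro ⟨Q, hQ, rfl⟩
    have h1 := isNested_collectionChords hQ.2
    exact ⟨_, h1.red.2, by rw [h1.dualBraid_prod, collectionRotation_eq]⟩
  · rintro ⟨u, hu, rfl⟩
    exact ⟨blocks u, isPolygonCollection_blocks u,
      (collectionRotation_blocks (simple_iff_isNC.1 hu)).symm⟩

/-- If the chords connect all punctures, the product has a single block and is the long cycle,
whatever the chords are. This serves both for the sides of the full polygon and for the chords of `Ψ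
(s_n), …, Ψ (s_1)`. -/
theorem IsNested.dualBraid_finRotate {L : List (Chord (2 * n))} (hL : IsNested L)
    (h : ∀ f : Fin (2 * n) → ℚ, (∀ p ∈ L, f p.1.1 = f p.1.2) → ∀ i j, f i = f j) :
    (L.map (chordGen n)).prod = dualBraid n (finRotate (2 * n)) := by
  rw [← hL.dualBraid_prod]
  congr 1
  refine (simple_iff_isNC.1 hL.red.2).eq_of_linked_iff isNC_finRotate fun i j => ?_
  rw [hL.linked_iff]
  exact ⟨fun _ => linked_finRotate _ _, fun _ f hf => h f hf i j⟩

theorem deltaA_eq : deltaA n = dualBraid n (finRotate (2 * n)) := by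
  have hs := pairwise_lt_sort (Finset.univ : Finset (Fin (2 * n)))
  rw [deltaA, polygonRotation, prod_zipWith_chordTwist hs]
  refine (isNested_chordsOf hs).dualBraid_finRotate fun f hf i j => ?_
  exact (forall_chordsOf_iff hs f).1 hf i (by simp) j (by simp)

end ChordLists
/-! ### The half turn -/

section HalfTurn

open IntervalGerm

variable {n : ℕ}

theorem finRotate_pow_val {m : ℕ} (k : ℕ) (x : Fin m) :
    ((finRotate m ^ k) x).val = (x.val + k) % m := by
  induction k with
  | zero => simp [Nat.mod_eq_of_lt x.isLt]
  | succ k ih =>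
    have h := ((finRotate m ^ k) x).isLt
    rw [pow_succ', Equiv.Perm.mul_apply, finRotate_val, ih, ← add_assoc]
    rw [ih] at h
    rw [Nat.add_mod (x.val + k) 1 m]
    split_ifs with h1
    · rcases Nat.lt_or_ge 1 m with h2 | h2
      · rw [Nat.mod_eq_of_lt h2, h1, Nat.mod_self]
      · obtain rfl : m = 1 := by omega
        omega
    · rw [Nat.mod_eq_of_lt (a := 1) (by omega),
        Nat.mod_eq_of_lt (a := (x.val + k) % m + 1) (by omega)]

theorem halfTurn_eq (x : Fin (2 * n)) : halfTurn x = (finRotate (2 * n) ^ n) x := by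
  ext
  rw [finRotate_pow_val, halfTurn]

theorem halfTurn_val (x : Fin (2 * n)) :
    (halfTurn x).val = if x.val < n then x.val + n else x.val - n := by
  have := x.isLt
  change (x.val + n) % (2 * n) = _
  split_ifs with h
  · exact Nat.mod_eq_of_lt (by omega)
  · rw [show x.val + n = x.val - n + 2 * n by omega, Nat.add_mod_right,
      Nat.mod_eq_of_lt (by omega)]

theorem finRotate_pow_mul_dualBraid {u : Equiv.Perm (Fin (2 * n))}
    (hu : (dualGerm (2 * n)).Simple u) (k : ℕ) :
    (dualGerm (2 * n)).Simple (finRotate (2 * n) ^ k * u * (finRotate (2 * n) ^ k)⁻¹) ∧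
    deltaA n ^ k * dualBraid n u =
      dualBraid n (finRotate (2 * n) ^ k * u * (finRotate (2 * n) ^ k)⁻¹) * deltaA n ^ k := by
  induction k with
  | zero => simpa using hu
  | succ k ih =>
    obtain ⟨h1, h2⟩ := ih
    have e : finRotate (2 * n) ^ (k + 1) * u * (finRotate (2 * n) ^ (k + 1))⁻¹ =
        finRotate (2 * n) * (finRotate (2 * n) ^ k * u * (finRotate (2 * n) ^ k)⁻¹) *
          (finRotate (2 * n))⁻¹ := by
      rw [pow_succ']
      group
    rw [e]
    refine ⟨simple_conj' h1, ?_⟩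
    have h3 := dualBraid_realization.top_mul h1
    change dualBraid n (finRotate (2 * n)) * _ =
      dualBraid n (finRotate (2 * n) * _ * (finRotate (2 * n))⁻¹) *
        dualBraid n (finRotate (2 * n)) at h3
    rw [← deltaA_eq] at h3
    rw [pow_succ', mul_assoc, h2, ← mul_assoc, h3, mul_assoc]

theorem sigmaChord_val (i : Fin (2 * n - 1)) :
    (sigmaChord i).1.1.val = (if i.val < n then i.val else 3 * n - 2 - i.val) ∧
    (sigmaChord i).1.2.val = (if i.val + 1 < n then i.val + 1 else if i.val + 1 = n then 2 * n - 1
      else 3 * n - 1 - i.val) := by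
  rw [sigmaChord]
  split_ifs <;> first | omega | exact ⟨rfl, rfl⟩

theorem dualBraid_chordSwap (p : Chord (2 * n)) : dualBraid n (chordSwap p) = chordGen n p :=
  isBandFamily_chordGen.isAtomic.spell_atom p

/-- Conjugation by `δ` rotates the circle by one step, so its `n`-th power acts on chords by the
half turn, which exchanges the chords of `σ i` and `σ i.rev`. -/
theorem deltaA_pow_mul_sigma (i : Fin (2 * n - 1)) :
    deltaA n ^ n * σ i = σ i.rev * deltaA n ^ n := by
  have h1 := (finRotate_pow_mul_dualBraid (simple_chordSwap (sigmaChord i)) n).2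
  rw [dualBraid_chordSwap, chordGen_sigmaChord] at h1
  rw [h1, ← chordGen_sigmaChord i.rev, ← dualBraid_chordSwap]
  congr 2
  rw [chordSwap, ← Equiv.swap_apply_apply, ← halfTurn_eq, ← halfTurn_eq, chordSwap]
  have hi := i.isLt
  have h2 := sigmaChord_val i
  have h3 := sigmaChord_val i.rev
  rw [Fin.val_rev] at h3
  have h4 := halfTurn_val (sigmaChord i).1.1
  have h5 := halfTurn_val (sigmaChord i).1.2
  rw [h2.1] at h4
  rw [h2.2] at h5
  have h6 : (halfTurn (sigmaChord i).1.1 = (sigmaChord i.rev).1.1 ∧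
      halfTurn (sigmaChord i).1.2 = (sigmaChord i.rev).1.2) ∨
      (halfTurn (sigmaChord i).1.1 = (sigmaChord i.rev).1.2 ∧
      halfTurn (sigmaChord i).1.2 = (sigmaChord i.rev).1.1) := by
    simp only [Fin.ext_iff, h3.1, h3.2, h4, h5]
    clear h1 h2 h3 h4 h5
    rcases Nat.lt_trichotomy (i.val + 1) n with h | h | h
    · left
      split_ifs <;> omega
    -- The chord joining `p_1` and `q_1` is mapped to itself with its ends exchanged.
    · right
      split_ifs <;> omega
    · left
      split_ifs <;> omega
  rcases h6 with h6 | h6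
  · rw [h6.1, h6.2]
  · rw [h6.1, h6.2, Equiv.swap_comm]

theorem DeltaA_mul_sigma {m : ℕ} (i : Fin (m - 1)) : DeltaA m * σ i = σ i.rev * DeltaA m := by
  have h1 : ∀ i : Fin (m - 1), permBraid m (adjSwap i) = σ i :=
    (permGerm_isAtomic m).spell_atom
  rw [DeltaA_eq, ← h1, ← h1, rev_mul_permBraid]
  congr 2
  rw [adjSwap, ← Equiv.swap_apply_apply, Equiv.swap_comm, adjSwap]
  have hi := i.isLt
  congr 1 <;>
  · ext
    simp only [Fin.revPerm_apply, Fin.val_rev]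
    omega

/-- Both elements conjugate `σ i` to `σ i.rev`, so `Δ⁻¹ * δ ^ n` commutes with all generators and is
central. -/
theorem commute_deltaA_pow_iff (g : BraidGroup (2 * n)) :
    Commute (deltaA n ^ n) g ↔ Commute (DeltaA (2 * n)) g := by
  have hz : ∀ g : BraidGroup (2 * n), Commute ((DeltaA (2 * n))⁻¹ * deltaA n ^ n) g := by
    intro g
    have hg : g ∈ Subgroup.closure (Set.range (σ (m := 2 * n))) := by
      rw [closure_range_sigma]; trivial
    induction hg using Subgroup.closure_induction with
    | mem x hx =>
      obtain ⟨i, rfl⟩ := hx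
      rw [commute_iff_eq, mul_assoc, deltaA_pow_mul_sigma, ← mul_assoc, ← mul_assoc]
      congr 1
      rw [inv_mul_eq_iff_eq_mul, ← mul_assoc, DeltaA_mul_sigma, mul_inv_cancel_right]
    | one => exact Commute.one_right _
    | mul x y _ _ hx hy => exact hx.mul_right hy
    | inv x _ hx => exact hx.inv_right
  have e : deltaA n ^ n = DeltaA (2 * n) * ((DeltaA (2 * n))⁻¹ * deltaA n ^ n) := by group
  constructor
  · intro h
    have h1 := h.mul_left (hz g).inv_left
    rwa [mul_inv_rev, inv_inv, mul_inv_cancel_left] at h1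
  · intro h
    rw [e]
    exact h.mul_left (hz g)

/-- The chords of the arcs whose half twists make up `Ψ (s i)`. -/
def psiChords (i : Fin n) : List (Chord (2 * n)) :=
  if i.val = 0 then [sigmaChord ⟨n - 1, by have := i.isLt; omega⟩]
  else [sigmaChord ⟨n - 1 + i.val, by have := i.isLt; omega⟩,
    sigmaChord ⟨n - 1 - i.val, by have := i.isLt; omega⟩]

theorem prod_psiChords (i : Fin n) : ((psiChords i).map (chordGen n)).prod = psiGen n i := by
  rw [psiChords, psiGen]
  split_ifs <;> simp [chordGen_sigmaChord]

theorem mem_psiChords {i : Fin n} {p : Chord (2 * n)} (hp : p ∈ psiChords i) :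
    (i.val = 0 ∧ p.1.1.val = n - 1 ∧ p.1.2.val = 2 * n - 1) ∨
    (i.val ≠ 0 ∧ p.1.1.val = 2 * n - 1 - i.val ∧ p.1.2.val = 2 * n - i.val) ∨
    (i.val ≠ 0 ∧ p.1.1.val = n - 1 - i.val ∧ p.1.2.val = n - i.val) := by
  have hi := i.isLt
  rw [psiChords] at hp
  split_ifs at hp with h
  · rw [List.mem_singleton] at hp
    subst hp
    refine Or.inl ⟨h, ?_⟩
    rw [(sigmaChord_val _).1, (sigmaChord_val _).2]
    dsimp only
    split_ifs <;> omega
  · rw [List.mem_pair] at hp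
    rcases hp with rfl | rfl
    · refine Or.inr (Or.inl ⟨h, ?_⟩)
      rw [(sigmaChord_val _).1, (sigmaChord_val _).2]
      dsimp only
      split_ifs <;> omega
    · refine Or.inr (Or.inr ⟨h, ?_⟩)
      rw [(sigmaChord_val _).1, (sigmaChord_val _).2]
      dsimp only
      split_ifs <;> omega

theorem isNested_psiChords :
    IsNested (List.ofFn fun i : Fin n => psiChords i.rev).flatten := by
  rw [IsNested, List.pairwise_flatten, List.pairwise_ofFn]
  constructor
  · intro l hl
    obtain ⟨i, rfl⟩ := List.mem_ofFn.1 hl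
    have hi := i.isLt
    have h0 := i.rev.isLt
    generalize i.rev = i at h0
    rw [psiChords]
    split_ifs with h
    · simp
    · rw [List.pairwise_pair]
      simp only [SameSide, Fin.le_def, Fin.lt_def, (sigmaChord_val _).1, (sigmaChord_val _).2]
      split_ifs <;> omega
  · intro i j hij p hp q hq
    have h1 := mem_psiChords hp
    have h2 := mem_psiChords hq
    have hj := j.isLt
    have hij' : i.val < j.val := hij
    rw [Fin.val_rev] at h1 h2
    simp only [SameSide, Fin.le_def, Fin.lt_def]
    omega

/-- The chords are the arcs between neighbouring punctures on the line, so they form a path through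
all punctures; the proof walks outwards from its middle arc. -/
theorem forall_eq_of_psiChords (f : Fin (2 * n) → ℚ)
    (h : ∀ p ∈ (List.ofFn fun i : Fin n => psiChords i.rev).flatten, f p.1.1 = f p.1.2)
    (x : Fin (2 * n)) : f x = f ⟨2 * n - 1, by have := x.isLt; omega⟩ := by
  have hmem : ∀ (i : Fin n), ∀ p ∈ psiChords i, f p.1.1 = f p.1.2 := fun i p hp =>
    h p (List.mem_flatten.2 ⟨psiChords i, List.mem_ofFn.2 ⟨i.rev, by rw [Fin.rev_rev]⟩, hp⟩)
  have hf : ∀ (k : Fin (2 * n - 1)) (a b : Fin (2 * n)), (sigmaChord k).1.1 = a →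
      (sigmaChord k).1.2 = b → f a = f b := by
    rintro k a b rfl rfl
    have hk := k.isLt
    rcases Nat.lt_trichotomy (k.val + 1) n with h1 | h1 | h1
    · refine hmem ⟨n - 1 - k.val, by omega⟩ _ ?_
      rw [psiChords, if_neg (by dsimp only; omega), List.mem_pair]
      right
      congr 1
      ext
      dsimp only
      omega
    · refine hmem ⟨0, by omega⟩ _ ?_
      rw [psiChords, if_pos rfl, List.mem_singleton]
      congr 1
      ext
      dsimp only
      omega
    · refine hmem ⟨k.val + 1 - n, by omega⟩ _ ?_
      rw [psiChords, if_neg (by dsimp only; omega), List.mem_pair]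
      left
      congr 1
      ext
      dsimp only
      omega
  have hstep : ∀ k (hk : k + 1 < 2 * n), k + 1 ≠ n →
      f ⟨k, by omega⟩ = f ⟨k + 1, hk⟩ := by
    intro k hk hkn
    by_cases h1 : k + 1 < n
    · refine hf ⟨k, by omega⟩ _ _ (Fin.ext ?_) (Fin.ext ?_)
      · rw [(sigmaChord_val _).1]; dsimp only; split_ifs <;> omega
      · rw [(sigmaChord_val _).2]; dsimp only; split_ifs; omega
    · refine hf ⟨3 * n - 2 - k, by omega⟩ _ _ (Fin.ext ?_) (Fin.ext ?_)
      · rw [(sigmaChord_val _).1]; dsimp only; split_ifs <;> omega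
      · rw [(sigmaChord_val _).2]; dsimp only; split_ifs <;> omega
  have hx := x.isLt
  have hmid : f ⟨n - 1, by omega⟩ = f ⟨2 * n - 1, by omega⟩ := by
    refine hf ⟨n - 1, by omega⟩ _ _ (Fin.ext ?_) (Fin.ext ?_)
    · rw [(sigmaChord_val _).1]; dsimp only; split_ifs <;> omega
    · rw [(sigmaChord_val _).2]; dsimp only; split_ifs <;> omega
  have right : ∀ d, d < n → ∀ h : 2 * n - 1 - d < 2 * n,
      f ⟨2 * n - 1 - d, h⟩ = f ⟨2 * n - 1, by omega⟩ := by
    intro d hd h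
    induction d with
    | zero => rfl
    | succ d ih =>
      rw [← ih (by omega) (by omega), hstep _ (by omega) (by omega)]
      congr 2
      omega
  have left : ∀ d, d < n → ∀ h : n - 1 - d < 2 * n,
      f ⟨n - 1 - d, h⟩ = f ⟨2 * n - 1, by omega⟩ := by
    intro d hd h
    induction d with
    | zero => exact hmid
    | succ d ih =>
      rw [← ih (by omega) (by omega), hstep _ (by omega) (by omega)]
      congr 2
      omega
  by_cases h1 : x.val < n
  · rw [← left (n - 1 - x.val) (by omega) (by omega)]
    congr 1
    ext
    dsimp only
    omega
  · rw [← right (2 * n - 1 - x.val) (by omega) (by omega)]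
    congr 1
    ext
    dsimp only
    omega

theorem Psi_deltaB : Psi n (deltaB n) = deltaA n := by
  rw [deltaA_eq, ← isNested_psiChords.dualBraid_finRotate fun f hf i j => by
    rw [forall_eq_of_psiChords f hf i, forall_eq_of_psiChords f hf j], deltaB, map_list_prod,
    List.map_flatten, List.prod_flatten, List.map_map, List.map_ofFn, List.map_ofFn]
  congr 2
  ext i
  simp only [Function.comp_apply, Psi_s, prod_psiChords]

theorem Psi_isCentralizerEmbedding_delta (hn : 1 ≤ n) :
    IsCentralizerEmbedding (Psi n) (deltaA n) (deltaB n) n where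
  injective := Psi_injective hn
  map_top := Psi_deltaB
  exists_iff g := by
    rw [commute_deltaA_pow_iff, (Psi_isCentralizerEmbedding_Delta hn).exists_iff, pow_one]

theorem linked_halfTurn_iff {u : Equiv.Perm (Fin (2 * n))} (hu : IsNC u)
    (hc : Commute (finRotate (2 * n) ^ n) u) (i j : Fin (2 * n)) :
    Linked u (halfTurn i) (halfTurn j) ↔ Linked u i j := by
  have hc' : ∀ x, (finRotate (2 * n) ^ n) (u x) = u ((finRotate (2 * n) ^ n) x) := fun x =>
    congrArg (fun w : Equiv.Perm (Fin (2 * n)) => w x) hc.eq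
  rw [hu.linked_iff, hu.linked_iff, halfTurn_eq, halfTurn_eq]
  constructor
  · intro h f hf
    have := h (fun x => f ((finRotate (2 * n) ^ n)⁻¹ x)) fun x => by
      have h1 := hc.inv_left
      have h2 : ((finRotate (2 * n) ^ n)⁻¹) (u x) = u ((finRotate (2 * n) ^ n)⁻¹ x) :=
        congrArg (fun w : Equiv.Perm (Fin (2 * n)) => w x) h1.eq
      beta_reduce
      rw [h2, hf]
    simpa using this
  · intro h f hf
    exact h (fun x => f ((finRotate (2 * n) ^ n) x)) fun x => by beta_reduce; rw [hc', hf]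

theorem isSymmetric_blocks {u : Equiv.Perm (Fin (2 * n))} (hu : IsNC u)
    (hc : Commute (finRotate (2 * n) ^ n) u) : IsSymmetric (blocks u) := by
  classical
  have hinj : Function.Injective (halfTurn (n := n)) := fun x y h => by
    rw [halfTurn_eq, halfTurn_eq] at h
    exact (finRotate (2 * n) ^ n).injective h
  have hinv : ∀ x : Fin (2 * n), halfTurn (halfTurn x) = x := fun x => by
    have := x.isLt
    ext
    rw [halfTurn_val, halfTurn_val]
    split_ifs <;> omega
  intro P hP
  obtain ⟨h1, x, rfl⟩ := mem_blocks.1 hP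
  refine mem_blocks.2 ⟨by rwa [Finset.card_image_of_injective _ hinj], halfTurn x, ?_⟩
  ext y
  simp only [Finset.mem_filter, Finset.mem_univ, true_and, Finset.mem_image]
  constructor
  · intro h
    refine ⟨halfTurn y, ?_, hinv y⟩
    rwa [← linked_halfTurn_iff hu hc, hinv]
  · rintro ⟨z, hz, rfl⟩
    rwa [linked_halfTurn_iff hu hc]

/-- A dual simple braid in the image commutes with `δ ^ n`, so its permutation commutes with the
half turn, and its blocks form an invariant collection of polygons. -/
theorem dualSimpleB_eq (hn : 1 ≤ n) : dualSimpleB n = Psi n ⁻¹' dualSimpleA n := by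
  ext y
  constructor
  · rintro ⟨Q, h1, -, h2⟩
    exact ⟨Q, h1, h2⟩
  · intro h
    rw [Set.mem_preimage, dualSimpleA_eq] at h
    obtain ⟨u, hu, h⟩ := h
    have h1 : Commute (deltaA n ^ n) (dualBraid n u) :=
      ((Psi_isCentralizerEmbedding_delta hn).exists_iff _).1 ⟨y, h.symm⟩
    obtain ⟨h2, h3⟩ := finRotate_pow_mul_dualBraid hu n
    rw [h1.eq, mul_left_inj] at h3
    have h4 := dualBraid_realization.injOn dualGerm_hasMeets hu h2 h3
    have hc : Commute (finRotate (2 * n) ^ n) u := by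
      rw [commute_iff_eq]
      exact (eq_mul_inv_iff_mul_eq.1 h4).symm
    have hN := simple_iff_isNC.1 hu
    exact ⟨blocks u, isPolygonCollection_blocks u, isSymmetric_blocks hN hc,
      by rw [collectionRotation_blocks hN, h]⟩

theorem isGarside_dualSimpleA (hn : 1 ≤ n) : IsGarside (dualSimpleA n) (deltaA n) := by
  rw [dualSimpleA_eq, deltaA_eq]
  exact isGarside_dualBraid hn

theorem isGarside_dualSimpleA_op (hn : 1 ≤ n) :
    IsGarside (MulOpposite.unop ⁻¹' dualSimpleA n) (MulOpposite.op (deltaA n)) := by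
  rw [dualSimpleA_eq, deltaA_eq]
  exact isGarside_dualBraid_op hn

end HalfTurn
end ArtinB


/-! ### The theorem -/

open ArtinB in
theorem corollary4p2 (n : ℕ) (hn : 1 ≤ n) :
    Function.Injective (Psi n) ∧
    Psi n (DeltaB n) = DeltaA (2 * n) ∧
    Psi n (deltaB n) = deltaA n ∧
    -- simple elements generate, so the word metrics are defined
    Subgroup.closure (classicalSimpleB n) = ⊤ ∧
    Subgroup.closure (classicalSimpleA (2 * n)) = ⊤ ∧
    Subgroup.closure (dualSimpleB n) = ⊤ ∧
    Subgroup.closure (dualSimpleA n) = ⊤ ∧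
    -- classical normal forms, left-greedy and right-greedy
    (∀ β : ArtinGroupB n,
      (∃! w : List (ArtinGroupB n) × ℤ,
        IsLeftNormalForm (classicalSimpleB n) (DeltaB n) β w.1 w.2) ∧
      (∃! w : List (BraidGroup (2 * n)) × ℤ,
        IsLeftNormalForm (classicalSimpleA (2 * n)) (DeltaA (2 * n)) (Psi n β) w.1 w.2) ∧
      ∀ (xs : List (ArtinGroupB n)) (p : ℤ),
        IsLeftNormalForm (classicalSimpleB n) (DeltaB n) β xs p →
        IsLeftNormalForm (classicalSimpleA (2 * n)) (DeltaA (2 * n)) (Psi n β)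
          (xs.map (Psi n)) p) ∧
    (∀ β : ArtinGroupB n,
      (∃! w : List (ArtinGroupB n) × ℤ,
        IsRightNormalForm (classicalSimpleB n) (DeltaB n) β w.1 w.2) ∧
      (∃! w : List (BraidGroup (2 * n)) × ℤ,
        IsRightNormalForm (classicalSimpleA (2 * n)) (DeltaA (2 * n)) (Psi n β) w.1 w.2) ∧
      ∀ (xs : List (ArtinGroupB n)) (p : ℤ),
        IsRightNormalForm (classicalSimpleB n) (DeltaB n) β xs p →
        IsRightNormalForm (classicalSimpleA (2 * n)) (DeltaA (2 * n)) (Psi n β)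
          (xs.map (Psi n)) p) ∧
    -- dual normal forms, left-greedy and right-greedy
    (∀ β : ArtinGroupB n,
      (∃! w : List (ArtinGroupB n) × ℤ,
        IsLeftNormalForm (dualSimpleB n) (deltaB n) β w.1 w.2) ∧
      (∃! w : List (BraidGroup (2 * n)) × ℤ,
        IsLeftNormalForm (dualSimpleA n) (deltaA n) (Psi n β) w.1 w.2) ∧
      ∀ (ys : List (ArtinGroupB n)) (q : ℤ),
        IsLeftNormalForm (dualSimpleB n) (deltaB n) β ys q →
        IsLeftNormalForm (dualSimpleA n) (deltaA n) (Psi n β) (ys.map (Psi n)) q) ∧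
    (∀ β : ArtinGroupB n,
      (∃! w : List (ArtinGroupB n) × ℤ,
        IsRightNormalForm (dualSimpleB n) (deltaB n) β w.1 w.2) ∧
      (∃! w : List (BraidGroup (2 * n)) × ℤ,
        IsRightNormalForm (dualSimpleA n) (deltaA n) (Psi n β) w.1 w.2) ∧
      ∀ (ys : List (ArtinGroupB n)) (q : ℤ),
        IsRightNormalForm (dualSimpleB n) (deltaB n) β ys q →
        IsRightNormalForm (dualSimpleA n) (deltaA n) (Psi n β) (ys.map (Psi n)) q) ∧
    -- isometric embedding for both word metrics
    (∀ β γ : ArtinGroupB n,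
      wordDist (classicalSimpleA (2 * n)) (Psi n β) (Psi n γ) =
        wordDist (classicalSimpleB n) β γ) ∧
    (∀ β γ : ArtinGroupB n,
      wordDist (dualSimpleA n) (Psi n β) (Psi n γ) = wordDist (dualSimpleB n) β γ) := by
  have hA := isGarside_classicalSimpleA (m := 2 * n) (by omega)
  have hA' := isGarside_classicalSimpleA_op (m := 2 * n) (by omega)
  rw [← DeltaA_eq] at hA hA'
  have hd := isGarside_dualSimpleA hn
  have hd' := isGarside_dualSimpleA_op hn
  have e := Psi_isCentralizerEmbedding_Delta hn
  have e' := Psi_isCentralizerEmbedding_delta hn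
  -- Both sets of simple elements of `A(B_n)` are now preimages, the form in which the transfer
  -- results apply.
  rw [classicalSimpleB_eq hn, dualSimpleB_eq hn]
  exact ⟨e.injective, e.map_top, e'.map_top, (hA.preimage e).closure_eq_top, hA.closure_eq_top,
    (hd.preimage e').closure_eq_top, hd.closure_eq_top,
    fun β => ⟨(hA.preimage e).existsUnique_isLeftNormalForm β,
      hA.existsUnique_isLeftNormalForm _, fun _ _ hw => hA.isLeftNormalForm_map e hw⟩,
    fun β => ⟨(hA'.preimage_op e).existsUnique_isRightNormalForm β,
      hA'.existsUnique_isRightNormalForm _, fun _ _ hw => isRightNormalForm_map hA' e hw⟩,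
    fun β => ⟨(hd.preimage e').existsUnique_isLeftNormalForm β,
      hd.existsUnique_isLeftNormalForm _, fun _ _ hw => hd.isLeftNormalForm_map e' hw⟩,
    fun β => ⟨(hd'.preimage_op e').existsUnique_isRightNormalForm β,
      hd'.existsUnique_isRightNormalForm _, fun _ _ hw => isRightNormalForm_map hd' e' hw⟩,
    hA.wordDist_map e, hd.wordDist_map e'⟩
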